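/- Let $d\ge 1$ and let $\mathsf M$ be a wide-sense stationary $L^2$ random signed measure on $\mathbb R^d$: a family of square integrable real random variables $I_{\mathsf M}(f)$, indexed by the bounded measurable compactly supported $f:\mathbb R^d\to\mathbb R$, almost surely linear and $\sigma$-additive in $f$, with $\mathbf E\, I_{\mathsf M}(f)=\lambda\int f$ for some constant $\lambda$ and with $\mathrm{Var}(I_{\mathsf M}(f))$ invariant under translations of $f$; put $I_{\mathsf M}(f)=I_{\mathsf M}(\mathrm{Re} f)+i\,I_{\mathsf M}(\mathrm{Im} f)$ for complex $f$. Let $\mathsf S$ be its spectral measure, i.e. the measure on $\mathbb R^d$ with $\mathrm{Var}(I_{\mathsf M}(f))=\int|\hat f|^2\,d\mathsf S$ for all bounded measurable compactly supported $f:\mathbb R^d\to\mathbb C$, where $\hat f(u)=\int e^{-i\langle u,t\rangle}f(t)\,dt$, and let $\mathsf s:\mathbb R^d\to[0,\infty)$ be the density of the absolutely continuous part of $\mathsf S$ (with $1/0=\infty$ in $\mathsf s^{-1}$). For a bounded measurable set $A$ and a function $\gamma$ that is measurable and bounded on $A$, $\mathsf M$ is (linearly) $\gamma$-rigid on $A$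 if $I_{\mathsf M}(\gamma 1_A)=\lim_n I_{\mathsf M}(h_n)$ almost surely and in $L^2$ for some bounded measurable compactly supported $h_n$ vanishing on $A$; it is maximally linearly rigid on $A$ if this holds for all bounded measurable compactly supported $\gamma$. For $\eta>0$ let $A^{+\eta}=\bigcup_{t\in A}B(t,\eta)$. For $\boldsymbol\kappa\in\mathbb N^d$, $\mathsf s^{-1}$ has a pole of order $\boldsymbol\kappa$ at $u_0$ if $a_{\boldsymbol\kappa}=0$ for every complex polynomial $P(u)=\sum_{\mathbf m}a_{\mathbf m}(u-u_0)^{\mathbf m}$ such that $\int_{B(u_0,\varepsilon)}|P|^2\mathsf s^{-1}<\infty$ for some $\varepsilon>0$; a pole is a pole of order $0$, and it has finite order if $\int_{B(u_0,\varepsilon)}\|u-u_0\|^{2q}\,\mathsf s(u)^{-1}du<\infty$ for some $\varepsilon>0$, $q\in\mathbb N$. Call $\mathsf s$ simple if $\mathsf s^{-1}$ has finitely many poles, all of finite order, and for some $\varepsilon,c>0$ and $p\in\mathbb N$, $\mathsf s(u)\ge c(1+\|u\|)^{-p}$ for all $u$ at distance at least $\varepsilon$ from the poles; isotropic if $\mathsf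 s(u)$ depends only on $\|u\|$; separable if $\mathsf s(u)=\prod_{i=1}^d\mathsf s_i(u_i)$ for some even $\mathsf s_i:\mathbb R\to[0,\infty)$. Write $\preceq$ for the coordinatewise order on $\mathbb N^d$. A complex polynomial $Q(t)=\sum_{\mathbf m}a_{\mathbf m}t^{\mathbf m}$ is a $\boldsymbol\kappa$-polynomial if there is $\boldsymbol\kappa_0\succeq\boldsymbol\kappa$ with $a_{\boldsymbol\kappa_0}\ne0$ and $\mathbf m\preceq\boldsymbol\kappa_0$ whenever $a_{\mathbf m}\neq0$. Let $\boldsymbol\kappa\in\mathbb N^d$, assume that $\mathsf s^{-1}$ does not have a pole of order $\boldsymbol\kappa$ at $0$, and let $Q$ be a $\boldsymbol\kappa$-polynomial. Then: (i) if $\mathsf s$ is simple, $\mathsf M$ is not linearly $Q$-rigid on $B(0,\eta)$, for any $\eta>0$; (ii) if $\mathsf s$ is isotropic and, for some $R>0$, $\mathsf M$ is not maximally linearly rigid on the closed ball $A=\overline B(0,R)$, then $\mathsf M$ is not linearly $Q$-rigid on $A^{+\eta}$, for any $\eta>0$; (iii) if $\mathsf s$ is separable and, for some $R>0$, $\mathsf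 M$ is not maximally linearly rigid on $A=[-R,R]^d$, then $\mathsf M$ is not linearly $Q$-rigid on $A^{+\eta}$, for any $\eta>0$. Thus in these cases no relation $\sum_{\mathbf m}a_{\mathbf m}\int t^{\mathbf m}d\mathsf M\in\sigma_{lin}(\mathsf M_{\text{outside}})$, with the integrals over the set in question, holds with the coefficients of a $\boldsymbol\kappa$-polynomial. -/

import Mathlib

open MeasureTheory Filter Topology
open scoped NNReal ENNReal

noncomputable section

namespace LinearRigidity

/-- The Euclidean space `ℝ^d`. -/
abbrev Space (d : ℕ) : Type := EuclideanSpace ℝ (Fin d)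

/-- Measurable bounded functions with compact support on `ℝ^d`. -/
def IsTestFunction {d : ℕ} {F : Type*} [NormedAddCommGroup F] [MeasurableSpace F]
    (f : Space d → F) : Prop :=
  Measurable f ∧ (∃ C : ℝ, ∀ t, ‖f t‖ ≤ C) ∧ HasCompactSupport f

/-- An `L²` random signed measure on `ℝ^d`, given by its linear statistics: square integrable real
random variables `I f`, indexed by the bounded measurable compactly supported `f`, that are almost
surely linear and almost surely σ-additive (the values of `I` at functions that are not test
functions carry no meaning and are never used). -/
structure RandomMeasure (d : ℕ) {Ω : Type*} [MeasurableSpace Ω] (P : Measure Ω) where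
  /-- the linear statistic `I f = ∫ f dM` -/
  I : (Space d → ℝ) → Ω → ℝ
  memLp : ∀ f, IsTestFunction f → MemLp (I f) 2 P
  add : ∀ f g, IsTestFunction f → IsTestFunction g →
    ∀ᵐ ω ∂P, I (fun t => f t + g t) ω = I f ω + I g ω
  smul : ∀ (c : ℝ) (f), IsTestFunction f → ∀ᵐ ω ∂P, I (fun t => c * f t) ω = c * I f ω
  sigma_additive : ∀ f, IsTestFunction f → ∀ B : ℕ → Set (Space d),
    (∀ n, MeasurableSet (B n)) → Pairwise (fun m n => Disjoint (B m) (B n)) →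
    ∀ᵐ ω ∂P, Tendsto (fun N : ℕ => ∑ n ∈ Finset.range N, I ((B n).indicator f) ω) atTop
      (𝓝 (I ((⋃ n, B n).indicator f) ω))

section

variable {d : ℕ} {Ω : Type*} [MeasurableSpace Ω] {P : Measure Ω}

/-- The linear statistic of a complex valued function. -/
def RandomMeasure.statistic (M : RandomMeasure d P) (f : Space d → ℂ) (ω : Ω) : ℂ :=
  (M.I (fun t => (f t).re) ω : ℂ) + Complex.I * (M.I (fun t => (f t).im) ω : ℂ)

/-- Wide-sense stationarity: there is a mean intensity `lam`, and the variances of the linear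
statistics are invariant under translations. -/
def RandomMeasure.IsWideSenseStationary (M : RandomMeasure d P) : Prop :=
  (∃ lam : ℝ, ∀ f, IsTestFunction f → ∫ ω, M.I f ω ∂P = lam * ∫ t, f t) ∧
  ∀ f, IsTestFunction f → ∀ x : Space d,
    ProbabilityTheory.variance (M.I (fun t => f (t - x))) P =
      ProbabilityTheory.variance (M.I f) P

/-- The variance `E |X - E X|²` of a complex random variable. -/
def complexVariance (X : Ω → ℂ) (P : Measure Ω) : ℝ :=
  ∫ ω, ‖X ω - ∫ ω', X ω' ∂P‖ ^ 2 ∂P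

/-- The Fourier transform `u ↦ ∫ e^{-i ⟨u, t⟩} f t dt`. -/
def fourier (f : Space d → ℂ) (u : Space d) : ℂ :=
  ∫ t, Complex.exp (-Complex.I * ((inner ℝ u t : ℝ) : ℂ)) * f t

/-- `S` is the spectral measure of `M`: the variance of the statistic of `f` is `∫ |f̂|² dS` for all
test functions `f`, complex valued ones included (which forces `S` to be even). -/
def RandomMeasure.IsSpectralMeasure (M : RandomMeasure d P) (S : Measure (Space d)) : Prop :=
  ∀ f : Space d → ℂ, IsTestFunction f →
    ∫⁻ u, ‖fourier f u‖ₑ ^ 2 ∂S = ENNReal.ofReal (complexVariance (M.statistic f) P)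

/-- `s` is (a version of) the density of the absolutely continuous part of `S`. -/
def IsSpectralDensity (S : Measure (Space d)) (s : Space d → ℝ≥0) : Prop :=
  Measurable s ∧ ∃ ν : Measure (Space d), ν ⟂ₘ volume ∧
    S = (volume : Measure (Space d)).withDensity (fun u => (s u : ℝ≥0∞)) + ν

/-- The statistic of `f` is the limit, almost surely and in `L²`, of statistics of test functions
that vanish on `A`. -/
def RandomMeasure.IsLinearlyPredictable (M : RandomMeasure d P) (A : Set (Space d))
    (f : Space d → ℂ) : Prop :=
  ∃ h : ℕ → Space d → ℂ, (∀ n, IsTestFunction (h n) ∧ ∀ t ∈ A, h n t = 0) ∧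
    Tendsto (fun n => eLpNorm (fun ω => M.statistic f ω - M.statistic (h n) ω) 2 P) atTop (𝓝 0) ∧
    ∀ᵐ ω ∂P, Tendsto (fun n => M.statistic (h n) ω) atTop (𝓝 (M.statistic f ω))

/-- Linear `γ`-rigidity on a bounded set `A`: `∫_A γ dM` is a limit of linear statistics of the
restriction of `M` to the complement of `A`. -/
def RandomMeasure.IsLinearlyRigid (M : RandomMeasure d P) (A : Set (Space d))
    (γ : Space d → ℂ) : Prop :=
  M.IsLinearlyPredictable A (A.indicator γ)

/-- Maximal linear rigidity on `A`. -/
def RandomMeasure.IsMaximallyLinearlyRigid (M : RandomMeasure d P) (A : Set (Space d)) : Prop :=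
  ∀ γ : Space d → ℂ, IsTestFunction γ → M.IsLinearlyRigid A γ

/-- A complex polynomial as a function on `ℝ^d`. -/
def polyFun (Q : MvPolynomial (Fin d) ℂ) (u : Space d) : ℂ :=
  MvPolynomial.eval (fun i => (u i : ℂ)) Q

/-- `s⁻¹` (with `0⁻¹ = ∞`) has a pole of order `κ` at `u₀`: for every polynomial
`Q = ∑ a_m (u - u₀)^m` whose square modulus is integrable against `s⁻¹` around `u₀`, the
coefficient `a_κ` vanishes. -/
def HasPoleOfOrder (s : Space d → ℝ≥0) (u₀ : Space d) (κ : Fin d →₀ ℕ) : Prop :=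
  ∀ Q : MvPolynomial (Fin d) ℂ,
    (∃ ε : ℝ, 0 < ε ∧
      ∫⁻ u in Metric.ball u₀ ε, ‖polyFun Q (u - u₀)‖ₑ ^ 2 * (s u : ℝ≥0∞)⁻¹ < ∞) →
    Q.coeff κ = 0

/-- A pole of `s⁻¹`, that is, a pole of order `0`. -/
def IsPole (s : Space d → ℝ≥0) (u₀ : Space d) : Prop :=
  HasPoleOfOrder s u₀ 0

/-- `∫ ‖u - u₀‖^(2q) / s(u) du` is finite around `u₀` for some `q`. -/
def HasFiniteOrder (s : Space d → ℝ≥0) (u₀ : Space d) : Prop :=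
  ∃ ε : ℝ, 0 < ε ∧ ∃ q : ℕ,
    ∫⁻ u in Metric.ball u₀ ε, ‖u - u₀‖ₑ ^ (2 * q) * (s u : ℝ≥0∞)⁻¹ < ∞

/-- Simple spectral densities: finitely many poles of `s⁻¹`, all of finite order, and a polynomial
lower bound for `s` at distance at least `ε` from them. -/
def IsSimple (s : Space d → ℝ≥0) : Prop :=
  {u₀ | IsPole s u₀}.Finite ∧ (∀ u₀, IsPole s u₀ → HasFiniteOrder s u₀) ∧
  ∃ ε : ℝ, 0 < ε ∧ ∃ c : ℝ, 0 < c ∧ ∃ p : ℕ,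
    ∀ u, (∀ u₀, IsPole s u₀ → ε ≤ dist u u₀) → c / (1 + ‖u‖) ^ p ≤ (s u : ℝ)

/-- `s(u)` depends only on `‖u‖`. -/
def IsIsotropic (s : Space d → ℝ≥0) : Prop :=
  ∀ u v, ‖u‖ = ‖v‖ → s u = s v

/-- `s(u)` is the product of even functions of the coordinates. -/
def IsSeparable (s : Space d → ℝ≥0) : Prop :=
  ∃ s' : Fin d → ℝ → ℝ≥0, (∀ i x, s' i (-x) = s' i x) ∧ ∀ u, s u = ∏ i, s' i (u i)

end

/-- The cube `[-R, R]^d`. -/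
def cube (d : ℕ) (R : ℝ) : Set (Space d) := {t | ∀ i, t i ∈ Set.Icc (-R) R}

/-- `κ`-polynomials: for some `κ₀ ≥ κ` (coordinatewise) the coefficient of order `κ₀` is not zero,
and all nonzero coefficients have order at most `κ₀` (coordinatewise). -/
def IsOrderPolynomial {d : ℕ} (κ : Fin d →₀ ℕ) (Q : MvPolynomial (Fin d) ℂ) : Prop :=
  ∃ κ₀ : Fin d →₀ ℕ, κ ≤ κ₀ ∧ Q.coeff κ₀ ≠ 0 ∧ ∀ m, Q.coeff m ≠ 0 → m ≤ κ₀

end LinearRigidity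

end

namespace LinearRigidity

/-! ### Stability properties of test functions. -/

section TestFunctions

variable {d : ℕ} {F : Type*} [NormedAddCommGroup F] [MeasurableSpace F]

/-! Rigidity is an approximation problem in a weighted L² space. With `S' = S + lam² δ₀`, which has
the same absolutely continuous part as `S`, second moments of statistics are `∫ |f̂|² dS'`
(`exists_moment_measure`). So rigidity of `A` for `Q` says that `1_A Q - h_n` has Fourier transform
tending to 0 in L²(S'), for some test functions `h_n` vanishing on `A`.

The obstruction is a dual function (`not_isLinearlyRigid`). Let `φ = p f` be Schwartz, with `φ̂`
supported in `A` and `∫ |φ|²/s < ∞`. Moving the Fourier transform across, `∫ (1_A Q - h_n)^ φ = ∫ Q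
φ̂` for every `n`, while Cauchy-Schwarz with weights `s` and `1/s` sends the left side to 0.
Rigidity therefore forces `∫ Q φ̂ = 0`. Integration by parts shows that the monomials `t^k` and
`u^m` pair to zero unless `m ≤ k`, and that `t^k` and `u^k` pair to a nonzero multiple of `∫ f̂ =
(2π)^d f(0)`. If `κ₀` is the top exponent of `Q`, and `p` has a nonzero coefficient at `κ₀` but none
strictly below it, the pairing is thus nonzero (`fourierPairing_ne_zero`). It remains to construct
`p` and `f`.

Simple `s`: take `κ' ≤ κ` minimal among the exponents at which there is no pole at 0. Minimality
kills all coefficients strictly below `κ'` in any polynomial admissible at 0. A witness for `κ'`,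
times powers of `‖u - v‖²` at the other poles `v` and the monomial `u^(κ₀ - κ')`, serves as `p`, and
any `f` with `f 0 ≠ 0` and `f̂` supported in a small ball will do.

Isotropic or separable `s`: failure of maximal rigidity gives a nonzero `c` in L²(S') orthogonal to
all `ĥ` with `h = 0` on `A`. Multiplied by a function `r` with `r̂` of small support, the measure `c
r dS'` has a smooth Fourier transform supported near `A`, so it equals `ψ du` with `ψ` Schwartz. Its
singular part vanishes and `ψ = s c r`, whence `∫ |ψ|²/s < ∞` (`exists_schwartz_of_orthogonal`).
This `ψ` may vanish at 0, so it is replaced. On a well chosen line `ψ` extends to an entire function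
of exponential type. Its even or odd part, divided by the largest power of `z`, is an even entire
`g` of the same type with `g 0 ≠ 0` (`PaleyWiener.exists_even_quotient`). Then `g(‖u‖)`,
respectively `∏ g_i(u_i)`, has Fourier transform supported in the slightly enlarged ball,
respectively cube; the radial case is a contour shift (`integral_radial_eq_zero`). Square
integrability of `u^κ₀` times this function against `1/s` comes near 0 from the absence of a pole of
order `κ`, transported by the symmetry of `s`, and far from 0 from `ψ`. -/

theorem IsTestFunction.comp [BorelSpace F] {G : Type*} [NormedAddCommGroup G] [MeasurableSpace G]
    [BorelSpace G] {f : Space d → F} (hf : IsTestFunction f) {φ : F → G} {K : ℝ}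
    (hφ : Continuous φ) (hK : ∀ x, ‖φ x‖ ≤ K * ‖x‖) :
    IsTestFunction (fun t => φ (f t)) := by
  obtain ⟨hm, ⟨C, hC⟩, hs⟩ := hf
  have h0 : φ 0 = 0 := by simpa using hK 0
  refine ⟨hφ.measurable.comp hm, ⟨|K| * C, fun t => (hK _).trans ?_⟩, hs.comp_left h0⟩
  have := hC t
  have := abs_nonneg K
  nlinarith [le_abs_self K, norm_nonneg (f t)]

theorem IsTestFunction.add [BorelSpace F] [SecondCountableTopology F] {f g : Space d → F}
    (hf : IsTestFunction f) (hg : IsTestFunction g) :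
    IsTestFunction (fun t => f t + g t) := by
  obtain ⟨hm, ⟨C, hC⟩, hs⟩ := hf
  obtain ⟨hm', ⟨C', hC'⟩, hs'⟩ := hg
  exact ⟨hm.add hm', ⟨C + C', fun t => (norm_add_le _ _).trans (add_le_add (hC t) (hC' t))⟩,
    hs.add hs'⟩

theorem IsTestFunction.neg [BorelSpace F] {f : Space d → F} (hf : IsTestFunction f) :
    IsTestFunction (fun t => -f t) :=
  hf.comp (φ := fun x => -x) (K := 1) continuous_neg (by simp)

theorem IsTestFunction.sub [BorelSpace F] [SecondCountableTopology F] {f g : Space d → F}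
    (hf : IsTestFunction f) (hg : IsTestFunction g) :
    IsTestFunction (fun t => f t - g t) := by
  simpa [sub_eq_add_neg] using hf.add hg.neg

theorem IsTestFunction.re {f : Space d → ℂ} (hf : IsTestFunction f) :
    IsTestFunction (fun t => (f t).re) :=
  hf.comp (φ := Complex.re) (K := 1) Complex.continuous_re
    (by simpa using fun x => Complex.abs_re_le_norm x)

theorem IsTestFunction.im {f : Space d → ℂ} (hf : IsTestFunction f) :
    IsTestFunction (fun t => (f t).im) :=
  hf.comp (φ := Complex.im) (K := 1) Complex.continuous_im
    (by simpa using fun x => Complex.abs_im_le_norm x)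

theorem IsTestFunction.const_mul {f : Space d → ℂ} (hf : IsTestFunction f) (c : ℂ) :
    IsTestFunction (fun t => c * f t) :=
  hf.comp (φ := fun x => c * x) (K := ‖c‖) (by fun_prop) (by simp)

theorem isTestFunction_zero : IsTestFunction (fun _ : Space d => (0 : F)) :=
  ⟨measurable_const, ⟨0, by simp⟩, HasCompactSupport.zero⟩

theorem isTestFunction_of_bound {f : Space d → F} (hf : Measurable f) {C R : ℝ}
    (hC : ∀ t, ‖f t‖ ≤ C) (hR : ∀ t, R < ‖t‖ → f t = 0) : IsTestFunction f := by
  refine ⟨hf, ⟨C, hC⟩, HasCompactSupport.intro (isCompact_closedBall (0 : Space d) R) ?_⟩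
  intro t ht
  exact hR t (by simpa using ht)

theorem isTestFunction_of_continuous [BorelSpace F] {f : Space d → F} (hf : Continuous f)
    (hs : HasCompactSupport f) : IsTestFunction f := by
  obtain ⟨C, hC⟩ := hs.exists_bound_of_continuous hf
  exact ⟨hf.measurable, ⟨C, hC⟩, hs⟩

theorem IsTestFunction.indicator {f : Space d → F} (hf : IsTestFunction f)
    {A : Set (Space d)} (hA : MeasurableSet A) : IsTestFunction (A.indicator f) := by
  obtain ⟨hm, ⟨C, hC⟩, hs⟩ := hf
  refine ⟨hm.indicator hA, ⟨C, fun t => (norm_indicator_le_norm_self _ _).trans (hC t)⟩, ?_⟩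
  exact hs.mono (by rw [Set.support_indicator]; exact Set.inter_subset_right)

theorem IsTestFunction.integrable [BorelSpace F] [SecondCountableTopology F] {f : Space d → F}
    (hf : IsTestFunction f) :
    Integrable f := by
  obtain ⟨hm, ⟨C, hC⟩, hs⟩ := hf
  have h1 : IntegrableOn f (tsupport f) :=
    Measure.integrableOn_of_bounded hs.measure_lt_top.ne hm.aestronglyMeasurable
      (ae_of_all _ hC)
  exact (integrableOn_iff_integrable_of_support_subset (subset_tsupport f)).1 h1

end TestFunctions

/-! ### Second moments of statistics and rigidity as L² approximation. -/

section Statistics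

variable {d : ℕ} {Ω : Type*} [MeasurableSpace Ω] {P : Measure Ω}

theorem RandomMeasure.memLp_statistic (M : RandomMeasure d P) {f : Space d → ℂ}
    (hf : IsTestFunction f) : MemLp (M.statistic f) 2 P := by
  have h1 := (M.memLp _ hf.re).ofReal (K := ℂ)
  have h2 := ((M.memLp _ hf.im).ofReal (K := ℂ)).const_mul Complex.I
  exact h1.add h2

theorem RandomMeasure.statistic_sub (M : RandomMeasure d P) {f g : Space d → ℂ}
    (hf : IsTestFunction f) (hg : IsTestFunction g) :
    M.statistic (fun t => f t - g t) =ᵐ[P] fun ω => M.statistic f ω - M.statistic g ω := by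
  have key : ∀ a b : Space d → ℝ, IsTestFunction a → IsTestFunction b →
      ∀ᵐ ω ∂P, M.I (fun t => a t - b t) ω = M.I a ω - M.I b ω := by
    intro a b ha hb
    have e : (fun t => a t - b t) = fun t => a t + (-1) * b t := by ext t; ring
    have hb' : IsTestFunction (fun t => (-1) * b t) := by simpa using hb.neg
    filter_upwards [M.add a _ ha hb', M.smul (-1) b hb] with ω h1 h2
    rw [e, h1, h2]; ring
  filter_upwards [key _ _ hf.re hg.re, key _ _ hf.im hg.im] with ω h1 h2
  simp only [statistic, Complex.sub_re, Complex.sub_im, h1, h2]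
  push_cast; ring

theorem complexVariance_eq [IsProbabilityMeasure P] {X : Ω → ℂ} (hX : MemLp X 2 P) :
    complexVariance X P = ∫ ω, ‖X ω‖ ^ 2 ∂P - ‖∫ ω, X ω ∂P‖ ^ 2 := by
  set m := ∫ ω, X ω ∂P with hm
  have hi : Integrable X P := hX.integrable (by norm_num)
  have hsq : Integrable (fun ω => ‖X ω‖ ^ 2) P := hX.integrable_norm_pow (by norm_num)
  have e : ∀ ω, ‖X ω - m‖ ^ 2 = ‖X ω‖ ^ 2 - 2 * (X ω * (starRingEnd ℂ) m).re + ‖m‖ ^ 2 := by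
    intro ω
    rw [← Complex.normSq_eq_norm_sq, ← Complex.normSq_eq_norm_sq, ← Complex.normSq_eq_norm_sq,
      Complex.normSq_sub]; ring
  have hi2 : Integrable (fun ω => X ω * (starRingEnd ℂ) m) P := hi.mul_const _
  have h3 : ∫ ω, (X ω * (starRingEnd ℂ) m).re ∂P = ‖m‖ ^ 2 := by
    have := integral_re hi2
    simp only [RCLike.re_to_complex] at this
    rw [this, integral_mul_const, ← hm, Complex.mul_conj, Complex.normSq_eq_norm_sq]
    exact Complex.ofReal_re _
  have hi3 : Integrable (fun ω => 2 * (X ω * (starRingEnd ℂ) m).re) P := by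
    have := hi2.re
    exact this.const_mul 2
  unfold complexVariance
  rw [← hm]
  simp_rw [e]
  have hi4 : Integrable (fun ω => ‖X ω‖ ^ 2 - 2 * (X ω * (starRingEnd ℂ) m).re) P := hsq.sub hi3
  rw [integral_add hi4 (integrable_const _), integral_sub hsq hi3,
    integral_const_mul, h3]
  simp
  ring

theorem fourier_zero_right (f : Space d → ℂ) : fourier f 0 = ∫ t, f t := by
  simp [fourier]

/-- The second moments of the linear statistics are given by the measure `S + lam² δ₀`, which has
the same absolutely continuous part as the spectral measure `S`. -/
theorem exists_moment_measure (hd : 0 < d) [IsProbabilityMeasure P] (M : RandomMeasure d P)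
    (hM : M.IsWideSenseStationary) {S : Measure (Space d)} (hS : M.IsSpectralMeasure S)
    {s : Space d → ℝ≥0} (hs : IsSpectralDensity S s) :
    ∃ S' : Measure (Space d), IsSpectralDensity S' s ∧ ∀ f, IsTestFunction f →
      ∫⁻ u, ‖fourier f u‖ₑ ^ 2 ∂S' = ∫⁻ ω, ‖M.statistic f ω‖ₑ ^ 2 ∂P := by
  obtain ⟨⟨lam, hlam⟩, -⟩ := hM
  obtain ⟨hsm, ν, hν, hSν⟩ := hs
  have : Nonempty (Fin d) := ⟨⟨0, hd⟩⟩
  have : Nontrivial (Space d) := inferInstance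
  -- Here `d ≥ 1` matters: in dimension 0 a Dirac mass is not singular.
  have hd0 : (Measure.dirac (0 : Space d)) ⟂ₘ volume := by
    refine ⟨{0}ᶜ, (measurableSet_singleton 0).compl, ?_, ?_⟩
    · simp
    · simp
  refine ⟨S + ENNReal.ofReal (lam ^ 2) • Measure.dirac 0, ⟨hsm, ν +
    ENNReal.ofReal (lam ^ 2) • Measure.dirac 0, ?_, ?_⟩, ?_⟩
  · exact hν.add_left (hd0.smul _)
  · rw [hSν, add_assoc]
  · intro f hf
    have hX := M.memLp_statistic hf
    have hmean : ∫ ω, M.statistic f ω ∂P = lam * ∫ t, f t := by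
      have hre := (M.memLp _ hf.re).integrable (by norm_num)
      have him := (M.memLp _ hf.im).integrable (by norm_num)
      unfold RandomMeasure.statistic
      rw [integral_add hre.ofReal (him.ofReal.const_mul _), integral_const_mul,
        integral_complex_ofReal, integral_complex_ofReal, hlam _ hf.re, hlam _ hf.im]
      have h1 : (∫ t, (f t).re : ℝ) = (∫ t, f t).re := integral_re hf.integrable
      have h2 : (∫ t, (f t).im : ℝ) = (∫ t, f t).im := integral_im hf.integrable
      rw [h1, h2]
      conv_rhs => rw [← Complex.re_add_im (∫ t, f t)]
      push_cast; ring
    have hsq : Integrable (fun ω => ‖M.statistic f ω‖ ^ 2) P :=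
      hX.integrable_norm_pow (by norm_num)
    have hv := complexVariance_eq hX
    have hv0 : 0 ≤ complexVariance (M.statistic f) P := integral_nonneg fun _ => by positivity
    rw [lintegral_add_measure, hS f hf, lintegral_smul_measure, lintegral_dirac,
      fourier_zero_right]
    have e1 : ∫⁻ ω, ‖M.statistic f ω‖ₑ ^ 2 ∂P
        = ENNReal.ofReal (∫ ω, ‖M.statistic f ω‖ ^ 2 ∂P) := by
      rw [ofReal_integral_eq_lintegral_ofReal hsq (ae_of_all _ fun _ => by positivity)]
      congr 1; ext ω
      rw [ENNReal.ofReal_pow (norm_nonneg _), ofReal_norm]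
    have e2 : ENNReal.ofReal (lam ^ 2) • ‖∫ t, f t‖ₑ ^ 2
        = ENNReal.ofReal (‖∫ ω, M.statistic f ω ∂P‖ ^ 2) := by
      rw [hmean, norm_mul, mul_pow, ENNReal.ofReal_mul (by positivity), smul_eq_mul,
        ENNReal.ofReal_pow (norm_nonneg (∫ t, f t)), ofReal_norm]
      simp
    rw [e1, e2, ← ENNReal.ofReal_add hv0 (by positivity), hv]
    congr 1; ring

/-- Almost sure convergence comes for free: L² convergence implies convergence in measure, so a
subsequence of the `h n` converges almost surely and keeps the L² limit. -/
theorem isLinearlyPredictable_of_tendsto (M : RandomMeasure d P) {S' : Measure (Space d)}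
    (hS' : ∀ f, IsTestFunction f →
      ∫⁻ u, ‖fourier f u‖ₑ ^ 2 ∂S' = ∫⁻ ω, ‖M.statistic f ω‖ₑ ^ 2 ∂P)
    {A : Set (Space d)} {f : Space d → ℂ} (hf : IsTestFunction f) {h : ℕ → Space d → ℂ}
    (hh : ∀ n, IsTestFunction (h n) ∧ ∀ t ∈ A, h n t = 0)
    (hlim : Tendsto (fun n => ∫⁻ u, ‖fourier (fun t => f t - h n t) u‖ₑ ^ 2 ∂S') atTop (𝓝 0)) :
    M.IsLinearlyPredictable A f := by
  have hsq : ∀ X : Ω → ℂ, eLpNorm X 2 P = (∫⁻ ω, ‖X ω‖ₑ ^ 2 ∂P) ^ (1 / 2 : ℝ) := by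
    intro X
    rw [eLpNorm_eq_lintegral_rpow_enorm_toReal (by norm_num) (by norm_num)]
    simp
  have h1 : ∀ n, eLpNorm (fun ω => M.statistic f ω - M.statistic (h n) ω) 2 P
      = (∫⁻ u, ‖fourier (fun t => f t - h n t) u‖ₑ ^ 2 ∂S') ^ (1 / 2 : ℝ) := by
    intro n
    rw [hS' _ (hf.sub (hh n).1), ← hsq]
    exact eLpNorm_congr_ae (M.statistic_sub hf (hh n).1).symm
  have h2 : Tendsto (fun n => eLpNorm (fun ω => M.statistic f ω - M.statistic (h n) ω) 2 P)
      atTop (𝓝 0) := by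
    simp_rw [h1]
    have := (ENNReal.continuous_rpow_const (y := (1 / 2 : ℝ))).tendsto 0 |>.comp hlim
    simpa [Function.comp_def] using this
  have h3 : TendstoInMeasure P (fun n => M.statistic (h n)) atTop (M.statistic f) := by
    refine tendstoInMeasure_of_tendsto_eLpNorm (p := 2) (by norm_num)
      (fun n => (M.memLp_statistic (hh n).1).1) (M.memLp_statistic hf).1 ?_
    refine h2.congr fun n => ?_
    rw [← eLpNorm_neg]
    congr 1; ext ω; simp
  obtain ⟨ns, hns, hae⟩ := h3.exists_seq_tendsto_ae
  exact ⟨fun n => h (ns n), fun n => hh _, h2.comp hns.tendsto_atTop, hae⟩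

theorem exists_tendsto_of_isLinearlyPredictable (M : RandomMeasure d P) {S' : Measure (Space d)}
    (hS' : ∀ f, IsTestFunction f →
      ∫⁻ u, ‖fourier f u‖ₑ ^ 2 ∂S' = ∫⁻ ω, ‖M.statistic f ω‖ₑ ^ 2 ∂P)
    {A : Set (Space d)} {f : Space d → ℂ} (hf : IsTestFunction f)
    (hp : M.IsLinearlyPredictable A f) :
    ∃ h : ℕ → Space d → ℂ, (∀ n, IsTestFunction (h n) ∧ ∀ t ∈ A, h n t = 0) ∧
      Tendsto (fun n => ∫⁻ u, ‖fourier (fun t => f t - h n t) u‖ₑ ^ 2 ∂S') atTop (𝓝 0) := by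
  obtain ⟨h, hh, hlim, -⟩ := hp
  refine ⟨h, hh, ?_⟩
  have h1 : ∀ n, ∫⁻ u, ‖fourier (fun t => f t - h n t) u‖ₑ ^ 2 ∂S'
      = eLpNorm (fun ω => M.statistic f ω - M.statistic (h n) ω) 2 P ^ 2 := by
    intro n
    rw [hS' _ (hf.sub (hh n).1), ← eLpNorm_congr_ae (M.statistic_sub hf (hh n).1),
      eLpNorm_eq_lintegral_rpow_enorm_toReal (by norm_num) (by norm_num),
      ← ENNReal.rpow_natCast, ← ENNReal.rpow_mul]
    simp
  simp_rw [h1]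
  have := (ENNReal.continuous_pow 2).tendsto 0 |>.comp hlim
  simpa [Function.comp_def] using this

end Statistics

end LinearRigidity

namespace LinearRigidity

/-! ### Fourier transforms with the kernel `e^{-i⟨u,t⟩}`, of measures and of Schwartz functions. -/

section MeasureFourier

open scoped FourierTransform SchwartzMap ContDiff

variable {d : ℕ}

/-- The Fourier transform `t ↦ ∫ e^{-i ⟨t, u⟩} f u dμ(u)` with respect to a measure. -/
noncomputable def measureFourier (μ : Measure (Space d)) (f : Space d → ℂ) (t : Space d) : ℂ :=
  ∫ u, Complex.exp (-Complex.I * ((inner ℝ t u : ℝ) : ℂ)) * f u ∂μ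

theorem fourier_eq_measureFourier (f : Space d → ℂ) : fourier f = measureFourier volume f := rfl

/-- The inner product divided by `2π`. -/
noncomputable def phaseForm (d : ℕ) : Space d →L[ℝ] Space d →L[ℝ] ℝ :=
  (2 * Real.pi)⁻¹ • innerSL ℝ

theorem phaseForm_apply (u v : Space d) :
    (phaseForm d).toLinearMap₁₂ u v = (2 * Real.pi)⁻¹ * inner ℝ u v := rfl

/-- Dividing the bilinear form by `2π` cancels the `2π` in the standard character, which gives
access to the general theory of Fourier integrals. -/
theorem measureFourier_eq (μ : Measure (Space d)) (f : Space d → ℂ) :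
    measureFourier μ f =
      VectorFourier.fourierIntegral Real.fourierChar μ (phaseForm d).toLinearMap₁₂ f := by
  ext t
  unfold measureFourier VectorFourier.fourierIntegral
  congr 1; ext u
  rw [Circle.smul_def, Real.fourierChar_apply, smul_eq_mul]
  congr 2
  have : (Real.pi : ℂ) ≠ 0 := by exact_mod_cast Real.pi_ne_zero
  rw [phaseForm_apply, real_inner_comm u t]
  push_cast
  field_simp

theorem phaseForm_flip : (phaseForm d).toLinearMap₁₂.flip = (phaseForm d).toLinearMap₁₂ := by
  ext u v
  rw [LinearMap.flip_apply, phaseForm_apply, phaseForm_apply, real_inner_comm]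

theorem continuous_phaseForm :
    Continuous fun p : Space d × Space d => (phaseForm d).toLinearMap₁₂ p.1 p.2 := by
  simp only [phaseForm_apply]
  fun_prop

theorem continuous_measureFourier {μ : Measure (Space d)} {f : Space d → ℂ}
    (hf : Integrable f μ) : Continuous (measureFourier μ f) := by
  rw [measureFourier_eq]
  exact VectorFourier.fourierIntegral_continuous Real.continuous_fourierChar
    continuous_phaseForm hf

theorem contDiff_measureFourier {μ : Measure (Space d)} {f : Space d → ℂ}
    (hf : ∀ n : ℕ, Integrable (fun u => ‖u‖ ^ n * ‖f u‖) μ) :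
    ContDiff ℝ ∞ (measureFourier μ f) := by
  rw [measureFourier_eq]
  exact VectorFourier.contDiff_fourierIntegral _ fun n _ => hf n

theorem norm_phase (t u : Space d) : ‖Complex.exp (-Complex.I * ((inner ℝ t u : ℝ) : ℂ))‖ = 1 := by
  rw [Complex.norm_exp]
  simp

theorem norm_measureFourier_le (μ : Measure (Space d)) (f : Space d → ℂ) (t : Space d) :
    ‖measureFourier μ f t‖ ≤ ∫ u, ‖f u‖ ∂μ := by
  refine (norm_integral_le_integral_norm _).trans_eq ?_
  simp only [norm_mul, norm_phase, one_mul]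

/-- Fubini. The two measures may differ, so that a transform against `S'` can be exchanged with one
against Lebesgue measure. -/
theorem integral_measureFourier_mul {μ ν : Measure (Space d)} [SigmaFinite μ] [SigmaFinite ν]
    {f g : Space d → ℂ} (hf : Integrable f μ) (hg : Integrable g ν) :
    ∫ t, measureFourier μ f t * g t ∂ν = ∫ u, f u * measureFourier ν g u ∂μ := by
  rw [measureFourier_eq, measureFourier_eq]
  have := VectorFourier.integral_fourierIntegral_smul_eq_flip (e := Real.fourierChar)
    (L := (phaseForm d).toLinearMap₁₂) Real.continuous_fourierChar continuous_phaseForm hf hg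
  rw [phaseForm_flip] at this
  exact this

theorem integrable_phase_mul {μ : Measure (Space d)} {f : Space d → ℂ} (hf : Integrable f μ)
    (t : Space d) :
    Integrable (fun u => Complex.exp (-Complex.I * ((inner ℝ t u : ℝ) : ℂ)) * f u) μ :=
  hf.bdd_mul (c := 1) (by fun_prop) (ae_of_all _ fun u => (norm_phase t u).le)

theorem measureFourier_add {μ : Measure (Space d)} {f g : Space d → ℂ} (hf : Integrable f μ)
    (hg : Integrable g μ) (t : Space d) :
    measureFourier μ (fun u => f u + g u) t = measureFourier μ f t + measureFourier μ g t := by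
  unfold measureFourier
  rw [← integral_add (integrable_phase_mul hf t) (integrable_phase_mul hg t)]
  congr 1; ext u; ring

theorem measureFourier_const_mul (μ : Measure (Space d)) (c : ℂ) (f : Space d → ℂ) (t : Space d) :
    measureFourier μ (fun u => c * f u) t = c * measureFourier μ f t := by
  unfold measureFourier
  rw [← integral_const_mul]
  congr 1; ext u; ring

theorem measureFourier_sub {μ : Measure (Space d)} {f g : Space d → ℂ} (hf : Integrable f μ)
    (hg : Integrable g μ) (t : Space d) :
    measureFourier μ (fun u => f u - g u) t = measureFourier μ f t - measureFourier μ g t := by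
  unfold measureFourier
  rw [← integral_sub (integrable_phase_mul hf t) (integrable_phase_mul hg t)]
  congr 1; ext u; ring

theorem fourier_eq_mathlib (f : Space d → ℂ) (u : Space d) :
    fourier f u = 𝓕 f ((2 * Real.pi)⁻¹ • u) := by
  rw [Real.fourier_eq']
  unfold fourier
  congr 1; ext t
  rw [smul_eq_mul]
  congr 2
  have : (Real.pi : ℂ) ≠ 0 := by exact_mod_cast Real.pi_ne_zero
  rw [inner_smul_right, real_inner_comm u t]
  push_cast
  field_simp

theorem two_pi_ne_zero : (2 * Real.pi : ℝ) ≠ 0 := by positivity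

/-- Dilation of Schwartz functions. -/
noncomputable def dilate (c : ℝ) (hc : c ≠ 0) (f : 𝓢(Space d, ℂ)) : 𝓢(Space d, ℂ) :=
  SchwartzMap.compCLMOfContinuousLinearEquiv ℂ
    (ContinuousLinearEquiv.smulLeft (Units.mk0 c hc) : Space d ≃L[ℝ] Space d) f

theorem dilate_apply (c : ℝ) (hc : c ≠ 0) (f : 𝓢(Space d, ℂ)) (x : Space d) :
    dilate c hc f x = f (c • x) := by
  simp [dilate, Units.smul_def]

/-- The Fourier transform on Schwartz functions. -/
noncomputable def schwartzFourier (f : 𝓢(Space d, ℂ)) : 𝓢(Space d, ℂ) :=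
  dilate (2 * Real.pi)⁻¹ (inv_ne_zero two_pi_ne_zero) (𝓕 f)

theorem schwartzFourier_apply (f : 𝓢(Space d, ℂ)) (x : Space d) :
    schwartzFourier f x = fourier f x := by
  rw [schwartzFourier, dilate_apply, fourier_eq_mathlib, SchwartzMap.fourier_coe]

theorem exists_schwartzFourier_eq (g : 𝓢(Space d, ℂ)) :
    ∃ f : 𝓢(Space d, ℂ), schwartzFourier f = g := by
  refine ⟨𝓕⁻ (dilate (2 * Real.pi) two_pi_ne_zero g), ?_⟩
  ext x
  rw [schwartzFourier, dilate_apply, FourierTransform.fourier_fourierInv_eq, dilate_apply,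
    smul_smul, mul_inv_cancel₀ two_pi_ne_zero, one_smul]

theorem hasTemperateGrowth_polyFun (p : MvPolynomial (Fin d) ℂ) :
    Function.HasTemperateGrowth (polyFun p : Space d → ℂ) := by
  induction p using MvPolynomial.induction_on with
  | C a =>
    have : (polyFun (MvPolynomial.C a) : Space d → ℂ) = fun _ => a := by ext; simp [polyFun]
    rw [this]; exact .const a
  | add p q hp hq =>
    have : (polyFun (p + q) : Space d → ℂ) = polyFun p + polyFun q := by ext; simp [polyFun]
    rw [this]; exact hp.add hq
  | mul_X p i hp =>
    have : (polyFun (p * MvPolynomial.X i) : Space d → ℂ)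
        = polyFun p * fun u => ((EuclideanSpace.proj i : Space d →L[ℝ] ℝ) u : ℂ) := by
      ext; simp [polyFun]
    rw [this]
    refine hp.mul ?_
    exact (Complex.ofRealCLM.comp (EuclideanSpace.proj i : Space d →L[ℝ] ℝ)).hasTemperateGrowth

/-- Multiplication of Schwartz functions by polynomials. -/
noncomputable def polyMul (p : MvPolynomial (Fin d) ℂ) (f : 𝓢(Space d, ℂ)) : 𝓢(Space d, ℂ) :=
  SchwartzMap.smulLeftCLM ℂ (polyFun p) f

theorem polyMul_apply (p : MvPolynomial (Fin d) ℂ) (f : 𝓢(Space d, ℂ)) (x : Space d) :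
    polyMul p f x = polyFun p x * f x := by
  rw [polyMul, SchwartzMap.smulLeftCLM_apply_apply (hasTemperateGrowth_polyFun p), smul_eq_mul]

theorem fderiv_schwartzFourier (f : 𝓢(Space d, ℂ)) (j : Fin d) (x : Space d) :
    fderiv ℝ (schwartzFourier f) x (EuclideanSpace.single j 1)
      = -Complex.I * schwartzFourier (polyMul (MvPolynomial.X j) f) x := by
  have h1 : (schwartzFourier f : Space d → ℂ) = fun y => (𝓕 f) ((2 * Real.pi)⁻¹ • y) := by
    ext y; rw [schwartzFourier, dilate_apply]
  have h2 : fderiv ℝ (fun y => (𝓕 f : 𝓢(Space d, ℂ)) ((2 * Real.pi)⁻¹ • y)) x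
      = (2 * Real.pi)⁻¹ • fderiv ℝ (𝓕 f : 𝓢(Space d, ℂ)) ((2 * Real.pi)⁻¹ • x) := by
    rw [fderiv_comp_smul]
  have h3 := congrArg (fun g => g ((2 * Real.pi)⁻¹ • x))
    (SchwartzMap.lineDerivOp_fourier_eq f (EuclideanSpace.single j (1 : ℝ)))
  simp only [SchwartzMap.lineDerivOp_apply_eq_fderiv] at h3
  have h4 : SchwartzMap.smulLeftCLM ℂ
      (fun y : Space d => (inner ℝ y (EuclideanSpace.single j (1 : ℝ)) : ℝ)) f
      = polyMul (MvPolynomial.X j) f := by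
    ext y
    rw [polyMul_apply, SchwartzMap.smulLeftCLM_apply_apply
      (Function.hasTemperateGrowth_inner_left _)]
    simp [polyFun, EuclideanSpace.inner_single_right]
  rw [h4] at h3
  rw [h1, h2, smul_apply, h3, FourierTransform.fourier_smul,
    smul_apply, schwartzFourier, dilate_apply]
  have : (Real.pi : ℂ) ≠ 0 := by exact_mod_cast Real.pi_ne_zero
  simp only [Complex.real_smul, smul_eq_mul]
  push_cast
  field_simp

theorem fourier_convolution_eq {f g : Space d → ℂ} (hf : Integrable f) (hg : Integrable g)
    (u : Space d) :
    fourier (convolution f g (ContinuousLinearMap.mul ℂ ℂ)) u = fourier f u * fourier g u := by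
  rw [fourier_eq_mathlib, fourier_eq_mathlib, fourier_eq_mathlib]
  exact Real.fourier_mul_convolution_eq hf hg _

/-- Fourier inversion. -/
theorem fourier_eq_of_fourier_neg {k χ : Space d → ℂ} (hk : Integrable k) (hχ : Integrable χ)
    (hc : Continuous χ) (h : ∀ t, k t = fourier χ t) (u : Space d) :
    fourier k (-u) = (2 * Real.pi) ^ d * χ u := by
  have hpos : (0 : ℝ) < 2 * Real.pi := by positivity
  have hk' : (fun t => k ((2 * Real.pi) • t)) = 𝓕 χ := by
    ext t
    rw [h, fourier_eq_mathlib, smul_smul, inv_mul_cancel₀ two_pi_ne_zero, one_smul]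
  have hi : Integrable (𝓕 χ) := by
    rw [← hk']
    exact (integrable_comp_smul_iff volume k two_pi_ne_zero).2 hk
  have hinv := congrFun (hc.fourierInv_fourier_eq hχ hi) u
  rw [← hinv, Real.fourierInv_eq', ← hk']
  have h1 := Measure.integral_comp_smul_of_nonneg volume
    (fun t => Complex.exp (-Complex.I * ((inner ℝ (-u) t : ℝ) : ℂ)) * k t) (2 * Real.pi)
    (hR := hpos.le)
  have h2 : fourier k (-u) = ((2 * Real.pi) ^ d : ℝ) • ∫ x,
      Complex.exp (-Complex.I * ((inner ℝ (-u) ((2 * Real.pi) • x) : ℝ) : ℂ)) *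
        k ((2 * Real.pi) • x) := by
    rw [h1, smul_smul, finrank_euclideanSpace_fin, mul_inv_cancel₀ (by positivity), one_smul]
    rfl
  rw [h2, Complex.real_smul]
  push_cast
  congr 2
  ext t
  rw [smul_eq_mul, inner_smul_right, inner_neg_left, real_inner_comm t u]
  congr 2
  push_cast
  ring

end MeasureFourier

end LinearRigidity

namespace LinearRigidity

/-! ### The triangular pairing of polynomials in `t` with polynomials in `u`. -/

section PolynomialPairing

open scoped FourierTransform SchwartzMap ContDiff

variable {d : ℕ}

theorem polyFun_add (p q : MvPolynomial (Fin d) ℂ) (u : Space d) :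
    polyFun (p + q) u = polyFun p u + polyFun q u := by simp [polyFun]

theorem polyFun_mul (p q : MvPolynomial (Fin d) ℂ) (u : Space d) :
    polyFun (p * q) u = polyFun p u * polyFun q u := by simp [polyFun]

theorem polyFun_smul (c : ℂ) (q : MvPolynomial (Fin d) ℂ) (u : Space d) :
    polyFun (c • q) u = c * polyFun q u := by simp [polyFun, MvPolynomial.smul_eval]

theorem continuous_polyFun (p : MvPolynomial (Fin d) ℂ) :
    Continuous (polyFun p : Space d → ℂ) := (hasTemperateGrowth_polyFun p).1.continuous

theorem polyMul_mul (p q : MvPolynomial (Fin d) ℂ) (f : 𝓢(Space d, ℂ)) :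
    polyMul (p * q) f = polyMul p (polyMul q f) := by
  ext x; simp only [polyMul_apply, polyFun_mul, mul_assoc]

theorem hasFDerivAt_polyFun (p : MvPolynomial (Fin d) ℂ) (u : Space d) :
    HasFDerivAt (polyFun p : Space d → ℂ) (∑ j, (polyFun (MvPolynomial.pderiv j p) u) •
      (Complex.ofRealCLM.comp (EuclideanSpace.proj j : Space d →L[ℝ] ℝ))) u := by
  induction p using MvPolynomial.induction_on with
  | C a =>
    have : (polyFun (MvPolynomial.C a) : Space d → ℂ) = fun _ => a := by ext; simp [polyFun]
    rw [this]
    refine (hasFDerivAt_const (𝕜 := ℝ) a u).congr_fderiv ?_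
    ext v
    simp [polyFun, sum_apply]
  | add p q hp hq =>
    have : (polyFun (p + q) : Space d → ℂ) = polyFun p + polyFun q := by ext; simp [polyFun]
    rw [this]
    refine (hp.add hq).congr_fderiv ?_
    ext v
    simp only [map_add, polyFun_add, add_apply, sum_apply, smul_apply, add_mul, smul_eq_mul,
      Finset.sum_add_distrib]
  | mul_X p i hp =>
    have : (polyFun (p * MvPolynomial.X i) : Space d → ℂ)
        = fun u => polyFun p u *
          (Complex.ofRealCLM.comp (EuclideanSpace.proj i : Space d →L[ℝ] ℝ)) u := by
      ext; simp [polyFun]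
    rw [this]
    refine (hp.mul (ContinuousLinearMap.hasFDerivAt
      (Complex.ofRealCLM.comp (EuclideanSpace.proj i : Space d →L[ℝ] ℝ)))).congr_fderiv ?_
    ext v
    have hX : ∀ j, polyFun (Pi.single (M := fun _ => MvPolynomial (Fin d) ℂ) j 1 i) u
        = if j = i then 1 else 0 := by
      intro j
      by_cases hj : j = i
      · subst hj; simp [polyFun]
      · rw [Pi.single_eq_of_ne (Ne.symm hj)]; simp [polyFun, hj]
    simp only [MvPolynomial.pderiv_mul, MvPolynomial.pderiv_X, polyFun_add, polyFun_mul, hX,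
      ContinuousLinearMap.comp_apply, add_apply, smul_apply, sum_apply,
      smul_eq_mul, Complex.ofRealCLM_apply, Finset.mul_sum, add_mul, Finset.sum_add_distrib]
    rw [add_comm]
    congr 1
    · refine Finset.sum_congr rfl fun j _ => ?_
      simp only [polyFun, MvPolynomial.eval_X, PiLp.proj_apply]
      ring
    · simp

theorem fderiv_polyFun (p : MvPolynomial (Fin d) ℂ) (u : Space d) (j : Fin d) :
    fderiv ℝ (polyFun p) u (EuclideanSpace.single j 1) = polyFun (MvPolynomial.pderiv j p) u := by
  rw [(hasFDerivAt_polyFun p u).fderiv]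
  rw [sum_apply, Finset.sum_eq_single j]
  · simp
  · intro i _ hi
    simp [hi]
  · simp

theorem integrable_polyFun_mul (r : MvPolynomial (Fin d) ℂ) (g : 𝓢(Space d, ℂ)) :
    Integrable fun t => polyFun r t * g t := by
  have h := (polyMul r g).integrable (μ := volume)
  have e : (polyMul r g : Space d → ℂ) = fun t => polyFun r t * g t := by
    ext t; exact polyMul_apply r g t
  rwa [e] at h

/-- Multiplication by `u_j` before the transform is, up to the factor `i`, differentiation in `t_j`
after it; one integration by parts moves the derivative onto `q`. -/
theorem integral_polyMul_schwartzFourier_X (q : MvPolynomial (Fin d) ℂ) (j : Fin d)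
    (f : 𝓢(Space d, ℂ)) :
    ∫ t, polyFun q t * schwartzFourier (polyMul (MvPolynomial.X j) f) t
      = -Complex.I * ∫ t, polyFun (MvPolynomial.pderiv j q) t * schwartzFourier f t := by
  have key : ∀ t, schwartzFourier (polyMul (MvPolynomial.X j) f) t
      = Complex.I * fderiv ℝ (schwartzFourier f) t (EuclideanSpace.single j 1) := by
    intro t
    rw [fderiv_schwartzFourier, ← mul_assoc, mul_neg, Complex.I_mul_I]; simp
  have h1 := integral_mul_fderiv_eq_neg_fderiv_mul_of_integrable (μ := volume)
    (f := (polyFun q : Space d → ℂ)) (g := schwartzFourier f)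
    (v := EuclideanSpace.single j (1 : ℝ))
    (by simpa only [fderiv_polyFun] using integrable_polyFun_mul _ _)
    (by
      have := (integrable_polyFun_mul q (schwartzFourier (polyMul (MvPolynomial.X j) f))).const_mul (-Complex.I)
      refine this.congr (ae_of_all _ fun t => ?_)
      simp only [fderiv_schwartzFourier]
      ring)
    (integrable_polyFun_mul _ _) (fun t _ => (hasFDerivAt_polyFun q t).differentiableAt)
    (fun t _ => (schwartzFourier f).differentiableAt)
  simp only [fderiv_polyFun] at h1
  have h2 : ∀ t, polyFun q t * schwartzFourier (polyMul (MvPolynomial.X j) f) t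
      = Complex.I * (polyFun q t *
        fderiv ℝ (schwartzFourier f) t (EuclideanSpace.single j 1)) := by
    intro t; rw [key]; ring
  simp_rw [h2]
  rw [integral_const_mul, h1]
  ring

/-- The pairing `∫ q(t) (p f)^(t) dt` of polynomials. -/
noncomputable def fourierPairing (f : 𝓢(Space d, ℂ)) :
    MvPolynomial (Fin d) ℂ →ₗ[ℂ] MvPolynomial (Fin d) ℂ →ₗ[ℂ] ℂ :=
  LinearMap.mk₂ ℂ (fun q p => ∫ t, polyFun q t * schwartzFourier (polyMul p f) t)
    (fun q q' p => by
      simp_rw [polyFun_add, add_mul]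
      exact integral_add (integrable_polyFun_mul _ _) (integrable_polyFun_mul _ _))
    (fun c q p => by
      simp_rw [polyFun_smul, mul_assoc]
      rw [integral_const_mul, smul_eq_mul])
    (fun q p p' => by
      rw [← integral_add (integrable_polyFun_mul _ _) (integrable_polyFun_mul _ _)]
      congr 1; ext t
      rw [← mul_add]
      congr 1
      simp only [schwartzFourier_apply]
      have : (polyMul (p + p') f : Space d → ℂ)
          = fun u => polyMul p f u + polyMul p' f u := by
        ext u; simp only [polyMul_apply, polyFun_add, add_mul]
      rw [this]
      exact measureFourier_add (SchwartzMap.integrable _) (SchwartzMap.integrable _) t)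
    (fun c q p => by
      rw [smul_eq_mul, ← integral_const_mul]
      congr 1; ext t
      simp only [schwartzFourier_apply]
      have : (polyMul (c • p) f : Space d → ℂ) = fun u => c * polyMul p f u := by
        ext u; simp only [polyMul_apply, polyFun_smul, mul_assoc]
      rw [this, fourier_eq_measureFourier, measureFourier_const_mul, fourier_eq_measureFourier]
      ring)

theorem fourierPairing_apply (f : 𝓢(Space d, ℂ)) (q p : MvPolynomial (Fin d) ℂ) :
    fourierPairing f q p = ∫ t, polyFun q t * schwartzFourier (polyMul p f) t := rfl

/-- Truncation in `k - single j 1` is harmless: if `k j = 0`, the factor `k j` annihilates the right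
side. -/
theorem fourierPairing_monomial_succ (f : 𝓢(Space d, ℂ)) (k m : Fin d →₀ ℕ) (j : Fin d) :
    fourierPairing f (MvPolynomial.monomial k 1) (MvPolynomial.monomial (m + Finsupp.single j 1) 1)
      = -Complex.I * k j * fourierPairing f
          (MvPolynomial.monomial (k - Finsupp.single j 1) 1) (MvPolynomial.monomial m 1) := by
  have h : MvPolynomial.monomial (m + Finsupp.single j 1) (1 : ℂ)
      = MvPolynomial.X j * MvPolynomial.monomial m 1 := by
    rw [MvPolynomial.X, MvPolynomial.monomial_mul, add_comm, one_mul]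
  have h' : MvPolynomial.pderiv j (MvPolynomial.monomial k (1 : ℂ))
      = (k j : ℂ) • MvPolynomial.monomial (k - Finsupp.single j 1) 1 := by
    rw [MvPolynomial.pderiv_monomial, MvPolynomial.smul_monomial]; simp
  rw [fourierPairing_apply, h, polyMul_mul, integral_polyMul_schwartzFourier_X, h',
    fourierPairing_apply, mul_assoc]
  simp_rw [polyFun_smul, mul_assoc]
  rw [integral_const_mul]

theorem exists_eq_add_single {m : Fin d →₀ ℕ} (hm : m ≠ 0) :
    ∃ (m' : Fin d →₀ ℕ) (j : Fin d), m = m' + Finsupp.single j 1 := by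
  obtain ⟨j, hj⟩ := Finsupp.ne_iff.1 hm
  refine ⟨m - Finsupp.single j 1, j, ?_⟩
  rw [tsub_add_cancel_of_le]
  simpa [Nat.one_le_iff_ne_zero] using hj

/-- Each factor `u_j` differentiates `t^k` once in `t_j`; when `m` exceeds `k` in some coordinate,
nothing is left. -/
theorem fourierPairing_monomial_of_not_le (f : 𝓢(Space d, ℂ)) (n : ℕ) :
    ∀ k m : Fin d →₀ ℕ, m.degree = n → ¬ m ≤ k →
      fourierPairing f (MvPolynomial.monomial k 1) (MvPolynomial.monomial m 1) = 0 := by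
  induction n with
  | zero =>
    intro k m hm hk
    rw [Finsupp.degree_eq_zero_iff] at hm
    exact absurd (hm ▸ zero_le) hk
  | succ n ih =>
    intro k m hm hk
    have hm0 : m ≠ 0 := by rintro rfl; simp at hm
    obtain ⟨m', j, rfl⟩ := exists_eq_add_single hm0
    rw [fourierPairing_monomial_succ]
    by_cases hkj : k j = 0
    · simp [hkj]
    · rw [ih _ m' (by simpa using hm), mul_zero]
      intro h
      refine hk ?_
      have h1 : Finsupp.single j 1 ≤ k := by simpa [Nat.one_le_iff_ne_zero] using hkj
      exact (le_tsub_iff_right h1).1 h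

/-- Differentiating `t^k` exactly `k` times leaves a product of factorials and powers of `-i`, a
constant that does not depend on `f`. -/
theorem exists_fourierPairing_monomial_self (n : ℕ) :
    ∀ k : Fin d →₀ ℕ, k.degree = n → ∃ c : ℂ, c ≠ 0 ∧ ∀ f : 𝓢(Space d, ℂ),
      fourierPairing f (MvPolynomial.monomial k 1) (MvPolynomial.monomial k 1)
        = c * ∫ t, schwartzFourier f t := by
  induction n with
  | zero =>
    intro k hk
    rw [Finsupp.degree_eq_zero_iff] at hk
    refine ⟨1, one_ne_zero, fun f => ?_⟩
    have h : polyMul (MvPolynomial.monomial (0 : Fin d →₀ ℕ) (1 : ℂ)) f = f := by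
      ext u; simp [polyMul_apply, polyFun]
    rw [hk, fourierPairing_apply, h, one_mul]
    simp [polyFun]
  | succ n ih =>
    intro k hk
    have hk0 : k ≠ 0 := by rintro rfl; simp at hk
    obtain ⟨k', j, rfl⟩ := exists_eq_add_single hk0
    obtain ⟨c, hc, h⟩ := ih k' (by simpa using hk)
    refine ⟨-Complex.I * (((k' + Finsupp.single j 1 : Fin d →₀ ℕ) j : ℕ) : ℂ) * c, ?_, fun f => ?_⟩
    · refine mul_ne_zero (mul_ne_zero (by simp) ?_) hc
      simp only [Finsupp.add_apply, Finsupp.single_eq_same]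
      exact_mod_cast Nat.succ_ne_zero (k' j)
    · rw [fourierPairing_monomial_succ, add_tsub_cancel_right, h]
      ring

/-- Only the term `k = m = κ₀` survives. A nonzero pairing needs `m ≤ k ≤ κ₀`; the only exponent of
`p` below `κ₀` is `κ₀` itself, which forces equality throughout. -/
theorem fourierPairing_ne_zero {κ₀ : Fin d →₀ ℕ} {Q p : MvPolynomial (Fin d) ℂ}
    (hQ : Q.coeff κ₀ ≠ 0) (hQ' : ∀ m, Q.coeff m ≠ 0 → m ≤ κ₀)
    (hp : p.coeff κ₀ ≠ 0) (hp' : ∀ m, m ≤ κ₀ → m ≠ κ₀ → p.coeff m = 0)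
    {f : 𝓢(Space d, ℂ)} (hf : ∫ t, schwartzFourier f t ≠ 0) :
    ∫ t, polyFun Q t * schwartzFourier (polyMul p f) t ≠ 0 := by
  obtain ⟨c, hc, h⟩ := exists_fourierPairing_monomial_self _ κ₀ rfl
  have hmon : ∀ (r : MvPolynomial (Fin d) ℂ), r = ∑ m ∈ r.support,
      r.coeff m • MvPolynomial.monomial m 1 := by
    intro r
    conv_lhs => rw [r.as_sum]
    refine Finset.sum_congr rfl fun m _ => ?_
    rw [MvPolynomial.smul_monomial, smul_eq_mul, mul_one]
  rw [← fourierPairing_apply]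
  have h1 : fourierPairing f Q p = ∑ k ∈ Q.support, ∑ m ∈ p.support,
      Q.coeff k * (p.coeff m * fourierPairing f (MvPolynomial.monomial k 1)
        (MvPolynomial.monomial m 1)) := by
    conv_lhs => rw [hmon Q, hmon p]
    simp only [map_sum, map_smul, LinearMap.sum_apply, LinearMap.smul_apply, smul_eq_mul,
      Finset.mul_sum]
    rw [Finset.sum_comm]
    refine Finset.sum_congr rfl fun k _ => Finset.sum_congr rfl fun m _ => by ring
  rw [h1, Finset.sum_eq_single κ₀, Finset.sum_eq_single κ₀, h]
  · exact mul_ne_zero hQ (mul_ne_zero hp (mul_ne_zero hc hf))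
  · intro m hm hne
    have : ¬ m ≤ κ₀ := fun hle => MvPolynomial.mem_support_iff.1 hm (hp' m hle hne)
    rw [fourierPairing_monomial_of_not_le f _ _ _ rfl this]; simp
  · intro hm; simp [MvPolynomial.notMem_support_iff.1 hm]
  · intro k hk hne
    refine Finset.sum_eq_zero fun m hm => ?_
    have hkle := hQ' k (MvPolynomial.mem_support_iff.1 hk)
    have : ¬ m ≤ k := by
      intro hle
      refine MvPolynomial.mem_support_iff.1 hm (hp' m (hle.trans hkle) ?_)
      rintro rfl
      exact hne (le_antisymm hkle hle)
    rw [fourierPairing_monomial_of_not_le f _ _ _ rfl this]; simp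
  · intro hm; simp [MvPolynomial.notMem_support_iff.1 hm]

/-- Multiplication by a polynomial becomes a differential operator after Fourier transform, and
differential operators do not enlarge supports. -/
theorem schwartzFourier_polyMul_eq_zero {K : Set (Space d)} (hK : IsClosed K)
    (p : MvPolynomial (Fin d) ℂ) {f : 𝓢(Space d, ℂ)} (hf : ∀ t ∉ K, schwartzFourier f t = 0) :
    ∀ t ∉ K, schwartzFourier (polyMul p f) t = 0 := by
  induction p using MvPolynomial.induction_on generalizing f with
  | C a =>
    intro t ht
    have : (polyMul (MvPolynomial.C a) f : Space d → ℂ) = fun u => a * f u := by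
      ext u; simp [polyMul_apply, polyFun]
    rw [schwartzFourier_apply, this, fourier_eq_measureFourier, measureFourier_const_mul,
      ← fourier_eq_measureFourier, ← schwartzFourier_apply, hf t ht, mul_zero]
  | add p q hp hq =>
    intro t ht
    have : (polyMul (p + q) f : Space d → ℂ)
        = fun u => polyMul p f u + polyMul q f u := by
      ext u; simp only [polyMul_apply, polyFun_add, add_mul]
    rw [schwartzFourier_apply, this, fourier_eq_measureFourier,
      measureFourier_add (SchwartzMap.integrable _) (SchwartzMap.integrable _),
      ← fourier_eq_measureFourier, ← fourier_eq_measureFourier,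
      ← schwartzFourier_apply, ← schwartzFourier_apply, hp hf t ht, hq hf t ht, add_zero]
  | mul_X p j hp =>
    rw [polyMul_mul]
    refine hp fun t ht => ?_
    have h1 : (schwartzFourier f : Space d → ℂ) =ᶠ[𝓝 t] fun _ => 0 := by
      filter_upwards [hK.isOpen_compl.mem_nhds ht] with x hx using hf x hx
    have h2 := fderiv_schwartzFourier f j t
    rw [h1.fderiv_eq] at h2
    simpa using h2.symm

end PolynomialPairing

/-! ### The dual obstruction to rigidity. -/

section NonRigidity

open scoped FourierTransform SchwartzMap

variable {d : ℕ} {Ω : Type*} [MeasurableSpace Ω] {P : Measure Ω}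

/-- Cauchy-Schwarz with weights `s` and `1/s`. Where `s = 0`, the finiteness of the weighted
integral makes `g` vanish almost everywhere, so nothing is lost there. -/
theorem lintegral_mul_le_weighted {f g : Space d → ℂ} (hf : Measurable f) (hg : Measurable g)
    {s : Space d → ℝ≥0} (hs : Measurable s)
    (hfin : ∫⁻ u, ‖g u‖ₑ ^ 2 * (s u : ℝ≥0∞)⁻¹ ≠ ∞) :
    ∫⁻ u, ‖f u‖ₑ * ‖g u‖ₑ ≤ (∫⁻ u, ‖f u‖ₑ ^ 2 * s u) ^ (1 / 2 : ℝ) *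
      (∫⁻ u, ‖g u‖ₑ ^ 2 * (s u : ℝ≥0∞)⁻¹) ^ (1 / 2 : ℝ) := by
  have hsm : Measurable fun u => (s u : ℝ≥0∞) := hs.coe_nnreal_ennreal
  have hH := ENNReal.lintegral_mul_le_Lp_mul_Lq (volume : Measure (Space d))
    Real.HolderConjugate.two_two
    (f := fun u => ‖f u‖ₑ * (s u : ℝ≥0∞) ^ (1 / 2 : ℝ))
    (g := fun u => ‖g u‖ₑ * ((s u : ℝ≥0∞)⁻¹) ^ (1 / 2 : ℝ))
    (by fun_prop) (by fun_prop)
  have e1 : ∀ x y : ℝ≥0∞, (x * y ^ (1 / 2 : ℝ)) ^ (2 : ℝ) = x ^ 2 * y := by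
    intro x y
    rw [ENNReal.mul_rpow_of_nonneg _ _ (by norm_num), ← ENNReal.rpow_mul]
    norm_num
  simp only [e1] at hH
  refine le_trans (lintegral_mono_ae ?_) hH
  have hmeas : AEMeasurable (fun u => ‖g u‖ₑ ^ 2 * (s u : ℝ≥0∞)⁻¹) volume := by fun_prop
  filter_upwards [ae_lt_top' hmeas hfin] with u hu
  by_cases hsu : s u = 0
  · have : g u = 0 := by
      by_contra h
      rw [hsu] at hu
      simp [ENNReal.mul_top, h] at hu
    simp [this]
  · have h1 : (s u : ℝ≥0∞) ^ (1 / 2 : ℝ) * ((s u : ℝ≥0∞)⁻¹) ^ (1 / 2 : ℝ) = 1 := by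
      rw [← ENNReal.mul_rpow_of_nonneg _ _ (by norm_num),
        ENNReal.mul_inv_cancel (by simpa using hsu) (by simp), ENNReal.one_rpow]
    simp only [Pi.mul_apply]
    rw [mul_mul_mul_comm, h1, mul_one]

theorem isTestFunction_indicator_polyFun (Q : MvPolynomial (Fin d) ℂ) {A : Set (Space d)}
    (hA : MeasurableSet A) (hb : Bornology.IsBounded A) :
    IsTestFunction (A.indicator (polyFun Q)) := by
  obtain ⟨R, hR⟩ := hb.subset_closedBall 0
  obtain ⟨C, hC⟩ := (isCompact_closedBall (0 : Space d) R).exists_bound_of_continuousOn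
    (continuous_polyFun Q).continuousOn
  refine isTestFunction_of_bound ((continuous_polyFun Q).measurable.indicator hA)
    (C := max C 0) (R := R) (fun t => ?_) (fun t ht => ?_)
  · by_cases h : t ∈ A
    · rw [Set.indicator_of_mem h]; exact (hC t (hR h)).trans (le_max_left _ _)
    · rw [Set.indicator_of_notMem h]; simp
  · refine Set.indicator_of_notMem (fun h => ?_) _
    have := hR h
    simp at this
    linarith

/-- A Schwartz function `p f` that is square integrable against `1 / s` and whose Fourier transform
is supported inside `A` obstructs the rigidity of `A` for polynomials paired non trivially with
it. -/
theorem not_isLinearlyRigid (M : RandomMeasure d P) {S' : Measure (Space d)} {s : Space d → ℝ≥0}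
    (hs : IsSpectralDensity S' s)
    (hS' : ∀ f, IsTestFunction f →
      ∫⁻ u, ‖fourier f u‖ₑ ^ 2 ∂S' = ∫⁻ ω, ‖M.statistic f ω‖ₑ ^ 2 ∂P)
    {A K : Set (Space d)} (hA : MeasurableSet A) (hb : Bornology.IsBounded A)
    (hK : IsClosed K) (hKA : K ⊆ A)
    {κ₀ : Fin d →₀ ℕ} {Q p : MvPolynomial (Fin d) ℂ}
    (hQ : Q.coeff κ₀ ≠ 0) (hQ' : ∀ m, Q.coeff m ≠ 0 → m ≤ κ₀)
    (hp : p.coeff κ₀ ≠ 0) (hp' : ∀ m, m ≤ κ₀ → m ≠ κ₀ → p.coeff m = 0)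
    (f : 𝓢(Space d, ℂ)) (hf0 : f 0 ≠ 0) (hf : ∀ t ∉ K, schwartzFourier f t = 0)
    (hfin : ∫⁻ u, ‖polyFun p u * f u‖ₑ ^ 2 * (s u : ℝ≥0∞)⁻¹ ≠ ∞) :
    ¬ M.IsLinearlyRigid A (polyFun Q) := by
  intro hrig
  have hAQ := isTestFunction_indicator_polyFun Q hA hb
  obtain ⟨h, hh, hlim⟩ := exists_tendsto_of_isLinearlyPredictable M hS' hAQ hrig
  obtain ⟨hsm, ν, hν, hSν⟩ := hs
  have hint0 : ∫ t, schwartzFourier f t ≠ 0 := by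
    have h1 := fourier_eq_of_fourier_neg (schwartzFourier f).integrable f.integrable f.continuous
      (fun t => schwartzFourier_apply f t) 0
    rw [neg_zero, fourier_zero_right] at h1
    rw [h1]
    refine mul_ne_zero (pow_ne_zero _ ?_) hf0
    exact_mod_cast two_pi_ne_zero
  have hne := fourierPairing_ne_zero hQ hQ' hp hp' hint0
  set φ := polyMul p f with hφ
  set c := ∫ t, polyFun Q t * schwartzFourier φ t with hc
  have hφK := schwartzFourier_polyMul_eq_zero hK p hf
  set b := ∫⁻ u, ‖polyFun p u * f u‖ₑ ^ 2 * (s u : ℝ≥0∞)⁻¹ with hbdef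
  have key : ∀ n, ‖c‖ₑ ≤
      (∫⁻ u, ‖fourier (fun t => A.indicator (polyFun Q) t - h n t) u‖ₑ ^ 2 ∂S') ^ (1 / 2 : ℝ) *
        b ^ (1 / 2 : ℝ) := by
    intro n
    set g := fun t => A.indicator (polyFun Q) t - h n t with hg
    have hgt : IsTestFunction g := hAQ.sub (hh n).1
    have hgc : Continuous (fourier g) := continuous_measureFourier hgt.integrable
    -- After the exchange of transforms, `h n` drops out since it vanishes on `A`, and `φ̂` vanishes
    -- off `A`; the value does not depend on `n`.
    have h1 : c = ∫ u, fourier g u * φ u := by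
      rw [fourier_eq_measureFourier, integral_measureFourier_mul hgt.integrable φ.integrable, hc]
      congr 1; ext t
      rw [← fourier_eq_measureFourier, ← schwartzFourier_apply]
      by_cases ht : t ∈ A
      · simp [hg, ht, (hh n).2 t ht]
      · rw [hφK t fun h' => ht (hKA h')]; simp
    have h2 : ‖c‖ₑ ≤ ∫⁻ u, ‖fourier g u‖ₑ * ‖φ u‖ₑ := by
      rw [h1]
      refine (enorm_integral_le_lintegral_enorm _).trans_eq ?_
      simp_rw [enorm_mul]
    have h3 := lintegral_mul_le_weighted (f := fourier g) (g := φ) hgc.measurable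
      φ.continuous.measurable hsm (by simpa only [hφ, polyMul_apply] using hfin)
    refine h2.trans (h3.trans ?_)
    simp only [hφ, polyMul_apply]
    refine mul_le_mul_left (ENNReal.rpow_le_rpow ?_ (by norm_num)) _
    -- Only the absolutely continuous part of `S'` is retained in the bound.
    rw [hSν, lintegral_add_measure]
    refine le_add_right ?_
    rw [lintegral_withDensity_eq_lintegral_mul _ hsm.coe_nnreal_ennreal
      (by fun_prop)]
    refine lintegral_mono fun u => ?_
    simp [mul_comm]
  have hlim2 : Tendsto (fun n => (∫⁻ u, ‖fourier (fun t => A.indicator (polyFun Q) t - h n t) u‖ₑ ^ 2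
      ∂S') ^ (1 / 2 : ℝ) * b ^ (1 / 2 : ℝ)) atTop (𝓝 0) := by
    have h1 := (ENNReal.continuous_rpow_const (y := (1 / 2 : ℝ))).tendsto 0 |>.comp hlim
    have h2 := ENNReal.Tendsto.mul_const (b := b ^ (1 / 2 : ℝ)) h1
      (Or.inr (ENNReal.rpow_ne_top_of_nonneg (by norm_num) hfin))
    simpa [Function.comp_def] using h2
  have := ge_of_tendsto' hlim2 key
  simp at this
  exact hne this

end NonRigidity

end LinearRigidity

namespace LinearRigidity

/-! ### Simple spectral densities. -/

section Simple

open scoped FourierTransform SchwartzMap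

variable {d : ℕ}

theorem exists_schwartz_decay (f : 𝓢(Space d, ℂ)) (k : ℕ) :
    ∃ C : ℝ, 0 ≤ C ∧ ∀ u, (1 + ‖u‖) ^ k * ‖f u‖ ≤ C := by
  refine ⟨2 ^ k * ((Finset.Iic (k, 0)).sup fun m => SchwartzMap.seminorm ℝ m.1 m.2) f,
    by positivity, fun u => ?_⟩
  have h := SchwartzMap.one_add_le_sup_seminorm_apply (𝕜 := ℝ) (m := (k, 0)) (k := k) (n := 0)
    le_rfl le_rfl f u
  simpa using h

/-- Inverse transform of a smooth bump; its value at 0 is a multiple of the integral of the bump,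
hence nonzero. -/
theorem exists_schwartz_fourier_support {δ : ℝ} (hδ : 0 < δ) :
    ∃ r : 𝓢(Space d, ℂ), r 0 ≠ 0 ∧ ∀ t ∉ Metric.closedBall (0 : Space d) δ,
      schwartzFourier r t = 0 := by
  let b : ContDiffBump (0 : Space d) := ⟨δ / 2, δ, by positivity, by linarith⟩
  have hsm : ContDiff ℝ ((⊤ : ℕ∞) : WithTop ℕ∞) (fun t => ((b t : ℝ) : ℂ)) :=
    Complex.ofRealCLM.contDiff.comp b.contDiff
  have hcs : HasCompactSupport (fun t => ((b t : ℝ) : ℂ)) :=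
    b.hasCompactSupport.comp_left (g := fun x : ℝ => (x : ℂ)) Complex.ofReal_zero
  obtain ⟨r, hr⟩ := exists_schwartzFourier_eq (hcs.toSchwartzMap hsm)
  have hrt : ∀ t, schwartzFourier r t = (b t : ℝ) := fun t => by rw [hr]; rfl
  refine ⟨r, fun h0 => ?_, fun t ht => ?_⟩
  · have h1 := fourier_eq_of_fourier_neg (schwartzFourier r).integrable r.integrable r.continuous
      (fun t => schwartzFourier_apply r t) 0
    rw [neg_zero, fourier_zero_right, h0, mul_zero] at h1
    simp_rw [hrt] at h1
    rw [integral_complex_ofReal] at h1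
    exact b.integral_pos.ne' (by exact_mod_cast h1)
  · rw [hrt]
    have : b t = 0 := b.zero_of_le_dist (by simpa using (not_le.1 (by simpa using ht)).le)
    simp [this]

/-- `|p|² / s` is integrable around `v`. -/
def LocallyAdmissible (s : Space d → ℝ≥0) (p : MvPolynomial (Fin d) ℂ) (v : Space d) : Prop :=
  ∃ ε : ℝ, 0 < ε ∧ ∫⁻ u in Metric.ball v ε, ‖polyFun p u‖ₑ ^ 2 * (s u : ℝ≥0∞)⁻¹ < ∞

theorem setLIntegral_mul_lt_top {α : Type*} [MeasurableSpace α] {μ : Measure α} {A : Set α}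
    (hA : MeasurableSet A) {f g : α → ℝ≥0∞} {C : ℝ≥0∞} (hC : C ≠ ∞)
    (hle : ∀ u ∈ A, f u ≤ C * g u) (hg : ∫⁻ u in A, g u ∂μ < ∞) : ∫⁻ u in A, f u ∂μ < ∞ := by
  refine (setLIntegral_mono_ae' (g := fun u => C * g u) hA (ae_of_all _ hle)).trans_lt ?_
  rw [lintegral_const_mul' _ _ hC]
  exact ENNReal.mul_lt_top hC.lt_top hg

theorem exists_enorm_polyFun_le (q : MvPolynomial (Fin d) ℂ) (v : Space d) (ε : ℝ) :
    ∃ C : ℝ≥0∞, C ≠ ∞ ∧ ∀ u ∈ Metric.ball v ε, ‖polyFun q u‖ₑ ^ 2 ≤ C := by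
  obtain ⟨C, hC⟩ := (isCompact_closedBall v ε).exists_bound_of_continuousOn
    (continuous_polyFun q).continuousOn
  refine ⟨ENNReal.ofReal C ^ 2, by simp, fun u hu => ?_⟩
  gcongr
  rw [← ofReal_norm]
  exact ENNReal.ofReal_le_ofReal (hC u (Metric.ball_subset_closedBall hu))

theorem LocallyAdmissible.mul_left {s : Space d → ℝ≥0} {p : MvPolynomial (Fin d) ℂ} {v : Space d}
    (h : LocallyAdmissible s p v) (q : MvPolynomial (Fin d) ℂ) :
    LocallyAdmissible s (q * p) v := by
  obtain ⟨ε, hε, hfin⟩ := h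
  obtain ⟨C, hC, hb⟩ := exists_enorm_polyFun_le q v ε
  refine ⟨ε, hε, setLIntegral_mul_lt_top measurableSet_ball hC
    (fun u hu => ?_) hfin⟩
  rw [polyFun_mul, enorm_mul, mul_pow, mul_assoc]
  exact mul_le_mul_left (hb u hu) _

theorem LocallyAdmissible.of_dvd {s : Space d → ℝ≥0} {p q : MvPolynomial (Fin d) ℂ} {v : Space d}
    (h : LocallyAdmissible s p v) (hd : p ∣ q) : LocallyAdmissible s q v := by
  obtain ⟨r, rfl⟩ := hd
  rw [mul_comm]
  exact h.mul_left r

theorem polyFun_zero (p : MvPolynomial (Fin d) ℂ) : polyFun p (0 : Space d) = p.coeff 0 := by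
  simp only [polyFun, PiLp.zero_apply, Complex.ofReal_zero]
  rw [MvPolynomial.eval_zero', MvPolynomial.constantCoeff_eq]

/-- A polynomial witnessing the absence of a pole does not vanish at `v`, so it is bounded below
near `v` and can be divided out. -/
theorem locallyAdmissible_one_of_not_isPole {s : Space d → ℝ≥0} {v : Space d}
    (h : ¬ IsPole s v) : LocallyAdmissible s 1 v := by
  unfold IsPole HasPoleOfOrder at h
  push Not at h
  obtain ⟨Q, ⟨ε, hε, hfin⟩, hQ⟩ := h
  have hQ0 : polyFun Q (0 : Space d) ≠ 0 := by
    rwa [polyFun_zero]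
  have hc : ContinuousAt (fun u : Space d => ‖polyFun Q (u - v)‖) v :=
    ((continuous_polyFun Q).comp (continuous_id.sub continuous_const)).norm.continuousAt
  have hpos : ‖polyFun Q (0 : Space d)‖ / 2 < ‖polyFun Q (v - v)‖ := by
    rw [sub_self]
    have := norm_pos_iff.2 hQ0
    linarith
  obtain ⟨ε', hε', hball⟩ := Metric.eventually_nhds_iff_ball.1 (hc.eventually_const_lt hpos)
  refine ⟨min ε ε', lt_min hε hε', setLIntegral_mul_lt_top measurableSet_ball
    (C := (ENNReal.ofReal (‖polyFun Q (0 : Space d)‖ / 2) ^ 2)⁻¹)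
    (g := fun u => ‖polyFun Q (u - v)‖ₑ ^ 2 * (s u : ℝ≥0∞)⁻¹) ?_ (fun u hu => ?_) ?_⟩
  · have := norm_pos_iff.2 hQ0
    simp
    exact hQ0
  · rw [← mul_assoc]
    refine mul_le_mul_left ?_ _
    have h1 := (hball u (Metric.ball_subset_ball (min_le_right _ _) hu)).le
    have h2 : ENNReal.ofReal (‖polyFun Q (0 : Space d)‖ / 2) ≤ ‖polyFun Q (u - v)‖ₑ := by
      rw [← ofReal_norm]; exact ENNReal.ofReal_le_ofReal h1
    have h3 : ENNReal.ofReal (‖polyFun Q (0 : Space d)‖ / 2) ^ 2 ≠ 0 := by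
      have := norm_pos_iff.2 hQ0
      simp
      exact hQ0
    have h4 : ‖polyFun 1 u‖ₑ ^ 2 = 1 := by simp [polyFun]
    rw [h4, ← ENNReal.inv_mul_cancel h3 (by simp)]
    exact mul_le_mul_right (pow_le_pow_left' h2 2) _
  · refine lt_of_le_of_lt (lintegral_mono_set (Metric.ball_subset_ball (min_le_left _ _))) hfin

/-- The polynomial `‖u - v‖^(2 q)`. -/
noncomputable def normSqPoly (v : Space d) (q : ℕ) : MvPolynomial (Fin d) ℂ :=
  (∑ k, (MvPolynomial.X k - MvPolynomial.C (v k : ℂ)) ^ 2) ^ q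

theorem polyFun_normSqPoly (v : Space d) (q : ℕ) (u : Space d) :
    polyFun (normSqPoly v q) u = ((‖u - v‖ ^ (2 * q) : ℝ) : ℂ) := by
  rw [pow_mul, EuclideanSpace.norm_sq_eq]
  simp [polyFun, normSqPoly]

theorem locallyAdmissible_normSqPoly {s : Space d → ℝ≥0} {v : Space d}
    (h : HasFiniteOrder s v) : ∃ q, LocallyAdmissible s (normSqPoly v q) v := by
  obtain ⟨ε, hε, q, hfin⟩ := h
  refine ⟨q, ε, hε, setLIntegral_mul_lt_top measurableSet_ball
    (C := ENNReal.ofReal ε ^ (2 * q)) (by simp) (fun u hu => ?_) hfin⟩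
  rw [polyFun_normSqPoly, ← mul_assoc]
  refine mul_le_mul_left ?_ _
  have h1 : ‖((‖u - v‖ ^ (2 * q) : ℝ) : ℂ)‖ₑ = ‖u - v‖ₑ ^ (2 * q) := by
    rw [← ofReal_norm, Complex.norm_real, ofReal_norm, enorm_pow, enorm_norm]
  rw [h1, sq]
  refine mul_le_mul_left (pow_le_pow_left' ?_ _) _
  rw [← ofReal_norm]
  exact ENNReal.ofReal_le_ofReal (by simpa [dist_eq_norm] using (Metric.mem_ball.1 hu).le)

/-- On a compact ball, finitely many neighbourhoods of admissibility suffice; far out, `1/s` grows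
at most polynomially and the Schwartz decay of `p r` wins. -/
theorem lintegral_polyFun_mul_schwartz_ne_top {s : Space d → ℝ≥0}
    {p : MvPolynomial (Fin d) ℂ} (hloc : ∀ v, LocallyAdmissible s p v) {R c : ℝ} {N : ℕ}
    (hc : 0 < c) (hfar : ∀ u : Space d, R ≤ ‖u‖ → c / (1 + ‖u‖) ^ N ≤ s u) (r : 𝓢(Space d, ℂ)) :
    ∫⁻ u, ‖polyFun p u * r u‖ₑ ^ 2 * (s u : ℝ≥0∞)⁻¹ ≠ ∞ := by
  have hK : IsCompact (Metric.closedBall (0 : Space d) R) := isCompact_closedBall _ _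
  rw [← lintegral_add_compl _ hK.measurableSet]
  refine (ENNReal.add_lt_top.2 ⟨?_, ?_⟩).ne
  · obtain ⟨C, hC0, hC⟩ := exists_schwartz_decay r 0
    refine setLIntegral_mul_lt_top hK.measurableSet
      (C := ENNReal.ofReal C ^ 2) (g := fun u => ‖polyFun p u‖ₑ ^ 2 * (s u : ℝ≥0∞)⁻¹)
      (by simp) (fun u _ => ?_) ?_
    · rw [enorm_mul, mul_pow, mul_comm (_ ^ 2) (‖r u‖ₑ ^ 2), mul_assoc]
      refine mul_le_mul_left (pow_le_pow_left' ?_ _) _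
      rw [← ofReal_norm]
      exact ENNReal.ofReal_le_ofReal (by simpa using hC u)
    · have hμ : (volume.withDensity fun u => ‖polyFun p u‖ₑ ^ 2 * (s u : ℝ≥0∞)⁻¹)
          (Metric.closedBall (0 : Space d) R) < ∞ := by
        refine hK.measure_lt_top_of_nhdsWithin fun v _ => ?_
        obtain ⟨ε, hε, hfin⟩ := hloc v
        refine ⟨Metric.ball v ε, mem_nhdsWithin_of_mem_nhds (Metric.ball_mem_nhds v hε), ?_⟩
        rwa [withDensity_apply _ measurableSet_ball]
      rwa [withDensity_apply _ hK.measurableSet] at hμ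
  · obtain ⟨C, hC0, hC⟩ := exists_schwartz_decay (polyMul p r) (N + d + 1)
    have hint : Integrable fun u : Space d => (1 + ‖u‖) ^ (-((d + 1 : ℕ) : ℝ)) :=
      integrable_one_add_norm (by simp)
    have hlt : ∫⁻ u in (Metric.closedBall (0 : Space d) R)ᶜ,
        ENNReal.ofReal ((1 + ‖u‖) ^ (-((d + 1 : ℕ) : ℝ))) < ∞ :=
      (setLIntegral_le_lintegral _ _).trans_lt hint.lintegral_lt_top
    refine setLIntegral_mul_lt_top hK.measurableSet.compl
      (C := ENNReal.ofReal (C ^ 2 / c)) (by simp) (fun u hu => ?_) hlt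
    have hu' : R ≤ ‖u‖ := by
      simp only [Set.mem_compl_iff, mem_closedBall_zero_iff, not_le] at hu
      exact hu.le
    have hx : 0 < 1 + ‖u‖ := by positivity
    have hsu : 0 < (s u : ℝ) := lt_of_lt_of_le (by positivity) (hfar u hu')
    have e1 : (s u : ℝ≥0∞)⁻¹ = ENNReal.ofReal ((s u : ℝ)⁻¹) := by
      rw [ENNReal.ofReal_inv_of_pos hsu, ENNReal.ofReal_coe_nnreal]
    rw [e1, ← ofReal_norm, ← ENNReal.ofReal_pow (norm_nonneg _),
      ← ENNReal.ofReal_mul (by positivity), ← ENNReal.ofReal_mul (by positivity)]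
    refine ENNReal.ofReal_le_ofReal ?_
    have h1 := hC u
    rw [polyMul_apply] at h1
    set g := ‖polyFun p u * r u‖
    have hg0 : 0 ≤ g := norm_nonneg _
    have h2 : (s u : ℝ)⁻¹ ≤ (1 + ‖u‖) ^ N / c := by
      rw [← inv_div]
      exact inv_anti₀ (by positivity) (hfar u hu')
    rw [Real.rpow_neg hx.le, Real.rpow_natCast]
    have h3 : g ≤ C / (1 + ‖u‖) ^ (N + d + 1) := by
      rw [le_div_iff₀ (by positivity)]; linarith
    have h4 : (1 : ℝ) ≤ (1 + ‖u‖) ^ (N + d + 1) := one_le_pow₀ (by linarith [norm_nonneg u])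
    calc g ^ 2 * (s u : ℝ)⁻¹ ≤ (C / (1 + ‖u‖) ^ (N + d + 1)) ^ 2 * ((1 + ‖u‖) ^ N / c) := by
          gcongr
      _ = C ^ 2 / c * (((1 + ‖u‖) ^ (N + d + 1))⁻¹ * ((1 + ‖u‖) ^ (d + 1))⁻¹) := by
          have : (1 + ‖u‖) ^ (N + d + 1) = (1 + ‖u‖) ^ N * (1 + ‖u‖) ^ (d + 1) := by ring
          rw [this]
          field_simp
      _ ≤ C ^ 2 / c * (1 * ((1 + ‖u‖) ^ (d + 1))⁻¹) := by
          gcongr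
          exact inv_le_one_of_one_le₀ h4
      _ = _ := by rw [one_mul]

theorem not_isLinearlyRigid_of_isSimple {Ω : Type*} [MeasurableSpace Ω] {P : Measure Ω}
    (M : RandomMeasure d P) {S' : Measure (Space d)} {s : Space d → ℝ≥0}
    (hs : IsSpectralDensity S' s)
    (hS' : ∀ f, IsTestFunction f →
      ∫⁻ u, ‖fourier f u‖ₑ ^ 2 ∂S' = ∫⁻ ω, ‖M.statistic f ω‖ₑ ^ 2 ∂P)
    {κ : Fin d →₀ ℕ} (hκ : ¬ HasPoleOfOrder s 0 κ)
    {Q : MvPolynomial (Fin d) ℂ} (hQ : IsOrderPolynomial κ Q) (hsimple : IsSimple s)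
    {η : ℝ} (hη : 0 < η) : ¬ M.IsLinearlyRigid (Metric.ball 0 η) (polyFun Q) := by
  classical
  obtain ⟨κ₀, hκ₀, hQ0, hQ1⟩ := hQ
  -- The order `κ` itself need not do: a witness for it may have nonzero lower coefficients. Below a
  -- minimal `κ'` every order is a pole, so such coefficients vanish.
  obtain ⟨κ', hκ', hmin⟩ := exists_minimal_le_of_wellFoundedLT
    (fun k => ¬ HasPoleOfOrder s 0 k) κ hκ
  obtain ⟨hZ, hord, ε₀, hε₀, c, hc, N, hlow⟩ := hsimple
  have hlower : ∀ k ≤ κ', k ≠ κ' → HasPoleOfOrder s 0 k := by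
    intro k hk hne
    by_contra hcon
    exact hne (le_antisymm hk (hmin.2 hcon hk))
  have hP := hmin.1
  unfold HasPoleOfOrder at hP
  push Not at hP
  obtain ⟨B, hBloc, hB⟩ := hP
  have hloc0 : ∀ q : MvPolynomial (Fin d) ℂ, LocallyAdmissible s q 0 →
      ∀ k ≤ κ', k ≠ κ' → q.coeff k = 0 := by
    intro q hq k hk hne
    exact hlower k hk hne q (by simpa [LocallyAdmissible] using hq)
  have hB0 : LocallyAdmissible s B 0 := by simpa [LocallyAdmissible] using hBloc
  choose! q hq using fun v (hv : IsPole s v) => locallyAdmissible_normSqPoly (hord v hv)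
  set Z := hZ.toFinset.erase 0 with hZdef
  -- The factors tame the poles other than 0, and the product does not vanish at 0.
  set Pi := ∏ v ∈ Z, normSqPoly v (q v) with hPi
  have hPi0 : Pi.coeff 0 ≠ 0 := by
    rw [← polyFun_zero, hPi]
    simp only [polyFun, map_prod]
    refine Finset.prod_ne_zero_iff.2 fun v hv => ?_
    have := polyFun_normSqPoly v (q v) 0
    simp only [polyFun] at this
    rw [this]
    have hv0 : v ≠ 0 := (Finset.mem_erase.1 hv).1
    simp [hv0]
  -- Since `B` has no coefficients strictly below `κ'`, the coefficient of the product is `B.coeff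
  -- κ' * Pi.coeff 0`.
  have hBPi : (B * Pi).coeff κ' ≠ 0 := by
    rw [MvPolynomial.coeff_mul, Finset.sum_eq_single (κ', 0)]
    · exact mul_ne_zero hB hPi0
    · rintro ⟨a, b⟩ hab hne
      rw [Finset.HasAntidiagonal.mem_antidiagonal] at hab
      simp only at hab
      have hale : a ≤ κ' := hab ▸ le_self_add
      have hane : a ≠ κ' := by
        rintro rfl
        exact hne (by simpa using hab)
      simp [hloc0 B hB0 a hale hane]
    · simp
  have hBPi0 : LocallyAdmissible s (B * Pi) 0 := hB0.of_dvd (dvd_mul_right _ _)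
  -- The monomial moves the lowest exponent from `κ'` to the top exponent `κ₀` of `Q`.
  set p := MvPolynomial.monomial (κ₀ - κ') 1 * (B * Pi) with hp
  have hκ'0 : κ' ≤ κ₀ := hκ'.trans hκ₀
  have hpc : p.coeff κ₀ ≠ 0 := by
    rw [hp, MvPolynomial.coeff_monomial_mul', if_pos tsub_le_self, one_mul,
      tsub_tsub_cancel_of_le hκ'0]
    exact hBPi
  have hpc' : ∀ m ≤ κ₀, m ≠ κ₀ → p.coeff m = 0 := by
    intro m hm hne
    rw [hp, MvPolynomial.coeff_monomial_mul']
    split_ifs with hle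
    · rw [one_mul]
      refine hloc0 _ hBPi0 _ ?_ ?_
      · rw [tsub_le_iff_right]
        refine hm.trans ?_
        rw [add_tsub_cancel_of_le hκ'0]
      · intro h
        apply hne
        rw [← tsub_add_cancel_of_le hle, h, add_tsub_cancel_of_le hκ'0]
    · rfl
  have hloc : ∀ v, LocallyAdmissible s p v := by
    intro v
    by_cases hv0 : v = 0
    · rw [hv0]; exact hBPi0.mul_left _
    · by_cases hv : IsPole s v
      · refine (hq v hv).of_dvd ?_
        have : v ∈ Z := Finset.mem_erase.2 ⟨hv0, by simpa using hv⟩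
        exact ((Finset.dvd_prod_of_mem _ this).mul_left _).mul_left _
      · exact (locallyAdmissible_one_of_not_isPole hv).of_dvd (one_dvd _)
  obtain ⟨R, hR⟩ := hZ.isBounded.subset_closedBall 0
  obtain ⟨r, hr0, hrK⟩ := exists_schwartz_fourier_support (d := d) (half_pos hη)
  refine not_isLinearlyRigid M hs hS' measurableSet_ball Metric.isBounded_ball
    Metric.isClosed_closedBall (Metric.closedBall_subset_ball (half_lt_self hη))
    hQ0 hQ1 hpc hpc' r hr0 hrK ?_
  -- All poles have norm at most `R`, so points of norm at least `R + ε₀` are at distance at least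
  -- `ε₀` from them.
  refine lintegral_polyFun_mul_schwartz_ne_top hloc (R := R + ε₀) hc (N := N) ?_ r
  intro u hu
  refine hlow u fun v hv => ?_
  have := hR hv
  rw [mem_closedBall_zero_iff] at this
  rw [dist_eq_norm]
  linarith [norm_sub_norm_le u v]

end Simple

end LinearRigidity

namespace LinearRigidity

/-! ### From the failure of maximal rigidity to a Schwartz function square integrable against `1/s`.
-/

section Duality

open scoped FourierTransform SchwartzMap

variable {d : ℕ}

/-- The Fourier transforms of test functions are square integrable. -/
def FourierSquareIntegrable (S' : Measure (Space d)) : Prop :=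
  ∀ f : Space d → ℂ, IsTestFunction f → MemLp (fourier f) 2 S'

theorem fourierSquareIntegrable_of_moment {Ω : Type*} [MeasurableSpace Ω] {P : Measure Ω}
    (M : RandomMeasure d P) {S' : Measure (Space d)}
    (hS' : ∀ f, IsTestFunction f →
      ∫⁻ u, ‖fourier f u‖ₑ ^ 2 ∂S' = ∫⁻ ω, ‖M.statistic f ω‖ₑ ^ 2 ∂P) :
    FourierSquareIntegrable S' := by
  intro f hf
  refine ⟨(continuous_measureFourier hf.integrable).aestronglyMeasurable, ?_⟩
  have h := (M.memLp_statistic hf).2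
  rw [eLpNorm_lt_top_iff_lintegral_rpow_enorm_lt_top (by norm_num) (by norm_num)] at h ⊢
  simpa [hS' f hf] using h

/-- Near `v`, test against the indicator of the unit ball modulated by `e^{i⟨v,t⟩}`: its transform
at `v` is the volume of the ball, so by continuity it is bounded below near `v`, and Markov's
inequality applies. -/
theorem isLocallyFiniteMeasure_of_fourierSquareIntegrable {S' : Measure (Space d)}
    (h : FourierSquareIntegrable S') : IsLocallyFiniteMeasure S' := by
  refine ⟨fun v => ?_⟩
  set f : Space d → ℂ := (Metric.closedBall (0 : Space d) 1).indicator
    (fun t => Complex.exp (Complex.I * ((inner ℝ v t : ℝ) : ℂ))) with hf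
  have hft : IsTestFunction f := by
    refine isTestFunction_of_bound (C := 1) (R := 1)
      (Measurable.indicator (by fun_prop) measurableSet_closedBall) (fun t => ?_) (fun t ht => ?_)
    · refine (norm_indicator_le_norm_self _ _).trans ?_
      rw [Complex.norm_exp]; simp
    · exact Set.indicator_of_notMem (by simpa using ht) _
  have hfv : fourier f v ≠ 0 := by
    have h1 : fourier f v = ∫ t, (Metric.closedBall (0 : Space d) 1).indicator (fun _ => (1 : ℂ)) t := by
      unfold fourier
      congr 1; ext t
      by_cases ht : t ∈ Metric.closedBall (0 : Space d) 1
      · rw [hf, Set.indicator_of_mem ht, Set.indicator_of_mem ht, ← Complex.exp_add]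
        simp
      · rw [hf, Set.indicator_of_notMem ht, Set.indicator_of_notMem ht, mul_zero]
    rw [h1, integral_indicator measurableSet_closedBall]
    simp only [integral_const, MeasurableSet.univ, measureReal_restrict_apply, Set.univ_inter]
    have : 0 < volume.real (Metric.closedBall (0 : Space d) 1) :=
      ENNReal.toReal_pos (Metric.measure_closedBall_pos _ _ one_pos).ne'
        measure_closedBall_lt_top.ne
    simpa using this.ne'
  have hc : Continuous (fourier f) := continuous_measureFourier hft.integrable
  have hpos : ‖fourier f v‖ / 2 < ‖fourier f v‖ := half_lt_self (norm_pos_iff.2 hfv)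
  have hnhds : {u | ‖fourier f v‖ / 2 < ‖fourier f u‖} ∈ 𝓝 v :=
    hc.norm.continuousAt.eventually_const_lt hpos
  refine ⟨_, hnhds, ?_⟩
  have h2 := (h f hft).2
  rw [eLpNorm_lt_top_iff_lintegral_rpow_enorm_lt_top (by norm_num) (by norm_num)] at h2
  have h3 := mul_meas_ge_le_lintegral₀ (μ := S') (f := fun u => ‖fourier f u‖ₑ ^ (2 : ℝ))
    (by fun_prop) (ENNReal.ofReal (‖fourier f v‖ / 2) ^ (2 : ℝ))
  have h4 := lt_of_le_of_lt h3 h2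
  refine lt_of_le_of_lt (measure_mono ?_)
    (ENNReal.lt_top_of_mul_ne_top_right h4.ne ?_)
  · intro u hu
    simp only [Set.mem_ofPred_eq] at hu ⊢
    refine ENNReal.rpow_le_rpow ?_ (by norm_num)
    rw [← ofReal_norm]
    exact ENNReal.ofReal_le_ofReal hu.le
  · have : 0 < ‖fourier f v‖ := norm_pos_iff.2 hfv
    simp [hfv]

/-- The transforms of test functions vanishing on `A` form a subspace of L²(S'). Were it dense,
every statistic on `A` could be approximated; so its orthogonal complement contains some `y ≠ 0`.
The conjugate of `y` is taken to make the pairing bilinear. -/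
theorem exists_orthogonal_of_not_isMaximallyLinearlyRigid {Ω : Type*} [MeasurableSpace Ω]
    {P : Measure Ω} (M : RandomMeasure d P) {S' : Measure (Space d)}
    (hS' : ∀ f, IsTestFunction f →
      ∫⁻ u, ‖fourier f u‖ₑ ^ 2 ∂S' = ∫⁻ ω, ‖M.statistic f ω‖ₑ ^ 2 ∂P)
    {A : Set (Space d)} (hA : MeasurableSet A) (hnot : ¬ M.IsMaximallyLinearlyRigid A) :
    ∃ c : Space d → ℂ, Measurable c ∧ MemLp c 2 S' ∧ ¬ (c =ᵐ[S'] 0) ∧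
      ∀ h, IsTestFunction h → (∀ t ∈ A, h t = 0) → ∫ u, fourier h u * c u ∂S' = 0 := by
  have hL := fourierSquareIntegrable_of_moment M hS'
  unfold RandomMeasure.IsMaximallyLinearlyRigid at hnot
  push Not at hnot
  obtain ⟨γ, hγ, hpred⟩ := hnot
  have hf := hγ.indicator hA
  set f := A.indicator γ with hfdef
  let W : Submodule ℂ (Lp ℂ 2 S') :=
    { carrier := {x | ∃ (h : Space d → ℂ) (ht : IsTestFunction h), (∀ t ∈ A, h t = 0) ∧
        x = (hL h ht).toLp (fourier h)}
      add_mem' := by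
        rintro _ _ ⟨h, ht, hA, rfl⟩ ⟨k, kt, kA, rfl⟩
        refine ⟨fun t => h t + k t, ht.add kt, fun t htA => by simp [hA t htA, kA t htA], ?_⟩
        rw [← MemLp.toLp_add]
        refine MemLp.toLp_congr _ _ (ae_of_all _ fun u => ?_)
        exact (measureFourier_add ht.integrable kt.integrable u).symm
      zero_mem' := by
        refine ⟨fun _ => 0, isTestFunction_zero, fun _ _ => rfl, ?_⟩
        rw [← MemLp.toLp_zero (E := ℂ) (p := 2) (μ := S') MemLp.zero']
        refine MemLp.toLp_congr _ _ (ae_of_all _ fun u => ?_)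
        simp [fourier]
      smul_mem' := by
        rintro z _ ⟨h, ht, hA, rfl⟩
        refine ⟨fun t => z * h t, ht.const_mul z, fun t htA => by simp [hA t htA], ?_⟩
        rw [← MemLp.toLp_const_smul]
        refine MemLp.toLp_congr _ _ (ae_of_all _ fun u => ?_)
        exact (measureFourier_const_mul volume z h u).symm }
  have hcl : W.topologicalClosure ≠ ⊤ := by
    intro htop
    apply hpred
    have hx : (hL f hf).toLp (fourier f) ∈ closure (W : Set (Lp ℂ 2 S')) := by
      have : (hL f hf).toLp (fourier f) ∈ W.topologicalClosure := htop ▸ Submodule.mem_top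
      exact this
    obtain ⟨x, hxW, hxlim⟩ := mem_closure_iff_seq_limit.1 hx
    choose h ht hA' hxe using hxW
    refine isLinearlyPredictable_of_tendsto M hS' hf (h := h) (fun n => ⟨ht n, hA' n⟩) ?_
    have h1 : ∀ n, ∫⁻ u, ‖fourier (fun t => f t - h n t) u‖ₑ ^ 2 ∂S'
        = edist ((hL f hf).toLp (fourier f)) (x n) ^ 2 := by
      intro n
      have e : ∀ x : ℝ≥0∞, (x ^ (1 / (2 : ℝ≥0∞).toReal)) ^ 2 = x := by
        intro x
        rw [← ENNReal.rpow_natCast, ← ENNReal.rpow_mul]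
        simp
      rw [hxe n, Lp.edist_toLp_toLp,
        eLpNorm_eq_lintegral_rpow_enorm_toReal (by norm_num) (by norm_num), e]
      congr 1; ext u
      rw [ENNReal.toReal_ofNat, ENNReal.rpow_ofNat]
      rw [Pi.sub_apply, fourier_eq_measureFourier, fourier_eq_measureFourier,
        fourier_eq_measureFourier, measureFourier_sub hf.integrable (ht n).integrable]
    refine Tendsto.congr (fun n => (h1 n).symm) ?_
    have h2 : Tendsto (fun n => edist ((hL f hf).toLp (fourier f)) (x n)) atTop (𝓝 0) := by
      have := tendsto_iff_edist_tendsto_0.1 hxlim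
      exact this.congr fun n => edist_comm _ _
    have := (ENNReal.continuous_pow 2).tendsto 0 |>.comp h2
    simpa [Function.comp_def] using this
  rw [Ne, Submodule.topologicalClosure_eq_top_iff] at hcl
  obtain ⟨y, hyW, hy0⟩ := (Submodule.ne_bot_iff _).1 hcl
  refine ⟨fun u => (starRingEnd ℂ) (y u), Complex.continuous_conj.measurable.comp
    (Lp.stronglyMeasurable y).measurable, ?_, fun hae => hy0 ?_, fun h ht hA => ?_⟩
  · exact (Lp.memLp y).star
  · rw [Lp.eq_zero_iff_ae_eq_zero]
    filter_upwards [hae] with u hu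
    simpa using hu
  · have h1 := (Submodule.mem_orthogonal' _ _).1 hyW _ ⟨h, ht, hA, rfl⟩
    rw [L2.inner_def] at h1
    rw [← h1]
    refine integral_congr_ae ?_
    filter_upwards [(hL h ht).coeFn_toLp] with u hu
    rw [hu]
    simp [RCLike.inner_apply]

/-- The function `g` is the reflected Fourier transform of `p r`, normalised by the inversion
constant; it shows that `p r` is the transform of a test function and hence lies in L²(S'). -/
theorem exists_test_fourier_eq {r : 𝓢(Space d, ℂ)} {δ : ℝ}
    (hr : ∀ t ∉ Metric.closedBall (0 : Space d) δ, schwartzFourier r t = 0)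
    (p : MvPolynomial (Fin d) ℂ) :
    ∃ g : Space d → ℂ, Continuous g ∧ HasCompactSupport g ∧
      (∀ t ∉ Metric.closedBall (0 : Space d) δ, g t = 0) ∧
      ∀ u, fourier g u = polyFun p u * r u := by
  have hp := schwartzFourier_polyMul_eq_zero Metric.isClosed_closedBall p hr
  have hpi : ((2 * Real.pi : ℂ) ^ d) ≠ 0 := pow_ne_zero _ (by exact_mod_cast two_pi_ne_zero)
  have hz : ∀ t ∉ Metric.closedBall (0 : Space d) δ,
      ((2 * Real.pi : ℂ) ^ d)⁻¹ * schwartzFourier (polyMul p r) (-t) = 0 := by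
    intro t ht
    rw [hp (-t) (by simpa using ht), mul_zero]
  refine ⟨fun t => ((2 * Real.pi : ℂ) ^ d)⁻¹ * schwartzFourier (polyMul p r) (-t),
    continuous_const.mul ((schwartzFourier _).continuous.comp continuous_neg),
    HasCompactSupport.intro (isCompact_closedBall (0 : Space d) δ) hz, hz, fun u => ?_⟩
  rw [fourier_eq_measureFourier, measureFourier_const_mul]
  have h1 := fourier_eq_of_fourier_neg (schwartzFourier (polyMul p r)).integrable
    (polyMul p r).integrable (polyMul p r).continuous (fun t => schwartzFourier_apply _ t) u
  have h2 : measureFourier volume (fun t => schwartzFourier (polyMul p r) (-t)) u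
      = fourier (schwartzFourier (polyMul p r)) (-u) := by
    unfold measureFourier fourier
    rw [← integral_neg_eq_self]
    simp
  rw [h2, h1, polyMul_apply, inv_mul_cancel_left₀ hpi]

/-- A density `c` orthogonal to the Fourier transforms of the test functions vanishing on `A`,
multiplied by a function `r` with Fourier transform supported in a small ball, is a Schwartz
function with Fourier transform supported near `A`. -/
theorem exists_schwartz_of_orthogonal {S' : Measure (Space d)} {s : Space d → ℝ≥0}
    (hs : IsSpectralDensity S' s) (hL : FourierSquareIntegrable S')
    {A : Set (Space d)} (hb : Bornology.IsBounded A) {c : Space d → ℂ}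
    (hcm : Measurable c) (hc : MemLp c 2 S')
    (horth : ∀ h, IsTestFunction h → (∀ t ∈ A, h t = 0) → ∫ u, fourier h u * c u ∂S' = 0)
    {δ : ℝ} {r : 𝓢(Space d, ℂ)}
    (hr : ∀ t ∉ Metric.closedBall (0 : Space d) δ, schwartzFourier r t = 0) :
    ∃ ψ : 𝓢(Space d, ℂ), (∀ t ∉ Metric.cthickening δ A, schwartzFourier ψ t = 0) ∧
      ∫⁻ u, ‖ψ u‖ₑ ^ 2 * (s u : ℝ≥0∞)⁻¹ ≠ ∞ ∧ (ψ = 0 → ∀ᵐ u ∂S', c u * r u = 0) := by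
  have := isLocallyFiniteMeasure_of_fourierSquareIntegrable hL
  obtain ⟨hsm, ν, hν, hSν⟩ := hs
  set a : Space d → ℂ := fun u => c u * r u with ha
  have ham : Measurable a := hcm.mul r.continuous.measurable
  set K := Metric.cthickening δ A with hK
  have hpr : ∀ p : MvPolynomial (Fin d) ℂ, Integrable (fun u => c u * (polyFun p u * r u)) S' := by
    intro p
    obtain ⟨g, hgc, hgs, -, hg⟩ := exists_test_fourier_eq hr p
    have h1 := hL g (isTestFunction_of_continuous hgc hgs)
    have h2 := hc.integrable_mul h1
    refine h2.congr (ae_of_all _ fun u => ?_)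
    simp [hg]
  have hai : Integrable a S' := by
    have := hpr 1
    simpa [polyFun, ha] using this
  -- All moments of `c r dS'` are finite, by pairing `c` with polynomial multiples of `r`; this
  -- makes the Fourier transform `G` smooth.
  have hmom : ∀ n : ℕ, Integrable (fun u => ‖u‖ ^ n * ‖a u‖) S' := by
    intro n
    refine (hai.norm.add (hpr (normSqPoly 0 n)).norm).mono'
      (by fun_prop) (ae_of_all _ fun u => ?_)
    rw [Real.norm_of_nonneg (by positivity)]
    simp only [Pi.add_apply, ha, norm_mul, polyFun_normSqPoly, sub_zero, Complex.norm_real,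
      norm_pow, norm_norm]
    have h1 : ‖u‖ ^ n ≤ 1 + ‖u‖ ^ (2 * n) := by
      rw [mul_comm, pow_mul]; nlinarith [sq_nonneg (‖u‖ ^ n - 1), norm_nonneg u]
    have h2 : 0 ≤ ‖c u‖ * ‖r u‖ := by positivity
    nlinarith
  set G := measureFourier S' a with hG
  have hGs := contDiff_measureFourier hmom
  have hGc : Continuous G := continuous_measureFourier hai
  -- For `g` with transform `r`, one has `r ĥ = (g * h)^`. If `h` vanishes on the `δ`-thickening of
  -- `A`, then `g * h` vanishes on `A`, and orthogonality applies.
  have hGh : ∀ h, IsTestFunction h → (∀ t ∈ K, h t = 0) → ∫ t, G t * h t = 0 := by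
    intro h ht hhK
    obtain ⟨g, hgc, hgs, hg0, hg⟩ := exists_test_fourier_eq hr 1
    have hgi : Integrable g := hgc.integrable_of_hasCompactSupport hgs
    rw [hG, integral_measureFourier_mul hai ht.integrable]
    have h1 : ∀ u, a u * measureFourier volume h u
        = fourier (convolution g h (ContinuousLinearMap.mul ℂ ℂ)) u * c u := by
      intro u
      rw [fourier_convolution_eq hgi ht.integrable, hg, ← fourier_eq_measureFourier]
      simp [polyFun, ha]; ring
    simp_rw [h1]
    refine horth _ (isTestFunction_of_continuous ?_ ?_) fun t htA => ?_
    · exact hgs.continuous_convolution_left _ hgc ht.integrable.locallyIntegrable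
    · exact hgs.convolution _ ht.2.2
    · unfold convolution
      rw [integral_eq_zero_of_ae]
      refine ae_of_all _ fun x => ?_
      by_cases hx : x ∈ Metric.closedBall (0 : Space d) δ
      · have : t - x ∈ K := by
          refine Metric.mem_cthickening_of_dist_le (t - x) t δ A htA ?_
          simpa [dist_eq_norm] using hx
        simp [hhK _ this]
      · simp [hg0 x hx]
  have hG0 : ∀ t ∉ K, G t = 0 := by
    intro t₀ ht₀
    have hopen : IsOpen (Kᶜ ∩ Metric.ball t₀ 1) :=
      Metric.isClosed_cthickening.isOpen_compl.inter Metric.isOpen_ball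
    -- Testing against the conjugate of `G` on `U` gives `∫_U |G|² = 0`, and continuity removes the
    -- almost everywhere.
    set U := Kᶜ ∩ Metric.ball t₀ 1 with hU
    set h : Space d → ℂ := U.indicator fun t => (starRingEnd ℂ) (G t) with hh
    have ht : IsTestFunction h := by
      refine isTestFunction_of_bound (C := ∫ u, ‖a u‖ ∂S') (R := ‖t₀‖ + 1)
        (Measurable.indicator (by fun_prop) hopen.measurableSet) (fun t => ?_) (fun t ht => ?_)
      · refine (norm_indicator_le_norm_self _ _).trans ?_
        rw [RCLike.norm_conj]
        exact norm_measureFourier_le _ _ _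
      · refine Set.indicator_of_notMem (fun hmem => ?_) _
        have := hmem.2
        rw [Metric.mem_ball, dist_eq_norm] at this
        linarith [norm_sub_norm_le t t₀]
    have h1 := hGh h ht fun t htK => Set.indicator_of_notMem (fun hmem => hmem.1 htK) _
    have h2 : ∀ t, G t * h t = ((U.indicator (fun t => ‖G t‖ ^ 2) t : ℝ) : ℂ) := by
      intro t
      by_cases htU : t ∈ U
      · rw [hh, Set.indicator_of_mem htU, Set.indicator_of_mem htU, Complex.mul_conj,
          Complex.normSq_eq_norm_sq]
      · rw [hh, Set.indicator_of_notMem htU, Set.indicator_of_notMem htU]; simp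
    simp_rw [h2] at h1
    rw [integral_complex_ofReal, Complex.ofReal_eq_zero,
      integral_indicator hopen.measurableSet] at h1
    have hint : IntegrableOn (fun t => ‖G t‖ ^ 2) U :=
      ((hGc.norm.pow 2).continuousOn.integrableOn_compact
        (isCompact_closedBall t₀ 1)).mono_set
        (Set.inter_subset_right.trans Metric.ball_subset_closedBall)
    rw [setIntegral_eq_zero_iff_of_nonneg_ae (ae_of_all _ fun t => by positivity) hint] at h1
    have h3 : Set.EqOn (fun t => ‖G t‖ ^ 2) 0 U :=
      Measure.eqOn_open_of_ae_eq (μ := volume) h1 hopen (hGc.norm.pow 2).continuousOn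
        continuousOn_const
    have h4 := h3 (x := t₀) ⟨ht₀, Metric.mem_ball_self one_pos⟩
    simpa using h4
  have hKb : Bornology.IsBounded K := hb.cthickening
  have hGcs : HasCompactSupport G :=
    HasCompactSupport.intro (Metric.isCompact_of_isClosed_isBounded Metric.isClosed_cthickening hKb) hG0
  obtain ⟨ψ, hψ⟩ := exists_schwartzFourier_eq (hGcs.toSchwartzMap hGs)
  have hψG : ∀ t, schwartzFourier ψ t = G t := fun t => by rw [hψ]; rfl
  -- As `a dS'` and `ψ du` have the same Fourier transform `G`, they agree as distributions.
  have hpair : ∀ ξ : Space d → ℝ, ContDiff ℝ ((⊤ : ℕ∞) : WithTop ℕ∞) ξ → HasCompactSupport ξ →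
      ∫ u, (ξ u : ℂ) * a u ∂S' = ∫ u, (ξ u : ℂ) * ψ u := by
    intro ξ hξ hξs
    have hsm : ContDiff ℝ ((⊤ : ℕ∞) : WithTop ℕ∞) (fun t => (ξ t : ℂ)) :=
      Complex.ofRealCLM.contDiff.comp hξ
    have hcs : HasCompactSupport (fun t => (ξ t : ℂ)) :=
      hξs.comp_left (g := fun x : ℝ => (x : ℂ)) Complex.ofReal_zero
    obtain ⟨χ, hχ⟩ := exists_schwartzFourier_eq (hcs.toSchwartzMap hsm)
    have hχξ : ∀ t, (ξ t : ℂ) = measureFourier volume χ t := fun t => by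
      rw [← fourier_eq_measureFourier, ← schwartzFourier_apply, hχ]; rfl
    simp_rw [hχξ]
    rw [integral_measureFourier_mul χ.integrable hai,
      integral_measureFourier_mul χ.integrable ψ.integrable]
    congr 1; ext t
    rw [← fourier_eq_measureFourier ψ, ← schwartzFourier_apply, hψG]
  have hνS : ν ≤ S' := by rw [hSν]; exact Measure.le_add_left le_rfl
  have hνf : IsLocallyFiniteMeasure ν := ⟨fun x => (S'.finiteAt_nhds x).measure_mono hνS⟩
  obtain ⟨N, hN, hνN, hvN⟩ := hν
  have haν : Integrable a ν := hai.mono_measure hνS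
  have hwd : volume.withDensity (fun u => (s u : ℝ≥0∞)) ≤ S' := by
    rw [hSν]; exact Measure.le_add_right le_rfl
  have has : Integrable (fun u => (s u : ℝ) • a u) :=
    (integrable_withDensity_iff_integrable_smul hsm).1 (hai.mono_measure hwd)
  classical
  -- The set `N` carries Lebesgue measure and is `ν`-null. So `b` is the density of `a dS' - ψ du`
  -- with respect to `volume + ν`, and a single vanishing statement treats both parts.
  set b : Space d → ℂ := N.piecewise (fun u => (s u : ℝ) • a u - ψ u) a with hbdef
  have hb1 : b =ᵐ[volume] fun u => (s u : ℝ) • a u - ψ u := by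
    have : ∀ᵐ u ∂volume, u ∈ N := by rwa [ae_iff]
    filter_upwards [this] with u hu
    exact Set.piecewise_eq_of_mem _ _ _ hu
  have hb2 : b =ᵐ[ν] a := by
    have : ∀ᵐ u ∂ν, u ∉ N := by rw [ae_iff]; simpa using hνN
    filter_upwards [this] with u hu
    exact Set.piecewise_eq_of_notMem _ _ _ hu
  have hbv : Integrable b volume := (has.sub ψ.integrable).congr hb1.symm
  have hbν : Integrable b ν := haν.congr hb2.symm
  have hbi : Integrable b (volume + ν) := hbv.add_measure hbν
  have hb0 : ∀ᵐ u ∂(volume + ν), b u = 0 := by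
    refine ae_eq_zero_of_integral_contDiff_smul_eq_zero hbi.locallyIntegrable
      fun ξ hξ hξs => ?_
    obtain ⟨C, hC⟩ := hξs.exists_bound_of_continuous hξ.continuous
    have hbd : ∀ {μ : Measure (Space d)} {g : Space d → ℂ}, Integrable g μ →
        Integrable (fun u => ξ u • g u) μ := fun hg =>
      hg.bdd_smul C hξ.continuous.aestronglyMeasurable (ae_of_all _ hC)
    rw [integral_add_measure (hbd hbv) (hbd hbν)]
    have e1 : ∫ u, ξ u • b u = (∫ u, ξ u • ((s u : ℝ) • a u)) - ∫ u, ξ u • ψ u := by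
      rw [← integral_sub (hbd has) (hbd ψ.integrable)]
      refine integral_congr_ae ?_
      filter_upwards [hb1] with u hu
      rw [hu, smul_sub]
    have e2 : ∫ u, ξ u • b u ∂ν = ∫ u, ξ u • a u ∂ν := by
      refine integral_congr_ae ?_
      filter_upwards [hb2] with u hu
      rw [hu]
    have e3 : ∫ u, ξ u • a u ∂S' = (∫ u, ξ u • ((s u : ℝ) • a u)) + ∫ u, ξ u • a u ∂ν := by
      rw [hSν, integral_add_measure (hbd (hai.mono_measure hwd)) (hbd haν),
        integral_withDensity_eq_integral_smul hsm]
      congr 1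
      refine integral_congr_ae (ae_of_all _ fun u => ?_)
      change (s u : ℝ) • ξ u • a u = ξ u • (s u : ℝ) • a u
      rw [smul_comm]
    have e4 := hpair ξ hξ hξs
    simp only [← Complex.real_smul] at e4
    rw [e1, e2, ← e4, e3]
    ring
  rw [ae_add_measure_iff] at hb0
  have hv0 : ∀ᵐ u, ψ u = (s u : ℝ) • a u := by
    filter_upwards [hb0.1, hb1] with u h1 h2
    rw [h1] at h2
    exact (sub_eq_zero.1 h2.symm).symm
  have hν0 : ∀ᵐ u ∂ν, a u = 0 := by
    filter_upwards [hb0.2, hb2] with u h1 h2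
    rw [← h2, h1]
  refine ⟨ψ, fun t ht => by rw [hψG, hG0 t ht], ?_, fun h0 => ?_⟩
  · obtain ⟨C, hC0, hC⟩ := exists_schwartz_decay r 0
    -- From `ψ = s a`, `|ψ|²/s = s |a|²` wherever `s ≠ 0`; where `s = 0` also `ψ = 0`, and `0 * ∞ =
    -- 0`.
    have h1 : ∫⁻ u, ‖ψ u‖ₑ ^ 2 * (s u : ℝ≥0∞)⁻¹ ≤ ∫⁻ u, (s u : ℝ≥0∞) * ‖a u‖ₑ ^ 2 := by
      refine lintegral_mono_ae ?_
      filter_upwards [hv0] with u hu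
      rw [hu]
      by_cases hsu : s u = 0
      · simp [hsu]
      · have e : ‖(s u : ℝ) • a u‖ₑ = (s u : ℝ≥0∞) * ‖a u‖ₑ := by
          rw [enorm_smul]; simp
        rw [e, mul_pow, sq (s u : ℝ≥0∞)]
        have : (s u : ℝ≥0∞) * (s u : ℝ≥0∞)⁻¹ = 1 :=
          ENNReal.mul_inv_cancel (by simpa using hsu) (by simp)
        calc (s u : ℝ≥0∞) * s u * ‖a u‖ₑ ^ 2 * (s u : ℝ≥0∞)⁻¹
            = ((s u : ℝ≥0∞) * (s u : ℝ≥0∞)⁻¹) * (s u * ‖a u‖ₑ ^ 2) := by ring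
          _ ≤ _ := by rw [this, one_mul]
    have h2 : ∫⁻ u, (s u : ℝ≥0∞) * ‖a u‖ₑ ^ 2 ≤ ∫⁻ u, ‖a u‖ₑ ^ 2 ∂S' := by
      refine le_trans (le_of_eq ?_) (lintegral_mono' hwd le_rfl)
      rw [lintegral_withDensity_eq_lintegral_mul _ hsm.coe_nnreal_ennreal (by fun_prop)]
      rfl
    have h3 : ∫⁻ u, ‖a u‖ₑ ^ 2 ∂S' ≤ ENNReal.ofReal C ^ 2 * ∫⁻ u, ‖c u‖ₑ ^ 2 ∂S' := by
      rw [← lintegral_const_mul _ (by fun_prop)]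
      refine lintegral_mono fun u => ?_
      rw [ha, enorm_mul, mul_pow, mul_comm]
      gcongr
      rw [← ofReal_norm]
      exact ENNReal.ofReal_le_ofReal (by simpa using hC u)
    have h4 : ∫⁻ u, ‖c u‖ₑ ^ 2 ∂S' < ∞ := by
      have := hc.2
      rw [eLpNorm_lt_top_iff_lintegral_rpow_enorm_lt_top (by norm_num) (by norm_num)] at this
      simpa using this
    exact ((h1.trans (h2.trans h3)).trans_lt (ENNReal.mul_lt_top (by simp) h4)).ne
  · rw [hSν, ae_add_measure_iff]
    refine ⟨?_, hν0⟩
    rw [ae_withDensity_iff hsm.coe_nnreal_ennreal]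
    filter_upwards [hv0] with u hu hsu
    rw [h0, zero_apply] at hu
    have := hu.symm
    rw [smul_eq_zero] at this
    refine this.resolve_left ?_
    simpa using hsu

/-- A translation multiplies the Fourier transform by a unimodular factor and keeps its zeros. -/
theorem schwartzFourier_translate_eq_zero {r : 𝓢(Space d, ℂ)} {t : Space d}
    (h : schwartzFourier r t = 0) (v : Space d) :
    schwartzFourier (SchwartzMap.compSubConstCLM ℂ v r) t = 0 := by
  rw [schwartzFourier_apply] at h ⊢
  have h1 : fourier (SchwartzMap.compSubConstCLM ℂ v r) t
      = Complex.exp (-Complex.I * ((inner ℝ t v : ℝ) : ℂ)) * fourier r t := by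
    unfold fourier
    rw [← integral_const_mul, ← integral_add_right_eq_self _ v]
    congr 1; ext u
    rw [SchwartzMap.compSubConstCLM_apply, add_sub_cancel_right, inner_add_right, ← mul_assoc,
      ← Complex.exp_add]
    congr 2
    push_cast; ring
  rw [h1, h, mul_zero]

/-- Some translate of `r` must give `ψ ≠ 0`: otherwise `c` vanishes `S'`-almost everywhere on the
ball of radius `ε` around each `v`, where the translate of `r` to `v` has no zeros, so `c = 0`. -/
theorem exists_schwartz_of_not_isMaximallyLinearlyRigid {Ω : Type*} [MeasurableSpace Ω]
    {P : Measure Ω} (M : RandomMeasure d P) {S' : Measure (Space d)} {s : Space d → ℝ≥0}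
    (hs : IsSpectralDensity S' s)
    (hS' : ∀ f, IsTestFunction f →
      ∫⁻ u, ‖fourier f u‖ₑ ^ 2 ∂S' = ∫⁻ ω, ‖M.statistic f ω‖ₑ ^ 2 ∂P)
    {A : Set (Space d)} (hA : MeasurableSet A) (hb : Bornology.IsBounded A)
    (hnot : ¬ M.IsMaximallyLinearlyRigid A) {δ : ℝ} (hδ : 0 < δ) :
    ∃ ψ : 𝓢(Space d, ℂ), ψ ≠ 0 ∧ (∀ t ∉ Metric.cthickening δ A, schwartzFourier ψ t = 0) ∧
      ∫⁻ u, ‖ψ u‖ₑ ^ 2 * (s u : ℝ≥0∞)⁻¹ ≠ ∞ := by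
  obtain ⟨c, hcm, hc, hc0, horth⟩ :=
    exists_orthogonal_of_not_isMaximallyLinearlyRigid M hS' hA hnot
  have hL := fourierSquareIntegrable_of_moment M hS'
  obtain ⟨r, hr0, hr⟩ := exists_schwartz_fourier_support (d := d) hδ
  by_contra hcon
  push Not at hcon
  apply hc0
  have hne : ∀ᶠ u in 𝓝 (0 : Space d), r u ≠ 0 := r.continuous.continuousAt.eventually_ne hr0
  obtain ⟨ε, hε, hball⟩ := Metric.eventually_nhds_iff_ball.1 hne
  have key : ∀ v : Space d, ∀ᵐ u ∂S', u ∈ Metric.ball v ε → c u = 0 := by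
    intro v
    obtain ⟨ψ, hψK, hψfin, hψ0⟩ := exists_schwartz_of_orthogonal hs hL hb hcm hc horth
      (r := SchwartzMap.compSubConstCLM ℂ v r)
      (fun t ht => schwartzFourier_translate_eq_zero (hr t ht) v)
    have hz : ψ = 0 := by
      by_contra hne
      exact hψfin (hcon ψ hne hψK)
    filter_upwards [hψ0 hz] with u hu hmem
    refine (mul_eq_zero.1 hu).resolve_right ?_
    rw [SchwartzMap.compSubConstCLM_apply]
    exact hball _ (by simpa [dist_eq_norm] using hmem)
  have hnull : S' {u | c u ≠ 0} = 0 := by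
    refine measure_null_of_locally_null _ fun v _ => ?_
    refine ⟨{u | c u ≠ 0} ∩ Metric.ball v ε,
      inter_mem_nhdsWithin _ (Metric.ball_mem_nhds v hε), ?_⟩
    refine measure_mono_null ?_ (ae_iff.1 (key v))
    rintro u ⟨hu, hmem⟩
    simp only [Set.mem_ofPred_eq, Classical.not_imp]
    exact ⟨hmem, hu⟩
  exact ae_iff.2 hnull

end Duality

end LinearRigidity

namespace LinearRigidity

/-! ### Even entire functions of exponential type and the radial Paley-Wiener theorem. -/

section PaleyWiener

/-- Entire functions of exponential type `R`, rapidly decreasing on horizontal strips. -/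
def PaleyWiener (R : ℝ) (f : ℂ → ℂ) : Prop :=
  Differentiable ℂ f ∧ ∀ N : ℕ, ∃ C : ℝ, ∀ z, (1 + ‖z‖) ^ N * ‖f z‖ ≤ C * Real.exp (R * |z.im|)

theorem PaleyWiener.exists_nonneg {R : ℝ} {f : ℂ → ℂ} (hf : PaleyWiener R f) (N : ℕ) :
    ∃ C : ℝ, 0 ≤ C ∧ ∀ z, (1 + ‖z‖) ^ N * ‖f z‖ ≤ C * Real.exp (R * |z.im|) := by
  obtain ⟨C, hC⟩ := hf.2 N
  refine ⟨C, ?_, hC⟩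
  have h := hC 0
  simp only [norm_zero, add_zero, one_pow, one_mul, Complex.zero_im, abs_zero, mul_zero,
    Real.exp_zero, mul_one] at h
  exact (norm_nonneg _).trans h

/-- The even or the odd part of an entire function that is not zero, divided by the largest possible
power of the variable. -/
theorem PaleyWiener.exists_even_quotient {R : ℝ} (hR : 0 ≤ R) {f : ℂ → ℂ} (hf : PaleyWiener R f)
    (hne : f ≠ 0) :
    ∃ (n : ℕ) (g : ℂ → ℂ), PaleyWiener R g ∧ g 0 ≠ 0 ∧ (∀ z, g (-z) = g z) ∧
      ∀ z, ‖z‖ ^ n * ‖g z‖ ≤ ‖f z‖ + ‖f (-z)‖ := by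
  -- The sign `σ` selects the even or the odd part; if both vanished, so would `f`.
  obtain ⟨σ, hσ, hσf⟩ : ∃ σ : ℂ, (σ = 1 ∨ σ = -1) ∧ (fun z => f z + σ * f (-z)) ≠ 0 := by
    by_contra hcon
    push Not at hcon
    have h1 := hcon 1 (Or.inl rfl)
    have h2 := hcon (-1) (Or.inr rfl)
    apply hne
    ext z
    have e1 := congrFun h1 z
    have e2 := congrFun h2 z
    simp only [one_mul, neg_one_mul, Pi.zero_apply] at e1 e2 ⊢
    linear_combination (e1 + e2) / 2
  set k : ℂ → ℂ := fun z => f z + σ * f (-z) with hk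
  have hσ2 : σ * σ = 1 := by rcases hσ with rfl | rfl <;> norm_num
  have hσn : ‖σ‖ = 1 := by rcases hσ with rfl | rfl <;> simp
  have hkneg : ∀ z, k (-z) = σ * k z := by
    intro z
    simp only [hk, neg_neg, mul_add, ← mul_assoc, hσ2]
    ring
  have hkd : Differentiable ℂ k := hf.1.add ((hf.1.comp differentiable_neg).const_mul σ)
  have hkle : ∀ z, ‖k z‖ ≤ ‖f z‖ + ‖f (-z)‖ := by
    intro z
    refine (norm_add_le _ _).trans ?_
    rw [norm_mul, hσn, one_mul]
  have hkan : AnalyticAt ℂ k 0 := hkd.analyticAt 0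
  have hnz : ¬ ∀ᶠ z in 𝓝 (0 : ℂ), k z = 0 := by
    intro h
    apply hσf
    exact AnalyticOnNhd.eq_of_eventuallyEq (z₀ := 0) (fun z _ => hkd.analyticAt z)
      (fun z _ => analyticAt_const) h
  obtain ⟨n, h, han, hh0, heq⟩ := hkan.exists_eventuallyEq_pow_smul_nonzero_iff.2 hnz
  simp only [sub_zero, smul_eq_mul] at heq
  classical
  set g : ℂ → ℂ := Function.update (fun z => k z / z ^ n) 0 (h 0) with hg
  have hg0 : g 0 = h 0 := Function.update_self _ _ _
  have hgz : ∀ z ≠ 0, g z = k z / z ^ n := fun z hz => Function.update_of_ne hz _ _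
  have hgh : g =ᶠ[𝓝 0] h := by
    filter_upwards [heq] with z hz
    by_cases hz0 : z = 0
    · rw [hz0, hg0]
    · rw [hgz z hz0, hz, mul_div_cancel_left₀ _ (pow_ne_zero _ hz0)]
  have hkg : ∀ z, k z = z ^ n * g z := by
    intro z
    by_cases hz0 : z = 0
    · rw [hz0, hg0, heq.self_of_nhds]
    · rw [hgz z hz0, mul_div_cancel₀ _ (pow_ne_zero _ hz0)]
  have hgd : Differentiable ℂ g := by
    intro z
    by_cases hz0 : z = 0
    · rw [hz0]; exact hgh.differentiableAt_iff.2 han.differentiableAt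
    · have h1 : g =ᶠ[𝓝 z] fun z => k z / z ^ n := by
        filter_upwards [isOpen_ne.mem_nhds hz0] with w hw using hgz w hw
      exact h1.differentiableAt_iff.2
        ((hkd z).div (differentiableAt_pow n) (pow_ne_zero _ hz0))
  have hgneg : ∀ z, g (-z) = σ * (-1) ^ n * g z := by
    intro z
    by_cases hz0 : z = 0
    · subst hz0
      have hcont : ∀ᶠ z in 𝓝[≠] (0 : ℂ), g (-z) = σ * (-1) ^ n * g z := by
        filter_upwards [self_mem_nhdsWithin] with w hw
        have hw' : -w ≠ 0 := neg_ne_zero.2 hw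
        rw [hgz w hw, hgz _ hw', hkneg, neg_pow]
        have h1 : ((-1 : ℂ) ^ n) * (-1) ^ n = 1 := by rw [← mul_pow]; simp
        have h2 : (-1 : ℂ) ^ n ≠ 0 := pow_ne_zero _ (by norm_num)
        have h3 : w ^ n ≠ 0 := pow_ne_zero _ hw
        field_simp
        linear_combination (-(σ * k w)) * h1
      have t1 : Tendsto (fun z => g (-z)) (𝓝[≠] (0 : ℂ)) (𝓝 (g (-0))) :=
        ((hgd.continuous.comp continuous_neg).tendsto 0).mono_left nhdsWithin_le_nhds
      have t2 : Tendsto (fun z => σ * (-1) ^ n * g z) (𝓝[≠] (0 : ℂ))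
          (𝓝 (σ * (-1) ^ n * g 0)) :=
        ((continuous_const.mul hgd.continuous).tendsto 0).mono_left nhdsWithin_le_nhds
      exact tendsto_nhds_unique_of_eventuallyEq t1 t2 hcont
    · have hw' : -z ≠ 0 := neg_ne_zero.2 hz0
      rw [hgz z hz0, hgz _ hw', hkneg, neg_pow]
      have h1 : ((-1 : ℂ) ^ n) * (-1) ^ n = 1 := by rw [← mul_pow]; simp
      have h2 : (-1 : ℂ) ^ n ≠ 0 := pow_ne_zero _ (by norm_num)
      have h3 : z ^ n ≠ 0 := pow_ne_zero _ hz0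
      field_simp
      linear_combination (-(σ * k z)) * h1
  -- The quotient has a parity, and `g 0 ≠ 0` excludes oddness.
  have hsign : σ * (-1) ^ n = 1 := by
    have := hgneg 0
    rw [neg_zero, hg0] at this
    exact mul_right_cancel₀ hh0 (by rw [one_mul]; exact this.symm)
  refine ⟨n, g, ⟨hgd, fun N => ?_⟩, hg0 ▸ hh0, fun z => by rw [hgneg, hsign, one_mul], fun z => ?_⟩
  · obtain ⟨C, hC0, hC⟩ := hf.exists_nonneg N
    obtain ⟨D, hD⟩ := (isCompact_closedBall (0 : ℂ) 1).exists_bound_of_continuousOn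
      hgd.continuous.continuousOn
    have hD0 : 0 ≤ D := (norm_nonneg _).trans (hD 0 (by simp))
    refine ⟨2 * C + 2 ^ N * D, fun z => ?_⟩
    have hexp : 1 ≤ Real.exp (R * |z.im|) := Real.one_le_exp (by positivity)
    -- In the unit disc `g` is bounded by compactness; outside, division by `z ^ n` only decreases
    -- the modulus.
    by_cases hz : ‖z‖ ≤ 1
    · have h1 := hD z (by simpa using hz)
      have h2 : (1 + ‖z‖) ^ N ≤ 2 ^ N := pow_le_pow_left₀ (by positivity) (by linarith) _
      calc (1 + ‖z‖) ^ N * ‖g z‖ ≤ 2 ^ N * D := by gcongr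
        _ ≤ (2 * C + 2 ^ N * D) * 1 := by linarith
        _ ≤ _ := by gcongr
    · have hz1 : 1 ≤ ‖z‖ ^ n := one_le_pow₀ (not_le.1 hz).le
      have h1 : ‖g z‖ ≤ ‖k z‖ := by
        rw [hkg z, norm_mul, norm_pow]
        exact le_mul_of_one_le_left (norm_nonneg _) hz1
      have h2 := hC z
      have h3 := hC (-z)
      rw [norm_neg, Complex.neg_im, abs_neg] at h3
      calc (1 + ‖z‖) ^ N * ‖g z‖ ≤ (1 + ‖z‖) ^ N * (‖f z‖ + ‖f (-z)‖) := by
            gcongr; exact h1.trans (hkle z)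
        _ ≤ 2 * C * Real.exp (R * |z.im|) := by linarith
        _ ≤ _ := by
          gcongr
          linarith [show (0 : ℝ) ≤ 2 ^ N * D by positivity]
  · rw [← norm_pow, ← norm_mul, ← hkg]
    exact hkle z

/-- An even entire function is an entire function of the square. -/
theorem exists_entire_sq_eq {g : ℂ → ℂ} (hg : Differentiable ℂ g) (heven : ∀ z, g (-z) = g z) :
    ∃ F : ℂ → ℂ, Differentiable ℂ F ∧ ∀ z, F (z ^ 2) = g z := by
  set F : ℂ → ℂ := fun w => g (w ^ (1 / 2 : ℂ)) with hF
  have hsq : ∀ w : ℂ, (w ^ (1 / 2 : ℂ)) ^ 2 = w := by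
    intro w
    rw [← Complex.cpow_nat_mul]
    norm_num
  have key : ∀ z, F (z ^ 2) = g z := by
    intro z
    have h := hsq (z ^ 2)
    rcases sq_eq_sq_iff_eq_or_eq_neg.1 h with h | h
    · simp only [hF, h]
    · simp only [hF, h, heven]
  have hslit : ∀ w ∈ Complex.slitPlane, DifferentiableAt ℂ F w := by
    intro w hw
    exact (hg _).comp w (differentiableAt_id.cpow (differentiableAt_const _) hw)
  have hne : ∀ w ≠ 0, DifferentiableAt ℂ F w := by
    intro w hw
    by_cases hs : w ∈ Complex.slitPlane
    · exact hslit w hs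
    · have hs' : -w ∈ Complex.slitPlane := by
        rw [Complex.mem_slitPlane_iff] at hs ⊢
        push Not at hs
        left
        have : w.re ≠ 0 := fun h0 => hw (Complex.ext h0 hs.2)
        simp only [Complex.neg_re]
        have := lt_of_le_of_ne hs.1 this
        linarith
      -- Evenness makes the branch of the root irrelevant: `i √(-v)` is also a root of `v` and is
      -- holomorphic across the negative axis. The origin is then a removable singularity.
      have e : F = fun v => g (Complex.I * (-v) ^ (1 / 2 : ℂ)) := by
        ext v
        rw [← key]
        congr 1
        rw [mul_pow, hsq, Complex.I_sq]; ring
      rw [e]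
      exact (hg _).comp w ((DifferentiableAt.cpow (differentiableAt_id.neg)
        (differentiableAt_const _) hs').const_mul _)
  refine ⟨F, fun w => ?_, key⟩
  by_cases hw : w = 0
  · subst hw
    have hc : ContinuousAt F 0 := by
      refine hg.continuous.continuousAt.comp ?_
      exact Complex.continuousAt_cpow_const_of_re_pos (Or.inl le_rfl) (by norm_num)
    refine (Complex.analyticAt_of_differentiable_on_punctured_nhds_of_continuousAt ?_ hc).differentiableAt
    filter_upwards [self_mem_nhdsWithin] with v hv using hne v hv
  · exact hne w hw

/-- If `|Im w|` were larger, the real part of the equation would make `|Re w|` larger than `|Re ζ|`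
too, contradicting `Re w * Im w = Re ζ * Im ζ`. -/
theorem abs_im_le_of_sq_eq {w ζ : ℂ} {c : ℝ} (h : w ^ 2 = (c : ℂ) ^ 2 + ζ ^ 2) :
    |w.im| ≤ |ζ.im| := by
  have h1 := congrArg Complex.re h
  have h2 := congrArg Complex.im h
  simp only [sq, Complex.mul_re, Complex.add_re, Complex.ofReal_re, Complex.ofReal_im,
    Complex.mul_im, Complex.add_im, mul_zero, sub_zero, zero_mul, add_zero, zero_add] at h1 h2
  rw [← sq_le_sq]
  by_contra hcon
  push Not at hcon
  have h3 : ζ.re ^ 2 < w.re ^ 2 := by nlinarith [sq_nonneg c]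
  have h4 : w.re * w.im = ζ.re * ζ.im := by linarith
  have h5 : (w.re * w.im) ^ 2 = (ζ.re * ζ.im) ^ 2 := by rw [h4]
  have h6 : ζ.re ^ 2 * ζ.im ^ 2 < w.re ^ 2 * w.im ^ 2 :=
    mul_lt_mul'' h3 hcon (sq_nonneg _) (sq_nonneg _)
  nlinarith

variable {V : Type*} [NormedAddCommGroup V] [InnerProductSpace ℝ V]

/-- The quadratic form `⟨u + z e, u + z e⟩`, extended to complex `z`. -/
noncomputable def shiftedSq (e u : V) (z : ℂ) : ℂ :=
  (‖u‖ : ℂ) ^ 2 + 2 * z * (inner ℝ u e : ℝ) + z ^ 2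

/-- Choose `w` with `w² = shiftedSq e u z`; with `a = ⟨u, e⟩` and `c² = ‖u‖² - a²` this reads `w² =
c² + (z + a)²`. So `|Im w| ≤ |Im z|`, which preserves the exponential type, and `‖u‖` is controlled
by `|w|` and `|z|`, which converts decay in `w` into decay in `u`. -/
theorem shiftedSq_bound {g F : ℂ → ℂ} (hF : ∀ z, F (z ^ 2) = g z) {R C : ℝ} {N : ℕ}
    (hC0 : 0 ≤ C) (hC : ∀ z, (1 + ‖z‖) ^ (2 * N) * ‖g z‖ ≤ C * Real.exp (R * |z.im|)) (hR : 0 ≤ R)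
    {e : V} (he : ‖e‖ = 1) (u : V) (z : ℂ) :
    (1 + ‖u‖ ^ 2) ^ N * ‖F (shiftedSq e u z)‖ ≤
      (2 * (1 + ‖z‖ ^ 2) ^ 2) ^ N * (C * Real.exp (R * |z.im|)) := by
  set a : ℝ := inner ℝ u e with ha
  have ha2 : a ^ 2 ≤ ‖u‖ ^ 2 := by
    have := abs_real_inner_le_norm u e
    rw [he, mul_one] at this
    exact sq_le_sq' (by linarith [neg_abs_le a]) ((le_abs_self a).trans this)
  set c : ℝ := Real.sqrt (‖u‖ ^ 2 - a ^ 2) with hc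
  have hc2 : c ^ 2 = ‖u‖ ^ 2 - a ^ 2 := Real.sq_sqrt (by linarith)
  obtain ⟨w, hw⟩ := IsAlgClosed.exists_pow_nat_eq (shiftedSq e u z) (n := 2) (by norm_num)
  have hwq : w ^ 2 = (c : ℂ) ^ 2 + (z + a) ^ 2 := by
    have : (c : ℂ) ^ 2 = (‖u‖ : ℂ) ^ 2 - (a : ℂ) ^ 2 := by exact_mod_cast hc2
    rw [hw, this, shiftedSq]
    ring
  have him : |w.im| ≤ |z.im| := by
    have := abs_im_le_of_sq_eq hwq
    simpa using this
  have hre : c ^ 2 + (z.re + a) ^ 2 - z.im ^ 2 ≤ ‖w‖ ^ 2 := by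
    have h1 := congrArg Complex.re hwq
    have h2 : (w ^ 2).re ≤ ‖w‖ ^ 2 := by
      rw [← norm_pow]; exact Complex.re_le_norm _
    have h3 : ((c : ℂ) ^ 2 + (z + a) ^ 2).re = c ^ 2 + (z.re + a) ^ 2 - z.im ^ 2 := by
      simp [sq, Complex.add_re, Complex.mul_re]; ring
    rw [h3] at h1
    linarith
  have hz2 : ‖z‖ ^ 2 = z.re ^ 2 + z.im ^ 2 := by
    rw [← Complex.normSq_eq_norm_sq, Complex.normSq_apply]; ring
  have hu : 1 + ‖u‖ ^ 2 ≤ 2 * (1 + ‖z‖ ^ 2) ^ 2 * (1 + ‖w‖) ^ 2 := by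
    have h1 : ‖u‖ ^ 2 ≤ 2 * (‖w‖ ^ 2 + z.im ^ 2) + 2 * z.re ^ 2 := by
      have : ‖u‖ ^ 2 = c ^ 2 + a ^ 2 := by linarith
      nlinarith [sq_nonneg (a + 2 * z.re), sq_nonneg c]
    have h2 : ‖u‖ ^ 2 ≤ 2 * ‖w‖ ^ 2 + 2 * ‖z‖ ^ 2 := by linarith
    have h3 : 1 ≤ (1 + ‖z‖ ^ 2) := by nlinarith [sq_nonneg ‖z‖]
    have h4 : 1 + ‖z‖ ^ 2 ≤ (1 + ‖z‖ ^ 2) ^ 2 := by nlinarith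
    have h5 : 1 + ‖w‖ ^ 2 ≤ (1 + ‖w‖) ^ 2 := by nlinarith [norm_nonneg w]
    have h6 : (1 + ‖z‖ ^ 2) * (1 + ‖w‖ ^ 2) ≤ (1 + ‖z‖ ^ 2) ^ 2 * (1 + ‖w‖) ^ 2 := by gcongr
    nlinarith [sq_nonneg ‖w‖, sq_nonneg ‖z‖, mul_nonneg (sq_nonneg ‖w‖) (sq_nonneg ‖z‖)]
  have hFg : F (shiftedSq e u z) = g w := by rw [← hw, hF]
  rw [hFg]
  calc (1 + ‖u‖ ^ 2) ^ N * ‖g w‖ ≤ (2 * (1 + ‖z‖ ^ 2) ^ 2 * (1 + ‖w‖) ^ 2) ^ N * ‖g w‖ := by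
        gcongr
    _ = (2 * (1 + ‖z‖ ^ 2) ^ 2) ^ N * ((1 + ‖w‖) ^ (2 * N) * ‖g w‖) := by
        rw [mul_pow _ ((1 + ‖w‖) ^ 2), ← pow_mul, mul_assoc]
    _ ≤ (2 * (1 + ‖z‖ ^ 2) ^ 2) ^ N * (C * Real.exp (R * |w.im|)) := by
        exact mul_le_mul_of_nonneg_left (hC w) (by positivity)
    _ ≤ _ := by gcongr

theorem shiftedSq_translate (e u : V) (he : ‖e‖ = 1) (x : ℝ) (z : ℂ) :
    shiftedSq e (u + x • e) z = shiftedSq e u (z + x) := by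
  have h1 : ‖u + x • e‖ ^ 2 = ‖u‖ ^ 2 + 2 * x * inner ℝ u e + x ^ 2 := by
    rw [norm_add_sq_real, inner_smul_right, norm_smul, he]
    simp; ring
  have h2 : inner ℝ (u + x • e) e = inner ℝ u e + x := by
    rw [inner_add_left, inner_smul_left, real_inner_self_eq_norm_sq, he]; simp
  have h1' : ((‖u + x • e‖ : ℝ) : ℂ) ^ 2 = (‖u‖ : ℂ) ^ 2 + 2 * x * (inner ℝ u e : ℝ) + x ^ 2 := by
    exact_mod_cast h1
  rw [shiftedSq, shiftedSq, h1', h2]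
  push_cast
  ring

variable [FiniteDimensional ℝ V] [MeasurableSpace V] [BorelSpace V]

/-- The Fourier transform of the radial function with profile `g` vanishes outside of the ball of
radius `R`. -/
theorem integral_radial_eq_zero {R : ℝ} (hR : 0 ≤ R) {g : ℂ → ℂ} (hg : PaleyWiener R g)
    (heven : ∀ z, g (-z) = g z) {t : V} (ht : R < ‖t‖) :
    ∫ u : V, g ‖u‖ * Complex.exp (Complex.I * (inner ℝ u t : ℝ)) = 0 := by
  obtain ⟨F, hFd, hF⟩ := exists_entire_sq_eq hg.1 heven
  set T := ‖t‖ with hT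
  have hTpos : 0 < T := hR.trans_lt ht
  set e : V := T⁻¹ • t with he
  have he1 : ‖e‖ = 1 := by
    rw [he, norm_smul, norm_inv, Real.norm_of_nonneg hTpos.le, ← hT, inv_mul_cancel₀ hTpos.ne']
  have het : inner ℝ e t = T := by
    rw [he, inner_smul_left, real_inner_self_eq_norm_sq, ← hT]
    simp only [conj_trivial]
    field_simp
  -- The integrand moved to the complex point `u + z e`, where `e` is the direction of `t`. The
  -- profile has to be a function of the square so that it extends holomorphically to such points.
  set Φ : V → ℂ → ℂ := fun u z =>
    F (shiftedSq e u z) * Complex.exp (Complex.I * ((inner ℝ u t : ℝ) + z * T)) with hΦ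
  -- With this `N`, `(1 + ‖u‖²)^(-N)` is integrable.
  set N := Module.finrank ℝ V + 1 with hN
  obtain ⟨C, hC0, hC⟩ := hg.exists_nonneg (2 * N)
  set j : V → ℝ := fun u => ((1 + ‖u‖ ^ 2) ^ N)⁻¹ with hj
  have hji : Integrable j := by
    have h := integrable_rpow_neg_one_add_norm_sq (E := V) (μ := volume) (r := 2 * N)
      (by rw [hN]; push_cast; linarith [(Nat.cast_nonneg (Module.finrank ℝ V) : (0 : ℝ) ≤ _)])
    refine h.congr (ae_of_all _ fun u => ?_)
    simp only [hj]
    have : (-(2 * (N : ℝ)) / 2) = -(N : ℝ) := by ring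
    rw [this, Real.rpow_neg (by positivity), Real.rpow_natCast]
  have hbound : ∀ u z, ‖Φ u z‖ ≤ (2 * (1 + ‖z‖ ^ 2) ^ 2) ^ N *
      (C * Real.exp (R * |z.im|)) * Real.exp (-(T * z.im)) * j u := by
    intro u z
    have h1 := shiftedSq_bound hF hC0 hC hR he1 u z
    have h2 : ‖Complex.exp (Complex.I * ((inner ℝ u t : ℝ) + z * T))‖ = Real.exp (-(T * z.im)) := by
      rw [Complex.norm_exp]
      congr 1
      simp; ring
    have hpos : 0 < (1 + ‖u‖ ^ 2) ^ N := by positivity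
    rw [hΦ, norm_mul, h2]
    have h3 : ‖F (shiftedSq e u z)‖ ≤ (2 * (1 + ‖z‖ ^ 2) ^ 2) ^ N *
      (C * Real.exp (R * |z.im|)) * j u := by
      rw [hj, ← div_eq_mul_inv, le_div_iff₀ hpos]
      linarith
    calc ‖F (shiftedSq e u z)‖ * Real.exp (-(T * z.im))
        ≤ ((2 * (1 + ‖z‖ ^ 2) ^ 2) ^ N * (C * Real.exp (R * |z.im|)) * j u) *
          Real.exp (-(T * z.im)) := by gcongr
      _ = _ := by ring
  have hΦd : ∀ u, Differentiable ℂ (Φ u) := by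
    intro u
    refine Differentiable.mul (hFd.comp ?_) ?_
    · unfold shiftedSq; fun_prop
    · fun_prop
  have hΦc : ∀ z, Continuous fun u => Φ u z := by
    intro z
    refine (hFd.continuous.comp ?_).mul (by fun_prop)
    unfold shiftedSq; fun_prop
  have hΦj : Continuous (Function.uncurry Φ) := by
    refine (hFd.continuous.comp ?_).mul (by fun_prop)
    unfold shiftedSq; fun_prop
  set K : ℂ → ℂ := fun z => ∫ u, Φ u z with hK
  have hunif : ∀ m : ℝ, 0 ≤ m → ∀ u z, ‖z‖ ≤ m → ‖Φ u z‖ ≤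
      (2 * (1 + m ^ 2) ^ 2) ^ N * (C * Real.exp (R * m)) * Real.exp (T * m) * j u := by
    intro m hm u z hz
    refine (hbound u z).trans ?_
    have h1 : |z.im| ≤ m := (Complex.abs_im_le_norm z).trans hz
    have h2 : -(T * z.im) ≤ T * m := by nlinarith [neg_abs_le z.im]
    have : 0 ≤ j u := by positivity
    gcongr
  have hKd : ∀ z₀, DifferentiableAt ℂ K z₀ := by
    intro z₀
    set m := ‖z₀‖ + 2 with hm
    have hm0 : 0 ≤ m := by positivity
    have h := hasDerivAt_integral_of_dominated_loc_of_deriv_le (μ := (volume : Measure V))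
      (F := fun z u => Φ u z) (F' := fun z u => deriv (Φ u) z) (x₀ := z₀)
      (s := Metric.ball z₀ 1)
      (bound := fun u => (2 * (1 + m ^ 2) ^ 2) ^ N * (C * Real.exp (R * m)) *
        Real.exp (T * m) * j u)
      (Metric.ball_mem_nhds z₀ one_pos)
      (Eventually.of_forall fun z => (hΦc z).aestronglyMeasurable)
      ((hji.const_mul _).mono' (hΦc z₀).aestronglyMeasurable
        (ae_of_all _ fun u => hunif m hm0 u z₀ (by linarith)))
      ?_ (ae_of_all _ fun u z hz => ?_) (hji.const_mul _)
      (ae_of_all _ fun u z _ => (hΦd u z).hasDerivAt)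
    · exact h.2.differentiableAt
    · exact ((stronglyMeasurable_deriv_with_param hΦj).comp_measurable
        (measurable_id.prodMk measurable_const)).aestronglyMeasurable
    · have h1 := Complex.norm_deriv_le_of_forall_mem_sphere_norm_le (c := z) (R := 1)
        (f := Φ u) one_pos (hΦd u).diffContOnCl (fun w hw => hunif m hm0 u w (by
          have h2 := mem_sphere_iff_norm.1 hw
          have h3 := mem_ball_iff_norm.1 hz
          have h4 : w = (w - z) + (z - z₀) + z₀ := by ring
          rw [h4]
          refine (norm_add_le _ _).trans ?_
          have := norm_add_le (w - z) (z - z₀)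
          linarith))
      simpa using h1
  -- A real shift of `z` is a translation of the integration variable, so the entire function `K` is
  -- constant along horizontal lines and hence constant.
  have hKx : ∀ (z : ℂ) (x : ℝ), K (z + x) = K z := by
    intro z x
    have h1 : ∀ u, Φ u (z + x) = Φ (u + x • e) z := by
      intro u
      simp only [hΦ, shiftedSq_translate e u he1]
      congr 2
      rw [inner_add_left, inner_smul_left, het]
      simp
      ring
    simp only [hK, h1]
    exact integral_add_right_eq_self (fun u => Φ u z) (x • e)
  have hKc : ∀ z, deriv K z = 0 := by
    intro z
    have h1 : HasDerivAt (fun x : ℝ => K (z + x)) (deriv K z) 0 := by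
      have h2 : HasDerivAt K (deriv K z) (z + ((0 : ℝ) : ℂ)) := by
        simpa using (hKd z).hasDerivAt
      have h3 : HasDerivAt (fun x : ℝ => z + (x : ℂ)) 1 0 :=
        (Complex.ofRealCLM.hasDerivAt (x := (0 : ℝ))).const_add z
      have h4 := HasDerivAt.scomp (0 : ℝ) h2 h3
      simpa [Function.comp_def] using h4
    simp only [hKx] at h1
    exact h1.unique (hasDerivAt_const _ _)
  have hconst : ∀ z, K z = K 0 := fun z => is_const_of_deriv_eq_zero hKd hKc z 0
  have hK0 : K 0 = ∫ u : V, g ‖u‖ * Complex.exp (Complex.I * (inner ℝ u t : ℝ)) := by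
    simp only [hK, hΦ, shiftedSq]
    congr 1; ext u
    rw [← hF]
    simp
  rw [← hK0]
  set J := ∫ u, j u with hJ
  have hJ0 : 0 ≤ J := integral_nonneg fun u => by positivity
  -- At `z = i y` the phase contributes `e^{-Ty}` and the profile at most `e^{Ry}` up to powers of
  -- `y`; as `T > R`, the constant value of `K` is 0.
  have hKy : ∀ y : ℝ, 1 ≤ y → ‖K 0‖ ≤ 8 ^ N * C * J * (y ^ (4 * N) / Real.exp ((T - R) * y)) := by
    intro y hy
    rw [← hconst (Complex.I * y)]
    have h1 : ‖K (Complex.I * y)‖ ≤ ∫ u, (2 * (1 + y ^ 2) ^ 2) ^ N *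
      (C * Real.exp (R * y)) * Real.exp (-(T * y)) * j u := by
      refine norm_integral_le_of_norm_le (hji.const_mul _) (ae_of_all _ fun u => ?_)
      have := hbound u (Complex.I * y)
      simpa [abs_of_nonneg (zero_le_one.trans hy)] using this
    rw [integral_const_mul] at h1
    refine h1.trans ?_
    have h2 : (2 * (1 + y ^ 2) ^ 2) ^ N ≤ 8 ^ N * y ^ (4 * N) := by
      rw [pow_mul, ← mul_pow]
      refine pow_le_pow_left₀ (by positivity) ?_ _
      have : 1 ≤ y ^ 2 := one_le_pow₀ hy
      nlinarith
    have h3 : Real.exp (R * y) * Real.exp (-(T * y)) = (Real.exp ((T - R) * y))⁻¹ := by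
      rw [← Real.exp_add, ← Real.exp_neg]; congr 1; ring
    calc (2 * (1 + y ^ 2) ^ 2) ^ N * (C * Real.exp (R * y)) * Real.exp (-(T * y)) * J
        = (2 * (1 + y ^ 2) ^ 2) ^ N * C * (Real.exp (R * y) * Real.exp (-(T * y))) * J := by ring
      _ ≤ (8 ^ N * y ^ (4 * N)) * C * (Real.exp (R * y) * Real.exp (-(T * y))) * J := by gcongr
      _ = _ := by rw [h3]; ring
  have hlim : Tendsto (fun y : ℝ => 8 ^ N * C * J * (y ^ (4 * N) / Real.exp ((T - R) * y)))
      atTop (𝓝 0) := by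
    have := (isLittleO_pow_exp_pos_mul_atTop (4 * N) (b := T - R) (by linarith)).tendsto_div_nhds_zero
    simpa using this.const_mul (8 ^ N * C * J)
  have : ‖K 0‖ ≤ 0 := ge_of_tendsto hlim (by
    filter_upwards [eventually_ge_atTop 1] with y hy using hKy y hy)
  simpa using this

end PaleyWiener

end LinearRigidity

namespace LinearRigidity

/-! ### Holomorphic extension along a line of functions with compactly supported Fourier transform.
-/

section LineExtension

open scoped FourierTransform SchwartzMap

variable {d : ℕ}

theorem eq_of_eq_on_real {f g : ℂ → ℂ} (hf : Differentiable ℂ f) (hg : Differentiable ℂ g)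
    (h : ∀ x : ℝ, f x = g x) : f = g := by
  refine AnalyticOnNhd.eq_of_frequently_eq (z₀ := 0) (fun z _ => hf.analyticAt z)
    (fun z _ => hg.analyticAt z) ?_
  have ht : Tendsto (fun x : ℝ => (x : ℂ)) (𝓝[≠] 0) (𝓝[≠] 0) := by
    refine tendsto_nhdsWithin_of_tendsto_nhds_of_eventually_within _ ?_ ?_
    · exact (Complex.continuous_ofReal.tendsto' 0 0 (by simp)).mono_left nhdsWithin_le_nhds
    · filter_upwards [self_mem_nhdsWithin] with x hx
      simpa using hx
  exact ht.frequently (Eventually.of_forall h).frequently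

/-- The holomorphic extension of `x ↦ ψ (u + x e)`, written as an inverse Fourier transform. -/
noncomputable def lineExtension (ψ : 𝓢(Space d, ℂ)) (u e : Space d) (z : ℂ) : ℂ :=
  ((2 * Real.pi : ℂ) ^ d)⁻¹ * ∫ t, Complex.exp (Complex.I *
    (((inner ℝ u t : ℝ) : ℂ) + z * ((inner ℝ e t : ℝ) : ℂ))) * schwartzFourier ψ t

theorem lineExtension_ofReal (ψ : 𝓢(Space d, ℂ)) (u e : Space d) (x : ℝ) :
    lineExtension ψ u e x = ψ (u + x • e) := by
  have h := fourier_eq_of_fourier_neg (schwartzFourier ψ).integrable ψ.integrable ψ.continuous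
    (fun t => schwartzFourier_apply ψ t) (u + x • e)
  have hpi : ((2 * Real.pi : ℂ) ^ d) ≠ 0 := pow_ne_zero _ (by exact_mod_cast two_pi_ne_zero)
  rw [lineExtension, inv_mul_eq_iff_eq_mul₀ hpi, ← h]
  unfold fourier
  congr 1; ext t
  congr 2
  rw [inner_neg_left, inner_add_left, inner_smul_left]
  simp
  ring

theorem norm_exp_line (a b : ℝ) (z : ℂ) :
    ‖Complex.exp (Complex.I * ((a : ℂ) + z * (b : ℂ)))‖ = Real.exp (-(z.im * b)) := by
  rw [Complex.norm_exp]
  congr 1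
  simp

theorem norm_exp_line_mul_le {ψ : 𝓢(Space d, ℂ)} {K : Set (Space d)}
    (hψ : ∀ t ∉ K, schwartzFourier ψ t = 0) {e : Space d} {R : ℝ}
    (hK : ∀ t ∈ K, |inner ℝ e t| ≤ R) (u : Space d) (z : ℂ) (t : Space d) :
    ‖Complex.exp (Complex.I * (((inner ℝ u t : ℝ) : ℂ) + z * ((inner ℝ e t : ℝ) : ℂ))) *
      schwartzFourier ψ t‖ ≤ Real.exp (R * |z.im|) * ‖schwartzFourier ψ t‖ := by
  rw [norm_mul, norm_exp_line]
  by_cases ht : t ∈ K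
  · gcongr
    have h1 := hK t ht
    have h2 : -(z.im * inner ℝ e t) ≤ |z.im| * |inner ℝ e t| := by
      rw [← abs_mul]; exact neg_le_abs _
    calc -(z.im * inner ℝ e t) ≤ |z.im| * |inner ℝ e t| := h2
      _ ≤ |z.im| * R := by gcongr
      _ = _ := mul_comm _ _
  · rw [hψ t ht]; simp

theorem norm_lineExtension_le {ψ : 𝓢(Space d, ℂ)} {K : Set (Space d)}
    (hψ : ∀ t ∉ K, schwartzFourier ψ t = 0) {e : Space d} {R : ℝ}
    (hK : ∀ t ∈ K, |inner ℝ e t| ≤ R) (u : Space d) :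
    ∃ C : ℝ, ∀ z, ‖lineExtension ψ u e z‖ ≤ C * Real.exp (R * |z.im|) := by
  refine ⟨‖((2 * Real.pi : ℂ) ^ d)⁻¹‖ * ∫ t, ‖schwartzFourier ψ t‖, fun z => ?_⟩
  rw [lineExtension, norm_mul, mul_assoc]
  gcongr
  refine (norm_integral_le_of_norm_le ((schwartzFourier ψ).integrable.norm.const_mul _)
    (ae_of_all _ (norm_exp_line_mul_le hψ hK u z))).trans_eq ?_
  rw [integral_const_mul, mul_comm]

theorem differentiable_lineExtension {ψ : 𝓢(Space d, ℂ)} {K : Set (Space d)}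
    (hψ : ∀ t ∉ K, schwartzFourier ψ t = 0) {e : Space d} {R : ℝ} (hR : 0 ≤ R)
    (hK : ∀ t ∈ K, |inner ℝ e t| ≤ R) (u : Space d) :
    Differentiable ℂ (lineExtension ψ u e) := by
  refine Differentiable.const_mul (fun z₀ => ?_) _
  set Φ : ℂ → Space d → ℂ := fun z t => Complex.exp (Complex.I *
    (((inner ℝ u t : ℝ) : ℂ) + z * ((inner ℝ e t : ℝ) : ℂ))) * schwartzFourier ψ t with hΦ
  have hc : ∀ z, Continuous (Φ z) := fun z =>
    Continuous.mul (by fun_prop) (schwartzFourier ψ).continuous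
  set m := ‖z₀‖ + 1 with hm
  have h := hasDerivAt_integral_of_dominated_loc_of_deriv_le (μ := (volume : Measure (Space d)))
    (F := Φ) (F' := fun z t => Complex.I * ((inner ℝ e t : ℝ) : ℂ) * Φ z t) (x₀ := z₀)
    (s := Metric.ball z₀ 1)
    (bound := fun t => R * Real.exp (R * m) * ‖schwartzFourier ψ t‖)
    (Metric.ball_mem_nhds z₀ one_pos)
    (Eventually.of_forall fun z => (hc z).aestronglyMeasurable)
    (((schwartzFourier ψ).integrable.norm.const_mul _).mono' (hc z₀).aestronglyMeasurable
      (ae_of_all _ (norm_exp_line_mul_le hψ hK u z₀)))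
    (Continuous.aestronglyMeasurable (Continuous.mul (by fun_prop) (hc z₀)))
    (ae_of_all _ fun t z hz => ?_)
    ((schwartzFourier ψ).integrable.norm.const_mul _)
    (ae_of_all _ fun t z _ => ?_)
  · exact h.2.differentiableAt
  · have h1 := norm_exp_line_mul_le hψ hK u z t
    have h2 : |z.im| ≤ m := by
      refine (Complex.abs_im_le_norm z).trans ?_
      have h3 := mem_ball_iff_norm.1 hz
      have h4 := norm_add_le (z - z₀) z₀
      rw [sub_add_cancel] at h4
      linarith
    by_cases ht : t ∈ K
    · rw [norm_mul, norm_mul, Complex.norm_I, one_mul, Complex.norm_real, mul_assoc]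
      refine mul_le_mul (hK t ht) (h1.trans ?_) (norm_nonneg _) hR
      gcongr
    · simp [hΦ, hψ t ht]
  · have h1 : HasDerivAt (fun z : ℂ => Complex.I *
        (((inner ℝ u t : ℝ) : ℂ) + z * ((inner ℝ e t : ℝ) : ℂ)))
        (Complex.I * ((inner ℝ e t : ℝ) : ℂ)) z := by
      have := (((hasDerivAt_id z).mul_const ((inner ℝ e t : ℝ) : ℂ)).const_add
        ((inner ℝ u t : ℝ) : ℂ)).const_mul Complex.I
      simpa using this
    refine (h1.cexp.mul_const (schwartzFourier ψ t)).congr_deriv ?_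
    simp only [hΦ]
    ring

/-- The linear form `⟨u, e⟩` as a polynomial. -/
noncomputable def innerPoly (e : Space d) : MvPolynomial (Fin d) ℂ :=
  ∑ i, MvPolynomial.C (e i : ℂ) * MvPolynomial.X i

theorem polyFun_innerPoly_pow (e : Space d) (N : ℕ) (u : Space d) :
    polyFun (innerPoly e ^ N) u = ((inner ℝ u e : ℝ) : ℂ) ^ N := by
  simp [polyFun, innerPoly, PiLp.inner_apply]

/-- Restrictions to lines of a Schwartz function with compactly supported Fourier transform. -/
theorem exists_paleyWiener_line {ψ : 𝓢(Space d, ℂ)} {K : Set (Space d)} (hKc : IsClosed K)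
    (hψ : ∀ t ∉ K, schwartzFourier ψ t = 0) {u e : Space d} (he : ‖e‖ = 1) (hu : inner ℝ u e = 0)
    {R : ℝ} (hR : 0 ≤ R) (hK : ∀ t ∈ K, |inner ℝ e t| ≤ R) :
    ∃ f, PaleyWiener R f ∧ ∀ x : ℝ, f x = ψ (u + x • e) := by
  have hd := differentiable_lineExtension hψ hR hK u
  refine ⟨lineExtension ψ u e, ⟨hd, fun N => ?_⟩,
    fun x => lineExtension_ofReal ψ u e x⟩
  have hψN := schwartzFourier_polyMul_eq_zero hKc (innerPoly e ^ N) hψ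
  -- On the line, `⟨u + x e, e⟩ = x` because `u ⟂ e`. So `z ^ N` times the extension is again an
  -- extension of the same type, with the same band, and inherits the exponential bound; this yields
  -- the polynomial decay.
  have heq : lineExtension (polyMul (innerPoly e ^ N) ψ) u e
      = fun z => z ^ N * lineExtension ψ u e z := by
    refine eq_of_eq_on_real (differentiable_lineExtension hψN hR hK u)
      ((differentiable_id.pow N).mul hd) fun x => ?_
    rw [lineExtension_ofReal, lineExtension_ofReal, polyMul_apply, polyFun_innerPoly_pow,
      inner_add_left, hu, inner_smul_left, real_inner_self_eq_norm_sq, he]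
    simp
  obtain ⟨C, hC⟩ := norm_lineExtension_le hψ hK u
  obtain ⟨D, hD⟩ := norm_lineExtension_le hψN hK u
  refine ⟨2 ^ (N - 1) * (C + D), fun z => ?_⟩
  have h1 := hC z
  have h2 := hD z
  rw [heq, norm_mul, norm_pow] at h2
  have h3 : (1 + ‖z‖) ^ N ≤ 2 ^ (N - 1) * (1 ^ N + ‖z‖ ^ N) :=
    add_pow_le zero_le_one (norm_nonneg z) N
  rw [one_pow] at h3
  calc (1 + ‖z‖) ^ N * ‖lineExtension ψ u e z‖
      ≤ 2 ^ (N - 1) * (1 + ‖z‖ ^ N) * ‖lineExtension ψ u e z‖ := by gcongr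
    _ = 2 ^ (N - 1) * (‖lineExtension ψ u e z‖ + ‖z‖ ^ N * ‖lineExtension ψ u e z‖) := by ring
    _ ≤ 2 ^ (N - 1) * (C * Real.exp (R * |z.im|) + D * Real.exp (R * |z.im|)) := by gcongr
    _ = _ := by ring

end LineExtension

/-! ### Turning band-limited functions into Schwartz functions. -/

section Mollification

open scoped FourierTransform SchwartzMap

variable {d : ℕ}

/-- Multiplication by a Schwartz function makes a band-limited function Schwartz, at the cost of a
slightly larger band. -/
theorem exists_schwartz_mul_eq {χ : Space d → ℂ} (hχ : Integrable χ) (hc : Continuous χ)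
    {K : Set (Space d)} (hK : IsClosed K) (hb : Bornology.IsBounded K)
    (hχK : ∀ t ∉ K, fourier χ t = 0) {δ : ℝ} (hδ : 0 < δ) :
    ∃ r φ : 𝓢(Space d, ℂ), r 0 ≠ 0 ∧ (∀ u, φ u = χ u * r u) ∧
      ∀ t ∉ Metric.cthickening δ K, schwartzFourier φ t = 0 := by
  obtain ⟨r, hr0, hr⟩ := exists_schwartz_fourier_support (d := d) hδ
  have hkc : Continuous (fourier χ) := continuous_measureFourier hχ
  have hks : HasCompactSupport (fourier χ) :=
    HasCompactSupport.intro (Metric.isCompact_of_isClosed_isBounded hK hb) hχK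
  have hki : Integrable (fourier χ) := hkc.integrable_of_hasCompactSupport hks
  have hρs : HasCompactSupport (schwartzFourier r) :=
    HasCompactSupport.intro (isCompact_closedBall (0 : Space d) δ) hr
  -- The Fourier transform of `χ r` is `(2π)^(-d)` times this convolution, which is smooth because
  -- one factor is, and supported in the `δ`-thickening of `K`.
  set G : Space d → ℂ :=
    convolution (fourier χ) (schwartzFourier r) (ContinuousLinearMap.mul ℂ ℂ) with hG
  have hGs : HasCompactSupport G :=
    HasCompactSupport.convolution (ContinuousLinearMap.mul ℂ ℂ) hks hρs
  have hGeq : G = convolution (fourier χ) (schwartzFourier r) (ContinuousLinearMap.mul ℝ ℂ) := by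
    ext t
    simp only [hG, convolution_def, ContinuousLinearMap.mul_apply']
  have hGd : ContDiff ℝ ((⊤ : ℕ∞) : WithTop ℕ∞) G := by
    rw [hGeq]
    exact hρs.contDiff_convolution_right (ContinuousLinearMap.mul ℝ ℂ) hkc.locallyIntegrable
      ((schwartzFourier r).smooth _)
  have hG0 : ∀ t ∉ Metric.cthickening δ K, G t = 0 := by
    intro t ht
    by_contra hne
    apply ht
    obtain ⟨a, ha, b, hb, rfl⟩ := Set.mem_add.1
      (support_convolution_subset (ContinuousLinearMap.mul ℂ ℂ) (Function.mem_support.2 hne))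
    have ha' : a ∈ K := by
      by_contra h
      exact ha (hχK a h)
    have hb' : b ∈ Metric.closedBall (0 : Space d) δ := by
      by_contra h
      exact hb (hr b h)
    exact Metric.mem_cthickening_of_dist_le _ a δ K ha' (by simpa using hb')
  have hpi : ((2 * Real.pi : ℂ) ^ d) ≠ 0 := pow_ne_zero _ (by exact_mod_cast two_pi_ne_zero)
  obtain ⟨φ, hφ⟩ := exists_schwartzFourier_eq
    (((2 * Real.pi : ℂ) ^ d)⁻¹ • hGs.toSchwartzMap hGd)
  have hφt : ∀ t, schwartzFourier φ t = ((2 * Real.pi : ℂ) ^ d)⁻¹ * G t := fun t => by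
    rw [hφ]; rfl
  refine ⟨r, φ, hr0, fun u => ?_, fun t ht => by rw [hφt, hG0 t ht, mul_zero]⟩
  have h1 := fourier_eq_of_fourier_neg (schwartzFourier φ).integrable φ.integrable φ.continuous
    (fun t => schwartzFourier_apply φ t) u
  have h2 : fourier (schwartzFourier φ) (-u) = ((2 * Real.pi : ℂ) ^ d)⁻¹ * fourier G (-u) := by
    rw [show (schwartzFourier φ : Space d → ℂ) = fun t => ((2 * Real.pi : ℂ) ^ d)⁻¹ * G t from
      funext hφt]
    exact measureFourier_const_mul volume _ G (-u)
  rw [h2, hG, fourier_convolution_eq hki (schwartzFourier r).integrable,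
    fourier_eq_of_fourier_neg hki hχ hc (fun _ => rfl) u,
    fourier_eq_of_fourier_neg (schwartzFourier r).integrable r.integrable r.continuous
    (fun t => schwartzFourier_apply r t) u] at h1
  refine mul_left_cancel₀ hpi (h1.symm.trans ?_)
  field_simp

/-- A criterion against rigidity by means of a band-limited function that is not rapidly
decreasing. -/
theorem not_isLinearlyRigid_of_bandLimited {Ω : Type*} [MeasurableSpace Ω] {P : Measure Ω}
    (M : RandomMeasure d P) {S' : Measure (Space d)} {s : Space d → ℝ≥0}
    (hs : IsSpectralDensity S' s)
    (hS' : ∀ f, IsTestFunction f →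
      ∫⁻ u, ‖fourier f u‖ₑ ^ 2 ∂S' = ∫⁻ ω, ‖M.statistic f ω‖ₑ ^ 2 ∂P)
    {A K : Set (Space d)} (hA : MeasurableSet A) (hb : Bornology.IsBounded A)
    (hK : IsClosed K) {δ : ℝ} (hδ : 0 < δ) (hKA : Metric.cthickening δ K ⊆ A)
    {κ₀ : Fin d →₀ ℕ} {Q : MvPolynomial (Fin d) ℂ}
    (hQ : Q.coeff κ₀ ≠ 0) (hQ' : ∀ m, Q.coeff m ≠ 0 → m ≤ κ₀)
    {χ : Space d → ℂ} (hχ : Integrable χ) (hc : Continuous χ) (hχ0 : χ 0 ≠ 0)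
    (hχK : ∀ t ∉ K, fourier χ t = 0) {N : ℕ}
    (hfin : ∫⁻ u, ‖polyFun (MvPolynomial.monomial κ₀ 1) u * χ u‖ₑ ^ 2 *
      (ENNReal.ofReal ((1 + ‖u‖) ^ N))⁻¹ * (s u : ℝ≥0∞)⁻¹ ≠ ∞) :
    ¬ M.IsLinearlyRigid A (polyFun Q) := by
  have hKb : Bornology.IsBounded K := hb.subset ((Metric.self_subset_cthickening K).trans hKA)
  obtain ⟨r, φ, hr0, hφ, hφK⟩ := exists_schwartz_mul_eq hχ hc hK hKb hχK hδ
  classical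
  refine not_isLinearlyRigid M hs hS' hA hb Metric.isClosed_cthickening hKA hQ hQ'
    (p := MvPolynomial.monomial κ₀ 1) (by simp) (fun m _ hm => by
      rw [MvPolynomial.coeff_monomial, if_neg (Ne.symm hm)]) φ
    (by rw [hφ]; exact mul_ne_zero hχ0 hr0) hφK ?_
  obtain ⟨C, hC0, hC⟩ := exists_schwartz_decay r N
  have hle : ∀ u, ‖polyFun (MvPolynomial.monomial κ₀ 1) u * φ u‖ₑ ^ 2 * (s u : ℝ≥0∞)⁻¹ ≤
      ENNReal.ofReal C ^ 2 * (‖polyFun (MvPolynomial.monomial κ₀ 1) u * χ u‖ₑ ^ 2 *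
        (ENNReal.ofReal ((1 + ‖u‖) ^ N))⁻¹ * (s u : ℝ≥0∞)⁻¹) := by
    intro u
    have hpos : 0 < (1 + ‖u‖) ^ N := by positivity
    have h1 : ‖r u‖ₑ ≤ ENNReal.ofReal C * (ENNReal.ofReal ((1 + ‖u‖) ^ N))⁻¹ := by
      rw [← div_eq_mul_inv, ENNReal.le_div_iff_mul_le (Or.inl (by simpa using hpos))
        (Or.inl ENNReal.ofReal_ne_top), ← ofReal_norm, ← ENNReal.ofReal_mul (norm_nonneg _)]
      exact ENNReal.ofReal_le_ofReal (by rw [mul_comm]; exact hC u)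
    have h2 : (ENNReal.ofReal ((1 + ‖u‖) ^ N))⁻¹ ≤ 1 := by
      rw [ENNReal.inv_le_one, ENNReal.one_le_ofReal]
      exact one_le_pow₀ (by linarith [norm_nonneg u])
    calc ‖polyFun (MvPolynomial.monomial κ₀ 1) u * φ u‖ₑ ^ 2 * (s u : ℝ≥0∞)⁻¹
        = ‖polyFun (MvPolynomial.monomial κ₀ 1) u * χ u‖ₑ ^ 2 * ‖r u‖ₑ ^ 2 * (s u : ℝ≥0∞)⁻¹ := by
          rw [hφ, ← mul_assoc, enorm_mul _ (r u), mul_pow]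
      _ ≤ ‖polyFun (MvPolynomial.monomial κ₀ 1) u * χ u‖ₑ ^ 2 *
          (ENNReal.ofReal C ^ 2 * (ENNReal.ofReal ((1 + ‖u‖) ^ N))⁻¹) * (s u : ℝ≥0∞)⁻¹ := by
          gcongr
          refine (pow_le_pow_left' h1 2).trans ?_
          rw [mul_pow]
          gcongr
          rw [sq]
          exact mul_le_of_le_one_left' h2
      _ = _ := by ring
  refine ((lintegral_mono hle).trans_lt ?_).ne
  rw [lintegral_const_mul' _ _ (by simp)]
  exact ENNReal.mul_lt_top (by simp) hfin.lt_top

end Mollification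

end LinearRigidity

namespace LinearRigidity

/-! ### Integration along rays. -/

section Polar

variable {V : Type*} [NormedAddCommGroup V] [NormedSpace ℝ V] [FiniteDimensional ℝ V] [Nontrivial V]
  [MeasurableSpace V] [BorelSpace V] {μ : Measure V} [μ.IsAddHaarMeasure]

theorem lintegral_polar {F : V → ℝ≥0∞} (hF : Measurable F) :
    ∫⁻ u, F u ∂μ = ∫⁻ θ : Metric.sphere (0 : V) 1, ∫⁻ r : Set.Ioi (0 : ℝ), F (r.1 • θ.1)
      ∂(Measure.volumeIoiPow (Module.finrank ℝ V - 1)) ∂μ.toSphere := by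
  have hm : Measurable fun q : Metric.sphere (0 : V) 1 × Set.Ioi (0 : ℝ) => F (q.2.1 • q.1.1) :=
    hF.comp (by fun_prop)
  have h1 : ∫⁻ u, F u ∂μ = ∫⁻ u : ({(0 : V)}ᶜ : Set V), F u.1 ∂(μ.comap (↑)) := by
    rw [lintegral_subtype_comap (measurableSet_singleton _).compl F, restrict_compl_singleton]
  have h2 := μ.measurePreserving_homeomorphUnitSphereProd.lintegral_comp hm
  rw [h1, ← lintegral_prod _ hm.aemeasurable, ← h2]
  congr 1; ext u
  congr 1
  have : (homeomorphUnitSphereProd V u).1.1 = ‖u.1‖⁻¹ • u.1 := by simp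
  rw [this, homeomorphUnitSphereProd_apply_snd_coe, smul_smul,
    mul_inv_cancel₀ (norm_ne_zero_iff.2 u.2), one_smul]

/-- Along some direction in which a given continuous function does not vanish, the radial profile of
an integrable function is integrable. -/
theorem exists_direction {F : V → ℝ≥0∞} (hF : Measurable F) (hfin : ∫⁻ u, F u ∂μ < ∞) {W : V → ℂ}
    (hW : Continuous W) (hW0 : W ≠ 0) :
    ∃ θ : V, ‖θ‖ = 1 ∧ ∫⁻ u, F (‖u‖ • θ) ∂μ < ∞ ∧ ∃ r : ℝ, 0 < r ∧ W (r • θ) ≠ 0 := by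
  have hm : Measurable fun q : Metric.sphere (0 : V) 1 × Set.Ioi (0 : ℝ) => F (q.2.1 • q.1.1) :=
    hF.comp (by fun_prop)
  rw [lintegral_polar hF] at hfin
  have hae := ae_lt_top (hm.lintegral_prod_right') hfin.ne
  -- Almost every ray has a finite radial integral; if `W` vanished on all of these, it would vanish
  -- almost everywhere, hence identically.
  obtain ⟨θ, hθ, r, hr⟩ : ∃ θ : Metric.sphere (0 : V) 1,
      (∫⁻ r : Set.Ioi (0 : ℝ), F (r.1 • θ.1)
        ∂(Measure.volumeIoiPow (Module.finrank ℝ V - 1)) < ∞) ∧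
      ∃ r : Set.Ioi (0 : ℝ), W (r.1 • θ.1) ≠ 0 := by
    by_contra hcon
    push Not at hcon
    apply hW0
    refine (hW.ae_eq_iff_eq μ (continuous_zero)).1 ?_
    have hz : ∫⁻ u, ‖W u‖ₑ ∂μ = 0 := by
      rw [lintegral_polar hW.enorm.measurable]
      refine lintegral_eq_zero_of_ae_eq_zero ?_
      filter_upwards [hae] with θ hθ
      simp [hcon θ hθ]
    rw [lintegral_eq_zero_iff hW.enorm.measurable] at hz
    filter_upwards [hz] with u hu
    simpa using hu
  refine ⟨θ.1, by simp, ?_, r.1, r.2, hr⟩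
  -- The radial function with the profile of `F` along `θ` has integral equal to that radial
  -- integral times the finite mass of the sphere.
  rw [lintegral_polar (F := fun u => F (‖u‖ • θ.1)) (hF.comp (by fun_prop))]
  have hn : ∀ (θ' : Metric.sphere (0 : V) 1) (r : Set.Ioi (0 : ℝ)), ‖r.1 • θ'.1‖ = r.1 := by
    intro θ' r
    rw [norm_smul, Real.norm_of_nonneg (le_of_lt r.2), mem_sphere_zero_iff_norm.1 θ'.2, mul_one]
  simp only [hn, lintegral_const]
  exact ENNReal.mul_lt_top hθ (measure_lt_top _ _)

end Polar

/-! ### Polynomials along rays. -/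

section Polynomial

variable {d : ℕ}

/-- A nonzero coefficient of order `k` bounds the order of vanishing at 0 by some `l ≤ k`, and `|r|
^ k ≤ |r| ^ l` for `|r| ≤ 1`. -/
theorem exists_le_norm_eval {q : Polynomial ℂ} {k : ℕ} (hq : q.coeff k ≠ 0) :
    ∃ c : ℝ, 0 < c ∧ ∃ ε : ℝ, 0 < ε ∧ ∀ r : ℝ, |r| < ε → c * |r| ^ k ≤ ‖q.eval (r : ℂ)‖ := by
  have hq0 : q ≠ 0 := fun h => hq (by simp [h])
  obtain ⟨q₁, hq₁, hdvd⟩ := Polynomial.exists_eq_pow_rootMultiplicity_mul_and_not_dvd q hq0 0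
  set l := q.rootMultiplicity 0
  rw [Polynomial.C_0, sub_zero] at hq₁ hdvd
  have hl : l ≤ k := by
    by_contra hlk
    apply hq
    rw [hq₁, Polynomial.coeff_X_pow_mul', if_neg hlk]
  have h0 : q₁.eval 0 ≠ 0 := by
    rwa [Ne, ← Polynomial.coeff_zero_eq_eval_zero, ← Polynomial.X_dvd_iff]
  have hpos := norm_pos_iff.2 h0
  have hc : Continuous fun r : ℝ => ‖q₁.eval (r : ℂ)‖ :=
    (q₁.continuous.comp Complex.continuous_ofReal).norm
  have hev : ∀ᶠ r : ℝ in 𝓝 0, ‖q₁.eval 0‖ / 2 < ‖q₁.eval (r : ℂ)‖ := by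
    refine (hc.continuousAt (x := 0)).eventually_const_lt ?_
    simp only [Complex.ofReal_zero]
    linarith
  obtain ⟨ε, hε, hball⟩ := Metric.eventually_nhds_iff.1 hev
  refine ⟨‖q₁.eval 0‖ / 2, by positivity, min ε 1, by positivity, fun r hr => ?_⟩
  have h1 := hball (y := r) (by simpa using hr.trans_le (min_le_left _ _))
  have h2 : |r| ^ k ≤ |r| ^ l :=
    pow_le_pow_of_le_one (abs_nonneg r) (hr.le.trans (min_le_right _ _)) hl
  have h3 : ‖q.eval (r : ℂ)‖ = |r| ^ l * ‖q₁.eval (r : ℂ)‖ := by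
    conv_lhs => rw [hq₁]
    simp
  rw [h3, mul_comm]
  gcongr

theorem polyFun_smul_of_isHomogeneous {p : MvPolynomial (Fin d) ℂ} {k : ℕ}
    (hp : p.IsHomogeneous k) (r : ℝ) (θ : Space d) :
    polyFun p (r • θ) = (r : ℂ) ^ k * polyFun p θ := by
  rw [polyFun, polyFun, MvPolynomial.eval_eq', MvPolynomial.eval_eq', Finset.mul_sum]
  refine Finset.sum_congr rfl fun m hm => ?_
  have hdeg : m.degree = k := by
    by_contra hne
    exact MvPolynomial.mem_support_iff.1 hm (hp.coeff_eq_zero hne)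
  rw [← hdeg, Finsupp.degree_eq_sum, ← Finset.prod_pow_eq_pow_sum]
  simp only [PiLp.smul_apply, smul_eq_mul, Complex.ofReal_mul, mul_pow, Finset.prod_mul_distrib]
  ring

/-- The restriction of a polynomial to a line through the origin. -/
noncomputable def rayPoly (p : MvPolynomial (Fin d) ℂ) (θ : Space d) : Polynomial ℂ :=
  MvPolynomial.aeval (fun i => Polynomial.C (θ i : ℂ) * Polynomial.X) p

theorem eval_rayPoly (p : MvPolynomial (Fin d) ℂ) (θ : Space d) (r : ℝ) :
    (rayPoly p θ).eval (r : ℂ) = polyFun p (r • θ) := by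
  unfold rayPoly polyFun
  induction p using MvPolynomial.induction_on with
  | C a => simp
  | add p q hp hq => simp [hp, hq]
  | mul_X p i hp => simp [hp]; left; ring

theorem coeff_rayPoly (p : MvPolynomial (Fin d) ℂ) (θ : Space d) (k : ℕ) :
    (rayPoly p θ).coeff k = polyFun (MvPolynomial.homogeneousComponent k p) θ := by
  induction p using MvPolynomial.induction_on' with
  | monomial m a =>
    have h1 : rayPoly (MvPolynomial.monomial m a) θ =
        Polynomial.C (polyFun (MvPolynomial.monomial m a) θ) * Polynomial.X ^ m.degree := by
      rw [rayPoly, MvPolynomial.aeval_monomial, polyFun, MvPolynomial.eval_monomial,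
        Finsupp.prod, Finsupp.prod, Finsupp.degree_apply, ← Finset.prod_pow_eq_pow_sum]
      simp only [mul_pow, Finset.prod_mul_distrib, map_mul, map_prod, map_pow]
      rw [mul_assoc]
      rfl
    rw [h1, Polynomial.coeff_C_mul, Polynomial.coeff_X_pow,
      MvPolynomial.homogeneousComponent_of_mem (n := m.degree)
        (MvPolynomial.isHomogeneous_monomial a rfl)]
    by_cases hk : k = m.degree
    · simp [hk]
    · rw [if_neg hk, if_neg (by tauto)]
      simp [polyFun]
  | add p q hp hq =>
    rw [map_add, polyFun_add, ← hp, ← hq, ← Polynomial.coeff_add]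
    simp [rayPoly]

theorem eq_zero_of_polyFun_eq_zero {p : MvPolynomial (Fin d) ℂ}
    (h : ∀ u : Space d, polyFun p u = 0) : p = 0 := by
  refine MvPolynomial.funext_set (s := fun _ => Set.range ((↑) : ℝ → ℂ))
    (fun _ => Set.infinite_range_of_injective Complex.ofReal_injective) fun x hx => ?_
  choose y hy using fun i => hx i (Set.mem_univ i)
  have := h (WithLp.toLp 2 y)
  simpa [polyFun, hy] using this

theorem norm_polyFun_monomial_le (κ : Fin d →₀ ℕ) (u : Space d) :
    ‖polyFun (MvPolynomial.monomial κ 1) u‖ ≤ ‖u‖ ^ κ.degree := by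
  rw [polyFun, MvPolynomial.eval_monomial, one_mul, Finsupp.prod, norm_prod, Finsupp.degree_apply,
    ← Finset.prod_pow_eq_pow_sum]
  refine Finset.prod_le_prod (fun _ _ => norm_nonneg _) fun i _ => ?_
  rw [norm_pow, Complex.norm_real]
  exact pow_le_pow_left₀ (norm_nonneg _) (PiLp.norm_apply_le u i) _

end Polynomial

/-! ### Isotropic spectral densities. -/

section Isotropic

open scoped FourierTransform SchwartzMap

variable {d : ℕ}

/-- On a ray where `|P|²/s` is integrable and the homogeneous component of `P` of degree `|κ|` does
not vanish, `|P|` is at least a multiple of `r ^ |κ|` near 0. Isotropy spreads the resulting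
estimate over all directions. -/
theorem exists_lintegral_norm_pow_of_isIsotropic (hd : 0 < d) {s : Space d → ℝ≥0} (hs : Measurable s)
    (hiso : IsIsotropic s) {κ : Fin d →₀ ℕ} (hκ : ¬ HasPoleOfOrder s 0 κ) :
    ∃ ε : ℝ, 0 < ε ∧ ∫⁻ u in Metric.ball (0 : Space d) ε,
      ‖u‖ₑ ^ (2 * κ.degree) * (s u : ℝ≥0∞)⁻¹ < ∞ := by
  have : Nonempty (Fin d) := ⟨⟨0, hd⟩⟩
  unfold HasPoleOfOrder at hκ
  push Not at hκ
  obtain ⟨P, ⟨ε, hε, hfin⟩, hP⟩ := hκ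
  simp only [sub_zero] at hfin
  rw [← lintegral_indicator measurableSet_ball] at hfin
  have hm : Measurable ((Metric.ball (0 : Space d) ε).indicator fun u =>
      ‖polyFun P u‖ₑ ^ 2 * (s u : ℝ≥0∞)⁻¹) :=
    (((continuous_polyFun P).measurable.enorm.pow_const 2).mul
      hs.coe_nnreal_ennreal.inv).indicator measurableSet_ball
  obtain ⟨θ, hθ, hθfin, r, hr, hW⟩ := exists_direction hm hfin
    (W := polyFun (MvPolynomial.homogeneousComponent κ.degree P)) (continuous_polyFun _) (by
      intro h
      have h0 := eq_zero_of_polyFun_eq_zero fun u => congrFun h u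
      apply hP
      have := congrArg (MvPolynomial.coeff κ) h0
      rwa [MvPolynomial.coeff_homogeneousComponent, if_pos rfl] at this)
  have hcoeff : (rayPoly P θ).coeff κ.degree ≠ 0 := by
    intro h
    rw [coeff_rayPoly] at h
    apply hW
    have h1 : polyFun (MvPolynomial.homogeneousComponent κ.degree P) (r • θ)
        = (r : ℂ) ^ κ.degree * polyFun (MvPolynomial.homogeneousComponent κ.degree P) θ := by
      exact polyFun_smul_of_isHomogeneous
        (MvPolynomial.homogeneousComponent_isHomogeneous κ.degree P) r θ
    rw [h1, h, mul_zero]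
  obtain ⟨c, hc, ε', hε', hle⟩ := exists_le_norm_eval hcoeff
  refine ⟨min ε ε', lt_min hε hε', ?_⟩
  refine setLIntegral_mul_lt_top measurableSet_ball (C := (ENNReal.ofReal c ^ 2)⁻¹)
    (g := fun u => (Metric.ball (0 : Space d) ε).indicator (fun u =>
      ‖polyFun P u‖ₑ ^ 2 * (s u : ℝ≥0∞)⁻¹) (‖u‖ • θ)) (by simpa using hc) (fun u hu => ?_)
    ((setLIntegral_le_lintegral _ _).trans_lt hθfin)
  have hu' : ‖u‖ < min ε ε' := by simpa using hu
  have hnorm : ‖‖u‖ • θ‖ = ‖u‖ := by rw [norm_smul, hθ, norm_norm, mul_one]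
  have hmem : ‖u‖ • θ ∈ Metric.ball (0 : Space d) ε := by
    rw [mem_ball_zero_iff, hnorm]; exact hu'.trans_le (min_le_left _ _)
  rw [Set.indicator_of_mem hmem, hiso _ u hnorm, ← mul_assoc]
  refine mul_le_mul_left ?_ _
  have h1 := hle ‖u‖ (by rw [abs_norm]; exact hu'.trans_le (min_le_right _ _))
  rw [eval_rayPoly, abs_norm] at h1
  have hc0 : ENNReal.ofReal c ^ 2 ≠ 0 := by simpa using hc
  rw [mul_comm 2, pow_mul, ← ENNReal.div_eq_inv_mul,
    ENNReal.le_div_iff_mul_le (Or.inl hc0) (Or.inl (by simp)), ← mul_pow]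
  refine pow_le_pow_left' ?_ 2
  rw [← ofReal_norm, ← ofReal_norm, ← ENNReal.ofReal_pow (norm_nonneg _),
    ← ENNReal.ofReal_mul (by positivity)]
  exact ENNReal.ofReal_le_ofReal (by rw [mul_comm]; exact h1)

theorem not_isLinearlyRigid_of_isIsotropic {Ω : Type*} [MeasurableSpace Ω] {P : Measure Ω}
    (hd : 0 < d) (M : RandomMeasure d P) {S' : Measure (Space d)} {s : Space d → ℝ≥0}
    (hs : IsSpectralDensity S' s)
    (hS' : ∀ f, IsTestFunction f →
      ∫⁻ u, ‖fourier f u‖ₑ ^ 2 ∂S' = ∫⁻ ω, ‖M.statistic f ω‖ₑ ^ 2 ∂P)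
    {κ : Fin d →₀ ℕ} (hκ : ¬ HasPoleOfOrder s 0 κ) {Q : MvPolynomial (Fin d) ℂ}
    (hQ : IsOrderPolynomial κ Q) (hiso : IsIsotropic s) {R : ℝ} (hR : 0 < R)
    (hnot : ¬ M.IsMaximallyLinearlyRigid (Metric.closedBall 0 R)) {η : ℝ} (hη : 0 < η) :
    ¬ M.IsLinearlyRigid (Metric.thickening η (Metric.closedBall 0 R)) (polyFun Q) := by
  have : Nonempty (Fin d) := ⟨⟨0, hd⟩⟩
  obtain ⟨κ₀, hκκ₀, hQ1, hQ2⟩ := hQ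
  -- The band grows by `δ` twice, in constructing `ψ` and in the final mollification, and `R + 2δ <
  -- R + η`.
  set δ := η / 3 with hδ
  have hδ0 : 0 < δ := by positivity
  set R' := R + δ with hR'
  have hR'0 : 0 < R' := by positivity
  obtain ⟨ψ, hψ0, hψK, hψfin⟩ := exists_schwartz_of_not_isMaximallyLinearlyRigid M hs hS'
    Metric.isClosed_closedBall.measurableSet Metric.isBounded_closedBall hnot hδ0
  rw [cthickening_closedBall hδ0.le hR.le, add_comm δ R, ← hR'] at hψK
  obtain ⟨ε, hε, hεfin⟩ := exists_lintegral_norm_pow_of_isIsotropic hd hs.1 hiso hκ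
  have hsinv : Measurable fun u => (s u : ℝ≥0∞)⁻¹ := hs.1.coe_nnreal_ennreal.inv
  set G : Space d → ℝ≥0∞ := fun u => ‖ψ u‖ₑ ^ 2 * (s u : ℝ≥0∞)⁻¹ with hG
  have hGm : Measurable G := (ψ.continuous.measurable.enorm.pow_const 2).mul hsinv
  -- The symmetrised integrand is used because `g` is bounded through the values of `f` at both
  -- `‖u‖` and `-‖u‖`.
  obtain ⟨θ, hθ, hθfin, r, hr, hψr⟩ := exists_direction (μ := (volume : Measure (Space d)))
    (F := fun u => G u + G (-u)) (hGm.add (hGm.comp measurable_neg)) (by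
      rw [lintegral_add_left hGm, (Measure.measurePreserving_neg volume).lintegral_comp hGm]
      exact ENNReal.add_lt_top.2 ⟨hψfin.lt_top, hψfin.lt_top⟩) ψ.continuous
    (fun h => hψ0 (by ext u; exact congrFun h u))
  obtain ⟨f, hf, hfψ⟩ := exists_paleyWiener_line Metric.isClosed_closedBall hψK (u := 0) hθ
    (by simp) hR'0.le (fun t ht => by
      have := abs_real_inner_le_norm θ t
      rw [hθ, one_mul] at this
      exact this.trans (by simpa using ht))
  simp only [zero_add] at hfψ
  obtain ⟨n, g, hg, hg0, hgeven, hgf⟩ := hf.exists_even_quotient hR'0.le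
    (fun h => hψr (by rw [← hfψ, h]; rfl))
  set χ : Space d → ℂ := fun u => g ‖u‖ with hχ
  have hχc : Continuous χ := hg.1.continuous.comp (by fun_prop)
  have hχi : Integrable χ := by
    obtain ⟨C, hC0, hC⟩ := hg.exists_nonneg (d + 1)
    refine ((integrable_one_add_norm (E := Space d) (μ := volume) (r := d + 1)
      (by simp)).const_mul C).mono' hχc.aestronglyMeasurable (ae_of_all _ fun u => ?_)
    have h1 := hC (‖u‖ : ℝ)
    rw [Complex.norm_real, norm_norm, Complex.ofReal_im, abs_zero, mul_zero, Real.exp_zero,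
      mul_one] at h1
    rw [Real.rpow_neg (by positivity), ← div_eq_mul_inv, le_div_iff₀ (by positivity), mul_comm]
    exact_mod_cast h1
  have hχK : ∀ t ∉ Metric.closedBall (0 : Space d) R', fourier χ t = 0 := by
    intro t ht
    have h1 := integral_radial_eq_zero hR'0.le hg hgeven (t := -t)
      (by rw [norm_neg]; simpa using ht)
    rw [← h1]
    unfold fourier
    congr 1; ext u
    rw [mul_comm, inner_neg_right, real_inner_comm]
    congr 2
    push_cast; ring
  refine not_isLinearlyRigid_of_bandLimited M hs hS' Metric.isOpen_thickening.measurableSet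
    Metric.isBounded_closedBall.thickening Metric.isClosed_closedBall (K := Metric.closedBall 0 R')
    hδ0 ?_ hQ1 hQ2 hχi hχc (by simpa [hχ] using hg0) hχK (N := 2 * κ₀.degree) ?_
  · rw [cthickening_closedBall hδ0.le hR'0.le, thickening_closedBall hη hR.le]
    exact Metric.closedBall_subset_ball (by rw [hR', hδ]; linarith)
  set B := Metric.ball (0 : Space d) (min ε 1) with hB
  have hw1 : ∀ u : Space d, (ENNReal.ofReal ((1 + ‖u‖) ^ (2 * κ₀.degree)))⁻¹ ≤ 1 := by
    intro u
    rw [ENNReal.inv_le_one, ENNReal.one_le_ofReal]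
    exact one_le_pow₀ (by linarith [norm_nonneg u])
  have hmon : ∀ u : Space d, ‖polyFun (MvPolynomial.monomial κ₀ 1) u‖ₑ ^ 2 ≤
      ‖u‖ₑ ^ (2 * κ₀.degree) := by
    intro u
    rw [mul_comm 2, pow_mul]
    refine pow_le_pow_left' ?_ 2
    rw [← ofReal_norm, ← ofReal_norm, ← ENNReal.ofReal_pow (norm_nonneg _)]
    exact ENNReal.ofReal_le_ofReal (norm_polyFun_monomial_le κ₀ u)
  rw [← lintegral_add_compl _ (measurableSet_ball : MeasurableSet B)]
  refine (ENNReal.add_lt_top.2 ⟨?_, ?_⟩).ne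
  -- Near 0, `χ` is bounded and `|κ| ≤ |κ₀|`, so `‖u‖^(2|κ|)/s` dominates.
  · obtain ⟨C, hC⟩ := (isCompact_closedBall (0 : Space d) 1).exists_bound_of_continuousOn
      hχc.continuousOn
    refine setLIntegral_mul_lt_top measurableSet_ball (C := ENNReal.ofReal C ^ 2) (by simp)
      (g := fun u => ‖u‖ₑ ^ (2 * κ.degree) * (s u : ℝ≥0∞)⁻¹) (fun u hu => ?_)
      ((lintegral_mono_set (Metric.ball_subset_ball (min_le_left _ _))).trans_lt hεfin)
    have hu' : ‖u‖ < min ε 1 := by simpa [hB] using hu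
    have hu1 : ‖u‖ ≤ 1 := (hu'.trans_le (min_le_right _ _)).le
    have hu2 : ‖u‖ₑ ≤ 1 := by
      rw [← ofReal_norm]; exact ENNReal.ofReal_le_one.2 hu1
    have hχu : ‖χ u‖ₑ ≤ ENNReal.ofReal C := by
      rw [← ofReal_norm]
      exact ENNReal.ofReal_le_ofReal (hC u (by simpa using hu1))
    rw [← mul_assoc]
    refine mul_le_mul_left ?_ _
    rw [enorm_mul, mul_pow]
    calc _ ≤ ‖u‖ₑ ^ (2 * κ₀.degree) * ENNReal.ofReal C ^ 2 * 1 :=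
          mul_le_mul' (mul_le_mul' (hmon u) (pow_le_pow_left' hχu 2)) (hw1 u)
      _ ≤ ‖u‖ₑ ^ (2 * κ.degree) * ENNReal.ofReal C ^ 2 * 1 := by
          gcongr ?_ * _ * _
          refine pow_le_pow_right_of_le_one' hu2 ?_
          have := Finsupp.degree_mono hκκ₀
          omega
      _ = _ := by ring
  -- Away from 0, the weight `(1 + ‖u‖)^(-2|κ₀|)` absorbs the monomial, and `χ` is bounded by the
  -- values of `ψ` at `± ‖u‖ θ`.
  · refine setLIntegral_mul_lt_top measurableSet_ball.compl
      (C := 2 * (ENNReal.ofReal ((min ε 1) ^ (2 * n)))⁻¹) ?_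
      (g := fun u => G (‖u‖ • θ) + G (-(‖u‖ • θ))) (fun u hu => ?_)
      ((setLIntegral_le_lintegral _ _).trans_lt hθfin)
    · refine ENNReal.mul_ne_top (by simp) ?_
      rw [Ne, ENNReal.inv_eq_top, ENNReal.ofReal_eq_zero, not_le]
      positivity
    have hu' : min ε 1 ≤ ‖u‖ := not_lt.1 fun h => hu (mem_ball_zero_iff.2 h)
    have hnorm : ‖‖u‖ • θ‖ = ‖u‖ := by rw [norm_smul, hθ, norm_norm, mul_one]
    have e1 : G (‖u‖ • θ) = ‖f (‖u‖ : ℝ)‖ₑ ^ 2 * (s u : ℝ≥0∞)⁻¹ := by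
      simp only [hG]
      rw [hfψ, hiso _ u hnorm]
    have e2 : G (-(‖u‖ • θ)) = ‖f (-(‖u‖ : ℝ))‖ₑ ^ 2 * (s u : ℝ≥0∞)⁻¹ := by
      have := hfψ (-‖u‖)
      rw [neg_smul] at this
      push_cast at this
      simp only [hG]
      rw [this, hiso _ u (by rw [norm_neg, hnorm])]
    rw [e1, e2, ← add_mul, ← mul_assoc]
    refine mul_le_mul_left ?_ _
    have hm0 : 0 < min ε 1 := by positivity
    have h1 : ‖χ u‖ ^ 2 * (min ε 1) ^ (2 * n) ≤
        2 * (‖f (‖u‖ : ℝ)‖ ^ 2 + ‖f (-(‖u‖ : ℝ))‖ ^ 2) := by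
      have h2 := hgf (‖u‖ : ℝ)
      rw [Complex.norm_real, norm_norm] at h2
      have h3 : (min ε 1) ^ n * ‖χ u‖ ≤ ‖f (‖u‖ : ℝ)‖ + ‖f (-(‖u‖ : ℝ))‖ :=
        le_trans (by gcongr) h2
      have h4 : ((min ε 1) ^ n * ‖χ u‖) ^ 2 ≤ (‖f (‖u‖ : ℝ)‖ + ‖f (-(‖u‖ : ℝ))‖) ^ 2 := by
        gcongr
      rw [mul_comm 2 n, pow_mul]
      nlinarith [sq_nonneg (‖f (‖u‖ : ℝ)‖ - ‖f (-(‖u‖ : ℝ))‖)]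
    have h2 : ‖polyFun (MvPolynomial.monomial κ₀ 1) u‖ₑ ^ 2 *
        (ENNReal.ofReal ((1 + ‖u‖) ^ (2 * κ₀.degree)))⁻¹ ≤ 1 := by
      rw [← div_eq_mul_inv]
      refine ENNReal.div_le_of_le_mul ?_
      rw [one_mul]
      refine (hmon u).trans ?_
      rw [← ofReal_norm, ← ENNReal.ofReal_pow (norm_nonneg _)]
      exact ENNReal.ofReal_le_ofReal (by gcongr; linarith)
    calc _ = (‖polyFun (MvPolynomial.monomial κ₀ 1) u‖ₑ ^ 2 *
          (ENNReal.ofReal ((1 + ‖u‖) ^ (2 * κ₀.degree)))⁻¹) * ‖χ u‖ₑ ^ 2 := by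
          rw [enorm_mul, mul_pow]; ring
      _ ≤ 1 * ‖χ u‖ₑ ^ 2 := by gcongr
      _ ≤ _ := by
        rw [one_mul, mul_comm 2, mul_assoc, ← ENNReal.div_eq_inv_mul,
          ENNReal.le_div_iff_mul_le (Or.inl (by simpa using by positivity)) (Or.inl (by simp))]
        have h3 := ENNReal.ofReal_le_ofReal h1
        rw [ENNReal.ofReal_mul (by positivity), ENNReal.ofReal_mul (by norm_num),
          ENNReal.ofReal_add (by positivity) (by positivity)] at h3
        simpa only [ENNReal.ofReal_pow (norm_nonneg _), ofReal_norm, ENNReal.ofReal_ofNat] using h3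

end Isotropic

end LinearRigidity

namespace LinearRigidity

/-! ### Lines parallel to the axes, product integrals and polynomials on slices. -/

section Slices

variable {d : ℕ}

theorem lintegral_slice {n : ℕ} (i : Fin (n + 1)) {F : Space (n + 1) → ℝ≥0∞} (hF : Measurable F) :
    ∫⁻ u, F u = ∫⁻ z : Fin n → ℝ, ∫⁻ x : ℝ,
      F (WithLp.toLp 2 (i.insertNth (0 : ℝ) z) + x • EuclideanSpace.single i (1 : ℝ)) := by
  have h1 := (PiLp.volume_preserving_toLp (Fin (n + 1))).lintegral_comp hF
  have hF' : Measurable fun x : Fin (n + 1) → ℝ => F (WithLp.toLp 2 x) :=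
    hF.comp (PiLp.volume_preserving_toLp (Fin (n + 1))).measurable
  have h2 := (volume_preserving_piFinSuccAbove (fun _ : Fin (n + 1) => ℝ) i).symm.lintegral_comp hF'
  rw [← h1, ← h2]
  have hm : Measurable fun p : ℝ × (Fin n → ℝ) =>
      F (WithLp.toLp 2 ((MeasurableEquiv.piFinSuccAbove (fun _ : Fin (n + 1) => ℝ) i).symm p)) :=
    hF'.comp (MeasurableEquiv.measurable _)
  have h3 := lintegral_prod_symm (μ := (volume : Measure ℝ)) (ν := (volume : Measure (Fin n → ℝ)))
    _ hm.aemeasurable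
  refine h3.trans ?_
  congr 1; ext z
  congr 1; ext x
  congr 1
  ext j
  rcases Fin.eq_self_or_eq_succAbove i j with rfl | ⟨k, rfl⟩
  · simp [MeasurableEquiv.piFinSuccAbove_symm_apply, Fin.insertNthEquiv]
  · simp [MeasurableEquiv.piFinSuccAbove_symm_apply, Fin.insertNthEquiv]

/-- An integrable function is integrable along some line parallel to a coordinate axis, on which a
given continuous function does not vanish. -/
theorem exists_slice (i : Fin d) {F : Space d → ℝ≥0∞} (hF : Measurable F) (hfin : ∫⁻ u, F u < ∞)
    {W : Space d → ℂ} (hW : Continuous W) (hW0 : W ≠ 0) :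
    ∃ v : Space d, v i = 0 ∧ ∫⁻ x : ℝ, F (v + x • EuclideanSpace.single i (1 : ℝ)) < ∞ ∧
      ∃ x : ℝ, W (v + x • EuclideanSpace.single i (1 : ℝ)) ≠ 0 := by
  obtain ⟨n, rfl⟩ : ∃ n, d = n + 1 := ⟨d - 1, by have := i.pos; omega⟩
  rw [lintegral_slice i hF] at hfin
  have hT : Measurable fun z : Fin n → ℝ =>
      (WithLp.toLp 2 (i.insertNth (0 : ℝ) z) : Space (n + 1)) := by
    have h1 : Measurable fun z : Fin n → ℝ =>
        (MeasurableEquiv.piFinSuccAbove (fun _ : Fin (n + 1) => ℝ) i).symm ((0 : ℝ), z) :=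
      (MeasurableEquiv.measurable _).comp (measurable_const.prodMk measurable_id)
    exact (PiLp.volume_preserving_toLp (Fin (n + 1))).measurable.comp h1
  have hm : Measurable fun p : (Fin n → ℝ) × ℝ =>
      F (WithLp.toLp 2 (i.insertNth (0 : ℝ) p.1) + p.2 • EuclideanSpace.single i (1 : ℝ)) :=
    hF.comp ((hT.comp measurable_fst).add (measurable_snd.smul_const _))
  have hae := ae_lt_top hm.lintegral_prod_right' hfin.ne
  by_contra hcon
  push Not at hcon
  apply hW0
  refine (hW.ae_eq_iff_eq volume (continuous_zero)).1 ?_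
  have hz : ∫⁻ u, ‖W u‖ₑ = 0 := by
    rw [lintegral_slice i hW.enorm.measurable]
    refine lintegral_eq_zero_of_ae_eq_zero ?_
    filter_upwards [hae] with z hz
    simp [hcon _ (by simp) hz]
  rw [lintegral_eq_zero_iff hW.enorm.measurable] at hz
  filter_upwards [hz] with u hu
  simpa using hu

theorem lintegral_fin_prod : ∀ {n : ℕ} {f : Fin n → ℝ → ℝ≥0∞} (_ : ∀ i, Measurable (f i)),
    ∫⁻ x : Fin n → ℝ, ∏ i, f i (x i) = ∏ i, ∫⁻ x, f i x
  | 0, f, _ => by simp [volume_pi]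
  | n + 1, f, hf => by
    have hm : Measurable fun x : Fin (n + 1) → ℝ => ∏ i, f i (x i) :=
      Finset.measurable_prod _ fun i _ => (hf i).comp (measurable_pi_apply i)
    have h2 := (volume_preserving_piFinSuccAbove
      (fun _ : Fin (n + 1) => ℝ) 0).symm.lintegral_comp hm
    rw [← h2, Fin.prod_univ_succ, ← lintegral_fin_prod fun i => hf (Fin.succ i)]
    have hm' : Measurable fun x : Fin n → ℝ => ∏ i : Fin n, f i.succ (x i) :=
      Finset.measurable_prod _ fun i _ => (hf _).comp (measurable_pi_apply i)
    have h3 := lintegral_prod_mul (μ := (volume : Measure ℝ))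
      (ν := (volume : Measure (Fin n → ℝ))) (hf 0).aemeasurable hm'.aemeasurable
    rw [← h3]
    refine lintegral_congr fun p => ?_
    rw [Fin.prod_univ_succ]
    simp [MeasurableEquiv.piFinSuccAbove_symm_apply, Fin.insertNthEquiv]

theorem lintegral_space_prod {f : Fin d → ℝ → ℝ≥0∞} (hf : ∀ i, Measurable (f i)) :
    ∫⁻ u : Space d, ∏ i, f i (u i) = ∏ i, ∫⁻ x, f i x := by
  rw [← lintegral_fin_prod hf]
  exact (PiLp.volume_preserving_ofLp (Fin d)).lintegral_comp
    (Finset.measurable_prod _ fun i _ => (hf i).comp (measurable_pi_apply i))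

theorem integral_space_prod (f : Fin d → ℝ → ℂ) :
    ∫ u : Space d, ∏ i, f i (u i) = ∏ i, ∫ x, f i x := by
  rw [← integral_fintype_prod_volume_eq_prod]
  exact (EuclideanSpace.volume_preserving_symm_measurableEquiv_toLp (Fin d)).integral_comp'
    (fun x : Fin d → ℝ => ∏ i, f i (x i))

theorem integrable_space_prod {f : Fin d → ℝ → ℂ} (hf : ∀ i, Integrable (f i)) :
    Integrable fun u : Space d => ∏ i, f i (u i) :=
  (PiLp.volume_preserving_ofLp (Fin d)).integrable_comp_of_integrable
    (Integrable.fintype_prod (μ := fun _ => volume) hf)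

/-- The restriction of a polynomial to a line parallel to a coordinate axis. -/
noncomputable def slicePoly (p : MvPolynomial (Fin d) ℂ) (i : Fin d) (v : Space d) :
    Polynomial ℂ :=
  MvPolynomial.aeval (fun j => if j = i then Polynomial.X else Polynomial.C (v j : ℂ)) p

/-- The coefficient of the `k`-th power of the variable `i`. -/
noncomputable def sliceCoeff (p : MvPolynomial (Fin d) ℂ) (i : Fin d) (k : ℕ) :
    MvPolynomial (Fin d) ℂ :=
  ∑ m ∈ p.support, if m i = k then MvPolynomial.monomial (m.erase i) (p.coeff m) else 0

theorem eval_slicePoly (p : MvPolynomial (Fin d) ℂ) (i : Fin d) {v : Space d} (hv : v i = 0)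
    (x : ℝ) :
    (slicePoly p i v).eval (x : ℂ) = polyFun p (v + x • EuclideanSpace.single i (1 : ℝ)) := by
  unfold slicePoly polyFun
  induction p using MvPolynomial.induction_on with
  | C a => simp
  | add p q hp hq => simp only [map_add, Polynomial.eval_add, hp, hq]
  | mul_X p j hp =>
    simp only [map_mul, Polynomial.eval_mul, hp, MvPolynomial.aeval_X, MvPolynomial.eval_X]
    congr 1
    by_cases hj : j = i
    · subst hj; simp [hv]
    · simp [hj]

theorem slicePoly_add_smul (p : MvPolynomial (Fin d) ℂ) (i : Fin d) (v : Space d) (x : ℝ) :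
    slicePoly p i (v + x • EuclideanSpace.single i (1 : ℝ)) = slicePoly p i v := by
  unfold slicePoly
  congr 2
  ext1 j
  by_cases hj : j = i
  · simp [hj]
  · simp [hj]

theorem coeff_slicePoly (p : MvPolynomial (Fin d) ℂ) (i : Fin d) (v : Space d) (k : ℕ) :
    (slicePoly p i v).coeff k = polyFun (sliceCoeff p i k) v := by
  rw [slicePoly, MvPolynomial.aeval_def, MvPolynomial.eval₂_eq', Polynomial.finsetSum_coeff,
    polyFun, sliceCoeff, map_sum]
  refine Finset.sum_congr rfl fun m _ => ?_
  have h1 : ∏ j, (if j = i then Polynomial.X else Polynomial.C (v j : ℂ)) ^ m j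
      = Polynomial.C (∏ j, (v j : ℂ) ^ (m.erase i) j) * Polynomial.X ^ m i := by
    have h2 : ∀ j, (if j = i then Polynomial.X else Polynomial.C (v j : ℂ)) ^ m j
        = Polynomial.C ((v j : ℂ) ^ (m.erase i) j) *
          (if j = i then Polynomial.X ^ m i else 1) := by
      intro j
      by_cases hj : j = i
      · subst hj; simp
      · simp [hj, Finsupp.erase_ne hj]
    rw [Finset.prod_congr rfl fun j _ => h2 j, Finset.prod_mul_distrib, Finset.prod_ite_eq',
      if_pos (Finset.mem_univ _), map_prod]
  rw [h1, Polynomial.algebraMap_eq, Polynomial.coeff_C_mul, Polynomial.coeff_C_mul,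
    Polynomial.coeff_X_pow]
  by_cases hk : k = m i
  · rw [if_pos hk, if_pos hk.symm, MvPolynomial.eval_monomial, mul_one,
      Finsupp.prod_fintype _ _ (by simp)]
  · rw [if_neg hk, if_neg (Ne.symm hk)]
    simp

/-- Exponents with the same `i`-th entry remain distinct after erasing it, so the coefficient at
`κ.erase i` cannot cancel. -/
theorem sliceCoeff_ne_zero {p : MvPolynomial (Fin d) ℂ} {κ : Fin d →₀ ℕ} (hp : p.coeff κ ≠ 0)
    (i : Fin d) : sliceCoeff p i (κ i) ≠ 0 := by
  intro h
  have h1 := congrArg (MvPolynomial.coeff (κ.erase i)) h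
  rw [sliceCoeff, MvPolynomial.coeff_sum, Finset.sum_eq_single κ] at h1
  · simp [hp] at h1
  · intro m _ hm
    split_ifs with hmi
    · rw [MvPolynomial.coeff_monomial, if_neg]
      intro he
      apply hm
      ext j
      by_cases hj : j = i
      · rw [hj, hmi]
      · have := DFunLike.congr_fun he j
        rwa [Finsupp.erase_ne hj, Finsupp.erase_ne hj] at this
    · simp
  · intro hκ
    rw [MvPolynomial.notMem_support_iff] at hκ
    exact absurd hκ hp

/-- A nonzero coefficient along some ray would bound the polynomial below by a positive quantity at
small radii inside the ball. -/
theorem eq_zero_of_polyFun_eq_zero_on_ball {p : MvPolynomial (Fin d) ℂ} {ε : ℝ} (hε : 0 < ε)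
    (h : ∀ u ∈ Metric.ball (0 : Space d) ε, polyFun p u = 0) : p = 0 := by
  refine eq_zero_of_polyFun_eq_zero fun θ => ?_
  have h0 : rayPoly p θ = 0 := by
    ext k
    rw [Polynomial.coeff_zero]
    by_contra hk
    obtain ⟨c, hc, ε', hε', hle⟩ := exists_le_norm_eval hk
    set r : ℝ := min (ε' / 2) (ε / (2 * (‖θ‖ + 1))) with hr
    have hr0 : 0 < r := by positivity
    have h1 := hle r (by
      rw [abs_of_pos hr0]
      exact (min_le_left _ _).trans_lt (by linarith))
    rw [eval_rayPoly, h] at h1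
    · rw [norm_zero, abs_of_pos hr0] at h1
      have : 0 < c * r ^ k := by positivity
      linarith
    · rw [mem_ball_zero_iff, norm_smul, Real.norm_of_nonneg hr0.le]
      have h2 : r ≤ ε / (2 * (‖θ‖ + 1)) := min_le_right _ _
      rw [le_div_iff₀ (by positivity)] at h2
      nlinarith [norm_nonneg θ]
  have := eval_rayPoly p θ 1
  rw [h0, one_smul] at this
  simpa using this.symm

end Slices

/-! ### Separable spectral densities: reduction to one coordinate. -/

section Separable

open scoped FourierTransform SchwartzMap

variable {d : ℕ} {s : Space d → ℝ≥0} {s' : Fin d → ℝ → ℝ≥0}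

theorem separable_slice (hprod : ∀ u, s u = ∏ i, s' i (u i)) (i : Fin d) {v : Space d}
    (hv : v i = 0) (x : ℝ) :
    s (v + x • EuclideanSpace.single i (1 : ℝ)) =
      s' i x * ∏ j ∈ Finset.univ.erase i, s' j (v j) := by
  rw [hprod, ← Finset.mul_prod_erase _ _ (Finset.mem_univ i)]
  congr 1
  · simp [hv]
  · refine Finset.prod_congr rfl fun j hj => ?_
    have := Finset.ne_of_mem_erase hj
    simp [this]

/-- The factors are not assumed measurable; through a point with `s ≠ 0`, the slice of `s` is a
nonzero multiple of `s' i`. -/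
theorem measurable_of_separable (hs : Measurable s) (hprod : ∀ u, s u = ∏ i, s' i (u i))
    {v : Space d} (hv : s v ≠ 0) (i : Fin d) : Measurable (s' i) := by
  set v' : Space d := v + (-(v i)) • EuclideanSpace.single i (1 : ℝ) with hv'
  have hvi : v' i = 0 := by simp [hv']
  set c := ∏ j ∈ Finset.univ.erase i, s' j (v' j) with hc
  have hslice := separable_slice hprod i hvi
  have hc0 : c ≠ 0 := by
    intro h0
    apply hv
    have h1 := hslice (v i)
    rw [← hc, h0, mul_zero, hv', add_assoc, ← add_smul] at h1
    simpa using h1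
  have h2 : s' i = fun x => s (v' + x • EuclideanSpace.single i (1 : ℝ)) * c⁻¹ := by
    ext1 x
    rw [hslice, mul_assoc, mul_inv_cancel₀ hc0, mul_one]
  rw [h2]
  exact (hs.comp (by fun_prop)).mul_const _

/-- The constant is `c + 1` rather than `c` because for `c = 0` the product `c * ∞` would be 0. -/
theorem inv_le_add_one_mul_inv (a c : ℝ≥0) :
    (a : ℝ≥0∞)⁻¹ ≤ ((c : ℝ≥0∞) + 1) * (((a * c : ℝ≥0)) : ℝ≥0∞)⁻¹ := by
  have h1 : (1 : ℝ≥0∞) ≤ ((c : ℝ≥0∞) + 1) * (c : ℝ≥0∞)⁻¹ := by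
    by_cases hc : c = 0
    · simp [hc]
    · rw [← ENNReal.mul_inv_cancel (a := (c : ℝ≥0∞)) (by simpa using hc) (by simp)]
      gcongr
      exact le_self_add
  rw [ENNReal.coe_mul, ENNReal.mul_inv (Or.inr (by simp)) (Or.inl (by simp))]
  calc (a : ℝ≥0∞)⁻¹ = 1 * (a : ℝ≥0∞)⁻¹ := (one_mul _).symm
    _ ≤ (((c : ℝ≥0∞) + 1) * (c : ℝ≥0∞)⁻¹) * (a : ℝ≥0∞)⁻¹ := by gcongr
    _ = _ := by ring

theorem exists_lintegral_pow_of_separable (hs : Measurable s)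
    (hprod : ∀ u, s u = ∏ i, s' i (u i)) {κ : Fin d →₀ ℕ} (hκ : ¬ HasPoleOfOrder s 0 κ)
    (i : Fin d) :
    ∃ ε : ℝ, 0 < ε ∧ ∫⁻ x in Metric.ball (0 : ℝ) ε,
      ‖x‖ₑ ^ (2 * κ i) * (s' i x : ℝ≥0∞)⁻¹ < ∞ := by
  unfold HasPoleOfOrder at hκ
  push Not at hκ
  obtain ⟨P, ⟨ε, hε, hfin⟩, hP⟩ := hκ
  simp only [sub_zero] at hfin
  rw [← lintegral_indicator measurableSet_ball] at hfin
  have hm : Measurable ((Metric.ball (0 : Space d) ε).indicator fun u =>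
      ‖polyFun P u‖ₑ ^ 2 * (s u : ℝ≥0∞)⁻¹) :=
    (((continuous_polyFun P).measurable.enorm.pow_const 2).mul
      hs.coe_nnreal_ennreal.inv).indicator measurableSet_ball
  -- The cutoff in `W` forces the selected point into the ball, so the line meets the ball around
  -- its foot `v`. The other factor is the coefficient of order `κ i` on the slice, which does not
  -- depend on the `i`-th coordinate.
  obtain ⟨v, hv, hvfin, x₀, hx₀⟩ := exists_slice i hm hfin
    (W := fun u => ((max 0 (ε - ‖u‖) : ℝ) : ℂ) * polyFun (sliceCoeff P i (κ i)) u)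
    ((Complex.continuous_ofReal.comp (by fun_prop)).mul (continuous_polyFun _)) (by
      intro h
      refine sliceCoeff_ne_zero hP i (eq_zero_of_polyFun_eq_zero_on_ball hε fun u hu => ?_)
      have h1 := congrFun h u
      rw [mem_ball_zero_iff] at hu
      rcases mul_eq_zero.1 h1 with h2 | h2
      · have h3 : max 0 (ε - ‖u‖) = 0 := by exact_mod_cast h2
        have h4 := le_max_right 0 (ε - ‖u‖)
        linarith
      · exact h2)
  set e : Space d := EuclideanSpace.single i (1 : ℝ) with he
  have he1 : ‖e‖ = 1 := by simp [he]
  have hve : inner ℝ v e = 0 := by simp [he, EuclideanSpace.inner_single_right, hv]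
  have hvε : ‖v‖ < ε := by
    have h1 : max 0 (ε - ‖v + x₀ • e‖) ≠ 0 := by
      intro h0
      apply hx₀
      rw [h0]; simp
    have h2 : ‖v + x₀ • e‖ < ε := by
      by_contra hcon
      exact h1 (max_eq_left (by linarith))
    have h3 : ‖v + x₀ • e‖ ^ 2 = ‖v‖ ^ 2 + x₀ ^ 2 := by
      rw [norm_add_sq_real, inner_smul_right, hve, norm_smul, he1]
      simp
    refine lt_of_le_of_lt ?_ h2
    refine (sq_le_sq₀ (norm_nonneg _) (norm_nonneg _)).1 ?_
    rw [h3]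
    linarith [sq_nonneg x₀]
  have hcoeff : (slicePoly P i v).coeff (κ i) ≠ 0 := by
    rw [← slicePoly_add_smul P i v x₀, coeff_slicePoly]
    exact right_ne_zero_of_mul hx₀
  obtain ⟨c, hc, ε', hε', hle⟩ := exists_le_norm_eval hcoeff
  set b := ∏ j ∈ Finset.univ.erase i, s' j (v j) with hb
  have hεv : 0 < ε - ‖v‖ := by linarith
  refine ⟨min (ε - ‖v‖) ε', lt_min hεv hε', ?_⟩
  refine setLIntegral_mul_lt_top measurableSet_ball
    (C := (ENNReal.ofReal c ^ 2)⁻¹ * ((b : ℝ≥0∞) + 1))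
    (g := fun x => (Metric.ball (0 : Space d) ε).indicator (fun u =>
      ‖polyFun P u‖ₑ ^ 2 * (s u : ℝ≥0∞)⁻¹) (v + x • e))
    (ENNReal.mul_ne_top (by simpa using hc) (by simp)) (fun x hx => ?_)
    ((setLIntegral_le_lintegral _ _).trans_lt hvfin)
  have hx' : |x| < min (ε - ‖v‖) ε' := by simpa using hx
  have hmem : v + x • e ∈ Metric.ball (0 : Space d) ε := by
    rw [mem_ball_zero_iff]
    refine (norm_add_le _ _).trans_lt ?_
    rw [norm_smul, he1, mul_one, Real.norm_eq_abs]
    linarith [hx'.trans_le (min_le_left _ _)]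
  rw [Set.indicator_of_mem hmem]
  have h1 := hle x (hx'.trans_le (min_le_right _ _))
  rw [eval_slicePoly P i hv] at h1
  have hc0 : ENNReal.ofReal c ^ 2 ≠ 0 := by simpa using hc
  have h2 : ‖x‖ₑ ^ (2 * κ i) ≤ (ENNReal.ofReal c ^ 2)⁻¹ * ‖polyFun P (v + x • e)‖ₑ ^ 2 := by
    rw [mul_comm 2, pow_mul, ← ENNReal.div_eq_inv_mul,
      ENNReal.le_div_iff_mul_le (Or.inl hc0) (Or.inl (by simp)), ← mul_pow]
    refine pow_le_pow_left' ?_ 2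
    rw [← ofReal_norm, ← ofReal_norm, ← ENNReal.ofReal_pow (norm_nonneg _),
      ← ENNReal.ofReal_mul (by positivity)]
    exact ENNReal.ofReal_le_ofReal (by rw [mul_comm]; exact h1)
  rw [separable_slice hprod i hv, ← hb]
  refine (mul_le_mul' h2 (inv_le_add_one_mul_inv (s' i x) b)).trans_eq ?_
  ring

/-- If `s` were identically 0, the weight would be `∞` everywhere and finiteness would force `ψ =
0`. -/
theorem exists_ne_zero_of_lintegral (hs : Measurable s) {ψ : 𝓢(Space d, ℂ)} (hψ0 : ψ ≠ 0)
    (hfin : ∫⁻ u, ‖ψ u‖ₑ ^ 2 * (s u : ℝ≥0∞)⁻¹ ≠ ∞) : ∃ u, s u ≠ 0 := by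
  have hGm : Measurable fun u => ‖ψ u‖ₑ ^ 2 * (s u : ℝ≥0∞)⁻¹ :=
    (ψ.continuous.measurable.enorm.pow_const 2).mul hs.coe_nnreal_ennreal.inv
  by_contra hcon
  push Not at hcon
  apply hψ0
  have hz : (ψ : Space d → ℂ) = 0 := by
    refine (ψ.continuous.ae_eq_iff_eq volume continuous_zero).1 ?_
    filter_upwards [ae_lt_top hGm hfin] with u hu
    by_contra hne
    rw [hcon u] at hu
    have : ‖ψ u‖ₑ ^ 2 ≠ 0 := by simpa using hne
    simp [ENNReal.mul_top this] at hu
  ext u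
  exact congrFun hz u

/-- The one dimensional profile of a band-limited function, with its zero at the origin removed. -/
theorem exists_profile_of_separable (hs : Measurable s)
    (heven : ∀ i x, s' i (-x) = s' i x) (hprod : ∀ u, s u = ∏ i, s' i (u i))
    {ψ : 𝓢(Space d, ℂ)} (hψ0 : ψ ≠ 0) {K : Set (Space d)} (hK : IsClosed K)
    (hψ : ∀ t ∉ K, schwartzFourier ψ t = 0)
    (hfin : ∫⁻ u, ‖ψ u‖ₑ ^ 2 * (s u : ℝ≥0∞)⁻¹ ≠ ∞) {R : ℝ} (hR : 0 ≤ R) (i : Fin d)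
    (hKR : ∀ t ∈ K, |t i| ≤ R) :
    ∃ g : ℂ → ℂ, PaleyWiener R g ∧ g 0 ≠ 0 ∧ (∀ z, g (-z) = g z) ∧
      ∀ ε : ℝ, 0 < ε → ∫⁻ x in (Metric.ball (0 : ℝ) ε)ᶜ,
        ‖g x‖ₑ ^ 2 * (s' i x : ℝ≥0∞)⁻¹ < ∞ := by
  have hGm : Measurable fun u => ‖ψ u‖ₑ ^ 2 * (s u : ℝ≥0∞)⁻¹ :=
    (ψ.continuous.measurable.enorm.pow_const 2).mul hs.coe_nnreal_ennreal.inv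
  obtain ⟨v, hv, hvfin, x₀, hx₀⟩ := exists_slice i hGm hfin.lt_top ψ.continuous
    (fun h => hψ0 (by ext u; exact congrFun h u))
  set e : Space d := EuclideanSpace.single i (1 : ℝ) with he
  have he1 : ‖e‖ = 1 := by simp [he]
  obtain ⟨f, hf, hfψ⟩ := exists_paleyWiener_line hK hψ (u := v) he1
    (by simp [he, EuclideanSpace.inner_single_right, hv]) hR (fun t ht => by
      have := hKR t ht
      simpa [he, EuclideanSpace.inner_single_left] using this)
  obtain ⟨n, g, hg, hg0, hgeven, hgf⟩ := hf.exists_even_quotient hR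
    (fun h => hx₀ (by rw [← hfψ, h]; rfl))
  refine ⟨g, hg, hg0, hgeven, fun ε hε => ?_⟩
  obtain ⟨u, hu⟩ := exists_ne_zero_of_lintegral hs hψ0 hfin
  have hsm := measurable_of_separable hs hprod hu i
  set G : ℝ → ℝ≥0∞ := fun x => ‖f x‖ₑ ^ 2 * (s' i x : ℝ≥0∞)⁻¹ with hG
  have hGm' : Measurable G :=
    (((hf.1.continuous.comp Complex.continuous_ofReal).measurable.enorm).pow_const 2).mul
      hsm.coe_nnreal_ennreal.inv
  set b := ∏ j ∈ Finset.univ.erase i, s' j (v j) with hb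
  have hGfin : ∫⁻ x, G x < ∞ := by
    rw [← setLIntegral_univ]
    refine setLIntegral_mul_lt_top MeasurableSet.univ (C := (b : ℝ≥0∞) + 1) (by simp)
      (g := fun x => ‖ψ (v + x • e)‖ₑ ^ 2 * (s (v + x • e) : ℝ≥0∞)⁻¹) (fun x _ => ?_)
      (by rw [setLIntegral_univ]; exact hvfin)
    simp only [hG]
    rw [separable_slice hprod i hv, ← hb, hfψ, mul_left_comm]
    gcongr
    exact inv_le_add_one_mul_inv _ _
  have hGfin2 : ∫⁻ x, (G x + G (-x)) < ∞ := by
    rw [lintegral_add_left hGm', (Measure.measurePreserving_neg volume).lintegral_comp hGm']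
    exact ENNReal.add_lt_top.2 ⟨hGfin, hGfin⟩
  refine setLIntegral_mul_lt_top measurableSet_ball.compl
    (C := 2 * (ENNReal.ofReal (ε ^ (2 * n)))⁻¹) ?_ (g := fun x => G x + G (-x)) (fun x hx => ?_)
    ((setLIntegral_le_lintegral _ _).trans_lt hGfin2)
  · refine ENNReal.mul_ne_top (by simp) ?_
    rw [Ne, ENNReal.inv_eq_top, ENNReal.ofReal_eq_zero, not_le]
    positivity
  have hx' : ε ≤ ‖(x : ℂ)‖ := by
    rw [Complex.norm_real]
    exact not_lt.1 fun h => hx (mem_ball_zero_iff.2 h)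
  simp only [hG, heven]
  rw [← add_mul, ← mul_assoc]
  refine mul_le_mul_left ?_ _
  have h1 : ‖g x‖ ^ 2 * ε ^ (2 * n) ≤ 2 * (‖f x‖ ^ 2 + ‖f ((-x : ℝ) : ℂ)‖ ^ 2) := by
    have h2 := hgf x
    rw [← Complex.ofReal_neg] at h2
    have h3 : ε ^ n * ‖g x‖ ≤ ‖f x‖ + ‖f ((-x : ℝ) : ℂ)‖ := le_trans (by gcongr) h2
    have h4 : (ε ^ n * ‖g x‖) ^ 2 ≤ (‖f x‖ + ‖f ((-x : ℝ) : ℂ)‖) ^ 2 := by gcongr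
    rw [mul_comm 2 n, pow_mul]
    nlinarith [sq_nonneg (‖f x‖ - ‖f ((-x : ℝ) : ℂ)‖)]
  rw [mul_comm 2, mul_assoc, ← ENNReal.div_eq_inv_mul,
    ENNReal.le_div_iff_mul_le (Or.inl (by simpa using by positivity)) (Or.inl (by simp))]
  have h3 := ENNReal.ofReal_le_ofReal h1
  rw [ENNReal.ofReal_mul (by positivity), ENNReal.ofReal_mul (by norm_num),
    ENNReal.ofReal_add (by positivity) (by positivity)] at h3
  simpa only [ENNReal.ofReal_pow (norm_nonneg _), ofReal_norm, ENNReal.ofReal_ofNat] using h3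

end Separable

end LinearRigidity

namespace LinearRigidity

/-! ### Separable spectral densities: product functions on the cube. -/

section Cube

open scoped FourierTransform SchwartzMap

variable {d : ℕ}

theorem isClosed_cube (R : ℝ) : IsClosed (cube d R) := by
  have : cube d R = ⋂ i, (fun t : Space d => t i) ⁻¹' Set.Icc (-R) R := by
    ext t; simp [cube]
  rw [this]
  exact isClosed_iInter fun i => isClosed_Icc.preimage (by fun_prop)

theorem norm_le_of_abs_le {t : Space d} {R : ℝ} (h : ∀ i, |t i| ≤ R) : ‖t‖ ≤ d * R := by
  have h1 : t = ∑ i, t i • EuclideanSpace.single i (1 : ℝ) := by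
    ext j
    simp [Pi.single_apply]
  rw [h1]
  refine (norm_sum_le _ _).trans ((Finset.sum_le_card_nsmul _ _ R fun i _ => ?_).trans_eq ?_)
  · rw [norm_smul]
    simpa using h i
  · simp

theorem isBounded_cube (R : ℝ) : Bornology.IsBounded (cube d R) :=
  (Metric.isBounded_closedBall (x := 0) (r := d * R)).subset fun t ht => by
    simpa using norm_le_of_abs_le fun i => abs_le.2 (ht i)

theorem cthickening_cube_subset {R δ : ℝ} (hδ : 0 ≤ δ) :
    Metric.cthickening δ (cube d R) ⊆ cube d (R + δ) := by
  rw [(Metric.isCompact_of_isClosed_isBounded (isClosed_cube R)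
    (isBounded_cube R)).cthickening_eq_biUnion_closedBall hδ]
  refine Set.iUnion₂_subset fun v hv t ht i => ?_
  have h1 : |t i - v i| ≤ δ := by
    have h2 := PiLp.norm_apply_le (t - v) i
    rw [mem_closedBall_iff_norm] at ht
    exact h2.trans ht
  have h2 := abs_le.1 h1
  have h3 := hv i
  rw [Set.mem_Icc] at h3 ⊢
  constructor <;> linarith

/-- Scaling by `R / (R + δ)` maps into the smaller cube and moves each coordinate by at most `δ`;
the factor `d` comes from a crude bound of the norm by the coordinates. -/
theorem cube_subset_cthickening {R δ : ℝ} (hR : 0 ≤ R) (hδ : 0 < δ) :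
    cube d (R + δ) ⊆ Metric.cthickening (d * δ) (cube d R) := by
  intro t ht
  have hpos : 0 < R + δ := by positivity
  refine Metric.mem_cthickening_of_dist_le t ((R / (R + δ)) • t) _ _ (fun i => ?_) ?_
  · have h1 := abs_le.2 (ht i)
    have h2 : |((R / (R + δ)) • t) i| ≤ R := by
      rw [PiLp.smul_apply, smul_eq_mul, abs_mul, abs_of_nonneg (by positivity)]
      calc R / (R + δ) * |t i| ≤ R / (R + δ) * (R + δ) := by gcongr
        _ = R := by field_simp
    exact abs_le.1 h2
  · rw [dist_eq_norm]
    refine norm_le_of_abs_le fun i => ?_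
    have h1 := abs_le.2 (ht i)
    have h2 : (t - (R / (R + δ)) • t) i = δ / (R + δ) * t i := by
      simp only [PiLp.sub_apply, PiLp.smul_apply, smul_eq_mul]
      field_simp
      ring
    rw [h2, abs_mul, abs_of_nonneg (by positivity)]
    calc δ / (R + δ) * |t i| ≤ δ / (R + δ) * (R + δ) := by gcongr
      _ = δ := by field_simp

theorem enorm_finset_prod {ι : Type*} (A : Finset ι) (f : ι → ℂ) :
    ‖∏ i ∈ A, f i‖ₑ = ∏ i ∈ A, ‖f i‖ₑ := by
  classical
  induction A using Finset.induction_on with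
  | empty => simp
  | insert a A ha ih => rw [Finset.prod_insert ha, Finset.prod_insert ha, enorm_mul, ih]

theorem PaleyWiener.integrable_ofReal {R : ℝ} {g : ℂ → ℂ} (hg : PaleyWiener R g) :
    Integrable fun x : ℝ => g x := by
  obtain ⟨C, hC0, hC⟩ := hg.exists_nonneg 2
  refine ((integrable_one_add_norm (E := ℝ) (μ := volume) (r := 2) (by simp)).const_mul C).mono'
    (hg.1.continuous.comp Complex.continuous_ofReal).aestronglyMeasurable
    (ae_of_all _ fun x => ?_)
  have h1 := hC x
  rw [Complex.norm_real, Complex.ofReal_im, abs_zero, mul_zero, Real.exp_zero, mul_one] at h1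
  rw [Real.rpow_neg (by positivity), ← div_eq_mul_inv, le_div_iff₀ (by positivity), mul_comm]
  exact_mod_cast h1

/-- The Fourier transform of an even profile vanishes outside of `[-R, R]`. -/
theorem integral_exp_mul_eq_zero {R : ℝ} (hR : 0 ≤ R) {g : ℂ → ℂ} (hg : PaleyWiener R g)
    (heven : ∀ z, g (-z) = g z) {t : ℝ} (ht : R < |t|) :
    ∫ x : ℝ, Complex.exp (-Complex.I * ((t * x : ℝ) : ℂ)) * g x = 0 := by
  have h1 := integral_radial_eq_zero (V := ℝ) hR hg heven (t := -t) (by simpa using ht)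
  rw [← h1]
  congr 1; ext x
  have h2 : g (‖x‖ : ℝ) = g x := by
    rcases abs_choice x with h | h
    · rw [Real.norm_eq_abs, h]
    · rw [Real.norm_eq_abs, h, Complex.ofReal_neg, heven]
  rw [h2, mul_comm]
  congr 2
  simp

/-- Here `w` stands for the inverse of one factor of the density. Near 0 the power `x^(2k)` makes
`w` integrable; away from 0 the decaying weight absorbs `x^(2k₀)`, and `g` controls the rest. -/
theorem lintegral_profile_lt_top {w : ℝ → ℝ≥0∞} {g : ℂ → ℂ} (hg : Continuous g) {k k₀ : ℕ}
    (hk : k ≤ k₀) {ε : ℝ} (hε : 0 < ε)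
    (h1 : ∫⁻ x in Metric.ball (0 : ℝ) ε, ‖x‖ₑ ^ (2 * k) * w x < ∞)
    (h2 : ∀ ε : ℝ, 0 < ε → ∫⁻ x in (Metric.ball (0 : ℝ) ε)ᶜ, ‖g x‖ₑ ^ 2 * w x < ∞) :
    ∫⁻ x : ℝ, ‖x‖ₑ ^ (2 * k₀) * ‖g x‖ₑ ^ 2 * (ENNReal.ofReal ((1 + |x|) ^ (2 * k₀)))⁻¹ * w x
      < ∞ := by
  rw [← lintegral_add_compl _ (measurableSet_ball : MeasurableSet (Metric.ball (0 : ℝ) (min ε 1)))]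
  refine ENNReal.add_lt_top.2 ⟨?_, ?_⟩
  · obtain ⟨C, hC⟩ := (isCompact_closedBall (0 : ℝ) 1).exists_bound_of_continuousOn
      (hg.comp Complex.continuous_ofReal).continuousOn
    refine setLIntegral_mul_lt_top measurableSet_ball (C := ENNReal.ofReal C ^ 2) (by simp)
      (g := fun x => ‖x‖ₑ ^ (2 * k) * w x) (fun x hx => ?_)
      ((lintegral_mono_set (Metric.ball_subset_ball (min_le_left _ _))).trans_lt h1)
    have hx' : ‖x‖ < min ε 1 := mem_ball_zero_iff.1 hx
    have hx1 : ‖x‖ ≤ 1 := (hx'.trans_le (min_le_right _ _)).le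
    have hx2 : ‖x‖ₑ ≤ 1 := by
      rw [← ofReal_norm]; exact ENNReal.ofReal_le_one.2 hx1
    have hgx : ‖g x‖ₑ ≤ ENNReal.ofReal C := by
      rw [← ofReal_norm]
      exact ENNReal.ofReal_le_ofReal (hC x (by simpa using hx1))
    have hw1 : (ENNReal.ofReal ((1 + |x|) ^ (2 * k₀)))⁻¹ ≤ 1 := by
      rw [ENNReal.inv_le_one, ENNReal.one_le_ofReal]
      exact one_le_pow₀ (by linarith [abs_nonneg x])
    rw [← mul_assoc]
    refine mul_le_mul_left ?_ _
    refine (mul_le_mul' (mul_le_mul' (pow_le_pow_right_of_le_one' hx2 (by omega : 2 * k ≤ 2 * k₀))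
      (pow_le_pow_left' hgx 2)) hw1).trans_eq ?_
    ring
  · refine setLIntegral_mul_lt_top measurableSet_ball.compl (C := 1) (by simp)
      (g := fun x => ‖g x‖ₑ ^ 2 * w x) (fun x _ => ?_) (h2 _ (by positivity))
    have h3 : ‖x‖ₑ ^ (2 * k₀) * (ENNReal.ofReal ((1 + |x|) ^ (2 * k₀)))⁻¹ ≤ 1 := by
      rw [← div_eq_mul_inv]
      refine ENNReal.div_le_of_le_mul ?_
      rw [one_mul, ← ofReal_norm, ← ENNReal.ofReal_pow (norm_nonneg _), Real.norm_eq_abs]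
      exact ENNReal.ofReal_le_ofReal (by gcongr; linarith)
    calc _ = (‖x‖ₑ ^ (2 * k₀) * (ENNReal.ofReal ((1 + |x|) ^ (2 * k₀)))⁻¹) *
          (‖g x‖ₑ ^ 2 * w x) := by ring
      _ ≤ 1 * (‖g x‖ₑ ^ 2 * w x) := by gcongr

theorem not_isLinearlyRigid_of_isSeparable {Ω : Type*} [MeasurableSpace Ω] {P : Measure Ω}
    (M : RandomMeasure d P) {S' : Measure (Space d)} {s : Space d → ℝ≥0}
    (hs : IsSpectralDensity S' s)
    (hS' : ∀ f, IsTestFunction f →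
      ∫⁻ u, ‖fourier f u‖ₑ ^ 2 ∂S' = ∫⁻ ω, ‖M.statistic f ω‖ₑ ^ 2 ∂P)
    {κ : Fin d →₀ ℕ} (hκ : ¬ HasPoleOfOrder s 0 κ) {Q : MvPolynomial (Fin d) ℂ}
    (hQ : IsOrderPolynomial κ Q) (hsep : IsSeparable s) {R : ℝ} (hR : 0 < R)
    (hnot : ¬ M.IsMaximallyLinearlyRigid (cube d R)) {η : ℝ} (hη : 0 < η) :
    ¬ M.IsLinearlyRigid (Metric.thickening η (cube d R)) (polyFun Q) := by
  obtain ⟨κ₀, hκκ₀, hQ1, hQ2⟩ := hQ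
  obtain ⟨s', heven, hprod⟩ := hsep
  -- Enlarging the cube by `δ` costs a thickening by `d δ` and the mollification another `δ`;
  -- together `(d + 1) δ = η / 2 < η`.
  set δ := η / (2 * (d + 1)) with hδ
  have hδ0 : 0 < δ := by positivity
  set R' := R + δ with hR'
  have hR'0 : 0 < R' := by positivity
  obtain ⟨ψ, hψ0, hψK, hψfin⟩ := exists_schwartz_of_not_isMaximallyLinearlyRigid M hs hS'
    (isClosed_cube R).measurableSet (isBounded_cube R) hnot hδ0
  replace hψK : ∀ t ∉ cube d R', schwartzFourier ψ t = 0 := fun t ht =>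
    hψK t fun h => ht (cthickening_cube_subset hδ0.le h)
  obtain ⟨u₀, hu₀⟩ := exists_ne_zero_of_lintegral hs.1 hψ0 hψfin
  have hs'm := measurable_of_separable hs.1 hprod hu₀
  choose g hg hg0 hgeven hgfin using fun i => exists_profile_of_separable hs.1 heven hprod hψ0
    (isClosed_cube R') hψK hψfin hR'0.le i (fun t ht => abs_le.2 (ht i))
  have hgc : ∀ i, Continuous fun x : ℝ => g i x := fun i =>
    (hg i).1.continuous.comp Complex.continuous_ofReal
  set χ : Space d → ℂ := fun u => ∏ i, g i (u i) with hχ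
  have hχc : Continuous χ := continuous_finsetProd _ fun i _ =>
    (hgc i).comp (by fun_prop)
  have hχi : Integrable χ :=
    integrable_space_prod (f := fun i x => g i x) fun i => (hg i).integrable_ofReal
  -- The transform factorises over the coordinates, and one coordinate of `t` outside `[-R', R']`
  -- already makes its factor vanish.
  have hχK : ∀ t ∉ cube d R', fourier χ t = 0 := by
    intro t ht
    simp only [cube, Set.mem_ofPred_eq, not_forall, Set.mem_Icc, ← abs_le, not_le] at ht
    obtain ⟨i, hi⟩ := ht
    set E : Fin d → ℝ → ℂ := fun j x =>
      Complex.exp (-Complex.I * ((t j * x : ℝ) : ℂ)) * g j x with hE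
    have h1 : fourier χ t = ∫ u : Space d, ∏ j, E j (u j) := by
      unfold fourier
      congr 1; ext u
      simp only [hE]
      rw [Finset.prod_mul_distrib, ← Complex.exp_sum, ← Finset.mul_sum, ← Complex.ofReal_sum]
      congr 4
      rw [PiLp.inner_apply]
      exact Finset.sum_congr rfl fun j _ => by simp [mul_comm]
    rw [h1, integral_space_prod E]
    exact Finset.prod_eq_zero (Finset.mem_univ i)
      (integral_exp_mul_eq_zero hR'0.le (hg i) (hgeven i) hi)
  refine not_isLinearlyRigid_of_bandLimited M hs hS' Metric.isOpen_thickening.measurableSet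
    (isBounded_cube R).thickening (isClosed_cube R') hδ0 ?_ hQ1 hQ2 hχi hχc
    (by simpa [hχ, Finset.prod_ne_zero_iff] using hg0) hχK (N := 2 * κ₀.degree) ?_
  · refine (Metric.cthickening_subset_of_subset δ (cube_subset_cthickening hR.le hδ0)).trans
      ((Metric.cthickening_cthickening_subset hδ0.le (by positivity) _).trans
      (Metric.cthickening_subset_thickening' hη ?_ _))
    have : δ * (2 * (d + 1)) = η := by rw [hδ]; field_simp
    nlinarith
  set H : Fin d → ℝ → ℝ≥0∞ := fun i x => ‖x‖ₑ ^ (2 * κ₀ i) * ‖g i x‖ₑ ^ 2 *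
    (ENNReal.ofReal ((1 + |x|) ^ (2 * κ₀ i)))⁻¹ * (s' i x : ℝ≥0∞)⁻¹ with hH
  have hHm : ∀ i, Measurable (H i) := by
    intro i
    refine Measurable.mul (Measurable.mul (Measurable.mul (by fun_prop)
      ((hgc i).measurable.enorm.pow_const 2)) ?_) (hs'm i).coe_nnreal_ennreal.inv
    fun_prop
  have hHfin : ∀ i, ∫⁻ x, H i x < ∞ := by
    intro i
    obtain ⟨ε, hε, hεfin⟩ := exists_lintegral_pow_of_separable hs.1 hprod hκ i
    exact lintegral_profile_lt_top (hg i).1.continuous (hκκ₀ i) hε hεfin (hgfin i)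
  refine ((lintegral_mono fun u => ?_).trans_lt ((lintegral_space_prod hHm).trans_lt
    (ENNReal.prod_lt_top fun i _ => hHfin i))).ne
  have e1 : ‖polyFun (MvPolynomial.monomial κ₀ 1) u‖ₑ ^ 2 = ∏ i, ‖u i‖ₑ ^ (2 * κ₀ i) := by
    rw [polyFun, MvPolynomial.eval_monomial, one_mul, Finsupp.prod_fintype _ _ (by simp),
      enorm_finset_prod, ← Finset.prod_pow]
    refine Finset.prod_congr rfl fun i _ => ?_
    rw [enorm_pow, ← pow_mul, mul_comm (κ₀ i)]
    congr 1
    rw [← ofReal_norm, Complex.norm_real, ofReal_norm]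
  have e2 : ‖χ u‖ₑ ^ 2 = ∏ i, ‖g i (u i)‖ₑ ^ 2 := by
    rw [hχ, enorm_finset_prod, Finset.prod_pow]
  -- The radial weight is dominated by a product of one dimensional weights, so that the whole
  -- integral splits into one factor per coordinate.
  have e3 : (ENNReal.ofReal ((1 + ‖u‖) ^ (2 * κ₀.degree)))⁻¹ ≤
      ∏ i, (ENNReal.ofReal ((1 + |u i|) ^ (2 * κ₀ i)))⁻¹ := by
    rw [← ENNReal.prod_inv_distrib fun i _ j _ _ => Or.inr ENNReal.ofReal_ne_top,
      ← ENNReal.ofReal_prod_of_nonneg fun i _ => by positivity, ENNReal.inv_le_inv]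
    refine ENNReal.ofReal_le_ofReal ?_
    rw [Finsupp.degree_eq_sum, Finset.mul_sum, ← Finset.prod_pow_eq_pow_sum]
    refine Finset.prod_le_prod (fun i _ => by positivity) fun i _ => ?_
    gcongr
    exact PiLp.norm_apply_le u i
  have e4 : (s u : ℝ≥0∞)⁻¹ = ∏ i, (s' i (u i) : ℝ≥0∞)⁻¹ := by
    rw [hprod, ENNReal.ofNNReal_finsetProd,
      ENNReal.prod_inv_distrib fun i _ j _ _ => Or.inr ENNReal.coe_ne_top]
  rw [enorm_mul, mul_pow, e1, e2, e4]
  simp only [hH, Finset.prod_mul_distrib]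
  gcongr

end Cube

end LinearRigidity

theorem proposition3p9 {d : ℕ} (hd : 0 < d)
    {Ω : Type*} [MeasurableSpace Ω] (P : Measure Ω) [IsProbabilityMeasure P]
    (M : LinearRigidity.RandomMeasure d P) (hM : M.IsWideSenseStationary)
    (S : Measure (LinearRigidity.Space d)) (hS : M.IsSpectralMeasure S)
    (s : LinearRigidity.Space d → ℝ≥0) (hs : LinearRigidity.IsSpectralDensity S s)
    (κ : Fin d →₀ ℕ) (hκ : ¬ LinearRigidity.HasPoleOfOrder s 0 κ)
    (Q : MvPolynomial (Fin d) ℂ) (hQ : LinearRigidity.IsOrderPolynomial κ Q) :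
    (LinearRigidity.IsSimple s →
      ∀ η : ℝ, 0 < η → ¬ M.IsLinearlyRigid (Metric.ball 0 η) (LinearRigidity.polyFun Q)) ∧
    (LinearRigidity.IsIsotropic s →
      ∀ R : ℝ, 0 < R → ¬ M.IsMaximallyLinearlyRigid (Metric.closedBall 0 R) →
      ∀ η : ℝ, 0 < η → ¬ M.IsLinearlyRigid
        (Metric.thickening η (Metric.closedBall 0 R)) (LinearRigidity.polyFun Q)) ∧
    (LinearRigidity.IsSeparable s →
      ∀ R : ℝ, 0 < R → ¬ M.IsMaximallyLinearlyRigid (LinearRigidity.cube d R) →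
      ∀ η : ℝ, 0 < η → ¬ M.IsLinearlyRigid
        (Metric.thickening η (LinearRigidity.cube d R)) (LinearRigidity.polyFun Q)) := by
  obtain ⟨S', hs', hS'⟩ := LinearRigidity.exists_moment_measure hd M hM hS hs
  exact ⟨fun hsimple η hη =>
      LinearRigidity.not_isLinearlyRigid_of_isSimple M hs' hS' hκ hQ hsimple hη,
    fun hiso R hR hnot η hη =>
      LinearRigidity.not_isLinearlyRigid_of_isIsotropic hd M hs' hS' hκ hQ hiso hR hnot hη,
    fun hsep R hR hnot η hη =>
      LinearRigidity.not_isLinearlyRigid_of_isSeparable M hs' hS' hκ hQ hsep hR hnot hη⟩
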